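/- For each integer $N\ge 1$ let $\rho_N(x)=\int_{\Omega^{N-1}}P_N(x,x_2,\dots,x_N)\,dx_2\cdots dx_N$ be the one-point marginal of the joint eigenvalue probability density $$P_N(x_1,\dots,x_N)=\frac1{Z_N}\prod_{l=1}^N\omega_N(x_l)\prod_{1\le j<k\le N}(x_k-x_j)^2,\qquad x_l\in\Omega,$$ where $Z_N$ is the normalisation constant making $P_N$ a probability density on $\Omega^N$. In the GUE case $\Omega=\mathbb R$ and $\omega_N(x)=e^{-2Nx^2}$; in the LUE case with parameter $\alpha>-1$ (fixed, real), $\Omega=(0,\infty)$ and $\omega_N(x)=x^\alpha e^{-4Nx}$. **GUE.** Let $\rho(x)=\frac2\pi\sqrt{1-x^2}$ for $x\in[-1,1]$, $\rho(x)=0$ otherwise, and $P(x)=\int_{-1}^x\rho(t)\,dt$. Then for every fixed $x$ with $|x|<1$ one has $P(x)=1+\frac x2\rho(x)-\frac1\pi\arccos x$ and, as $N\to\infty$, $$\rho_N(x)=\rho(x)-\frac{2\cos[2N\pi P(x)]}{\pi^3\rho(x)^2}\,\frac1N+O\!\left(\frac1{N^2}\right).$$ **LUE.** Let $\rho(x)=\frac2\pi\sqrt{\frac1x-1}$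 for $x\in(0,1]$, $\rho(x)=0$ otherwise, and $P(x)=\int_0^x\rho(t)\,dt$. Then for every fixed $\alpha>-1$ and every fixed $x$ with $0<x<1$ one has $P(x)=1+x\rho(x)-\frac2\pi\arccos\sqrt x$ and, as $N\to\infty$, $$\rho_N(x)=\rho(x)-\left(\frac{\cos\bigl(2N\pi P(x)-\alpha\pi[1+x\rho(x)-P(x)]\bigr)}{\pi^3x^2\rho(x)^2}-\frac{\alpha}{\pi^2x\,\rho(x)}\right)\frac1N+O\!\left(\frac1{N^2}\right),$$ equivalently, $$\rho_N(x)=\rho(x)-\left(\frac{\cos\bigl(2N\pi P(x)-2\alpha\arccos\sqrt x\bigr)}{\pi^3x^2\rho(x)^2}-\frac{\alpha}{2\pi\sqrt{x(1-x)}}\right)\frac1N+O\!\left(\frac1{N^2}\right).$$ The constants implied by $O$ may depend on $x$ (and on $\alpha$ for the LUE), but not on $N$. -/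

import Mathlib

open MeasureTheory Filter Asymptotics

noncomputable section

/-- The unnormalised joint eigenvalue density
`∏ₗ w(xₗ) ∏_{j<k} (x_k - x_j)²` for a one-body weight `w`. -/
def jointWeight (w : ℝ → ℝ) (N : ℕ) (x : Fin N → ℝ) : ℝ :=
  (∏ l, w (x l)) * ∏ j, ∏ k ∈ Finset.Ioi j, (x k - x j) ^ 2

/-- The normalisation constant: the integral of `jointWeight` over `Ω^N`. -/
def partitionFunction (w : ℝ → ℝ) (Ω : Set ℝ) (N : ℕ) : ℝ :=
  ∫ x in Set.univ.pi (fun _ : Fin N => Ω), jointWeight w N x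

/-- The joint eigenvalue probability density function on `Ω^N`. -/
def jointDensity (w : ℝ → ℝ) (Ω : Set ℝ) (N : ℕ) (x : Fin N → ℝ) : ℝ :=
  jointWeight w N x / partitionFunction w Ω N

/-- The one-point marginal `ρ_N(x) = ∫_{Ω^{N-1}} P_N(x, x₂, …, x_N) dx₂ ⋯ dx_N`
of the joint eigenvalue density (there is no eigenvalue when `N = 0`). -/
def marginalDensity (w : ℝ → ℝ) (Ω : Set ℝ) : ℕ → ℝ → ℝ
  | 0, _ => 0
  | n + 1, x => ∫ y in Set.univ.pi (fun _ : Fin n => Ω),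
      jointDensity w Ω (n + 1) (Fin.cons x y : Fin (n + 1) → ℝ)

/-- The scaled GUE weight `exp(-2 N x²)`. -/
def gueWeight (N : ℕ) (x : ℝ) : ℝ := Real.exp (-2 * (N : ℝ) * x ^ 2)

/-- The scaled LUE weight `x^α exp(-4 N x)`. -/
def lueWeight (α : ℝ) (N : ℕ) (x : ℝ) : ℝ := x ^ α * Real.exp (-4 * (N : ℝ) * x)

/-- The GUE eigenvalue density `ρ_N`, with `Ω = ℝ`. -/
def gueDensity (N : ℕ) (x : ℝ) : ℝ := marginalDensity (gueWeight N) Set.univ N x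

/-- The LUE eigenvalue density `ρ_N`, with `Ω = (0, ∞)`. -/
def lueDensity (α : ℝ) (N : ℕ) (x : ℝ) : ℝ :=
  marginalDensity (lueWeight α N) (Set.Ioi 0) N x

open Classical in
/-- The Wigner semi-circle density on `[-1, 1]`. -/
def semicircle (x : ℝ) : ℝ :=
  if x ∈ Set.Icc (-1 : ℝ) 1 then 2 / Real.pi * Real.sqrt (1 - x ^ 2) else 0

open Classical in
/-- The Marčenko–Pastur density on `(0, 1]`. -/
def marcenkoPastur (x : ℝ) : ℝ :=
  if x ∈ Set.Ioc (0 : ℝ) 1 then 2 / Real.pi * Real.sqrt (1 / x - 1) else 0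

/-- The distribution function of the semi-circle density, integrated from the left edge `-1`. -/
def semicircleCdf (x : ℝ) : ℝ := ∫ t in (-1 : ℝ)..x, semicircle t

/-- The distribution function of the Marčenko–Pastur density, integrated from the left edge `0`. -/
def marcenkoPasturCdf (x : ℝ) : ℝ := ∫ t in (0 : ℝ)..x, marcenkoPastur t

end

/-! Both ensembles are determinantal. If `p k` are the monic orthogonal polynomials of the weight
and `h k` their squared norms, then ρ_N = (1/N) ∑_{k<N} w p_k²/h_k (`marginalDensity_eq_sum`), and
the diagonal Christoffel–Darboux identity reduces the sum to a quadratic form in p_N and p_N'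
(`laguerre_kernel`, `hermite_kernel`). It remains to know one oscillating function well enough that
the form is correct up to O(N⁻²).

Put L = 4N+2α+2 and write the Laguerre variable as s²/L. The Laguerre function, normalised to be 1
at 0, solves w'' + (2α+1)w'/s + (1 − s²/L²)w = 0 (`isRegularSolution_laguerre`), a perturbation of
Bessel's equation. The Liouville–Green variables (P, M) of w are compared with the Bessel pair (B,
B') taken at the phase ξ = L g(s/L), where g' = √(1−y²). A Gronwall estimate for the distance gives
an error O(s/L²), that is O(1/L) in the bulk (`liouville_comparison`). This is one order short for
the leading term, but the leading term of the density is √(1−y²)(M²+P²), which is essentially an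
energy. The energy M²+qP² varies only through the derivative of q, and so it agrees with the Bessel
energy up to O(L⁻²) (`liouville_energy_comparison`). Every other term of the form carries a factor
1/L, for which the weaker comparison is enough. The result is `exists_bound_densityForm`.

The amplitude and the phase of B at infinity come from the Laplace transform of t^(2α+1) w, which is
Γ(2α+2) p/(1+p²)^(α+3/2): its singularity at p = −i encodes the oscillation (`laplace_besselW`,
`exists_besselB_asymptotics`). The remaining normalisation is a quotient of gamma functions, centred
so that it is 1+O(N⁻²) (`gammaRatio_sub_one_isBigO`).

The GUE needs no new analysis: Hermite polynomials of even and odd degree are Laguerre polynomials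
in x² with parameter −1/2 and 1/2. The point x = 0, where this reduction degenerates, is computed
directly, and negative x follows by symmetry.

The form is evaluated at a point √(X/(1+d/N)) that moves with N. Expanding in d/N produces a
constant shift of the phase and the non-oscillating 1/N term. Up to affine constants g is the
limiting distribution function, which puts the phase into the stated shape. -/

/-! ### Orthogonal polynomial ensembles: the marginal as a diagonal kernel -/

/-- The joint weight as a double sum over permutations. -/
theorem jointWeight_mul_sq_eq_sum {w : ℝ → ℝ} {N : ℕ} {f : ℕ → ℝ → ℝ} {κ : ℝ} {x : Fin N → ℝ}
    (hdet : (∏ j, ∏ k ∈ Finset.Ioi j, (x k - x j)) * κ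
      = (Matrix.of fun i j : Fin N => f i (x j)).det) :
    jointWeight w N x * κ ^ 2 = ∑ σ : Equiv.Perm (Fin N), ∑ τ : Equiv.Perm (Fin N),
      ((Equiv.Perm.sign σ : ℤ) : ℝ) * ((Equiv.Perm.sign τ : ℤ) : ℝ) *
        ∏ i, (w (x i) * (f (σ i) (x i) * f (τ i) (x i))) := by
  have h1 : jointWeight w N x * κ ^ 2
      = (∏ l, w (x l)) * ((∏ j, ∏ k ∈ Finset.Ioi j, (x k - x j)) * κ) ^ 2 := by
    simp only [jointWeight, Finset.prod_pow]; ring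
  rw [h1, hdet, Matrix.det_apply', sq, Finset.sum_mul_sum, Finset.mul_sum]
  refine Finset.sum_congr rfl fun σ _ => ?_
  rw [Finset.mul_sum]
  refine Finset.sum_congr rfl fun τ _ => ?_
  simp only [Finset.prod_mul_distrib, Matrix.of_apply]
  ring

theorem Equiv.Perm.sum_apply_zero {n : ℕ} (F : Fin (n + 1) → ℝ) :
    ∑ σ : Equiv.Perm (Fin (n + 1)), F (σ 0) = (n.factorial : ℝ) * ∑ k, F k := by
  rw [← Equiv.Perm.decomposeFin.symm.sum_comp, Fintype.sum_prod_type]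
  simp [Fintype.card_perm, Finset.mul_sum]

theorem Equiv.Perm.eq_of_eq_on_succ {n : ℕ} {σ τ : Equiv.Perm (Fin (n + 1))}
    (h : ∀ i : Fin n, σ i.succ = τ i.succ) : σ = τ := by
  refine Equiv.ext fun i => ?_
  refine Fin.cases ?_ h i
  obtain ⟨j, hj⟩ := σ.surjective (τ 0)
  rcases Fin.eq_zero_or_eq_succ j with rfl | ⟨k, rfl⟩
  · exact hj
  · rw [h] at hj
    exact absurd (τ.injective hj) (Fin.succ_ne_zero k)

/-- Orthogonality forces σ and τ to agree at every index but 0, hence everywhere, so the signs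
multiply to 1. The weight at index 0 is left as a free matrix `F` so that the same count serves the
partition function and the marginal, where the first variable is not integrated. -/
theorem sum_sign_mul_prod_orthogonal {n : ℕ} (h : ℕ → ℝ) (hh : ∀ j, h j ≠ 0)
    (F : Fin (n + 1) → Fin (n + 1) → ℝ) :
    ∑ σ : Equiv.Perm (Fin (n + 1)), ∑ τ : Equiv.Perm (Fin (n + 1)),
      ((Equiv.Perm.sign σ : ℤ) : ℝ) * ((Equiv.Perm.sign τ : ℤ) : ℝ) *
        (F (σ 0) (τ 0) * ∏ i : Fin n,
          (if (σ i.succ : ℕ) = (τ i.succ : ℕ) then h (σ i.succ) else 0))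
      = (n.factorial : ℝ) * (∏ k : Fin (n + 1), h k) * ∑ k : Fin (n + 1), F k k / h k := by
  have key : ∀ σ : Equiv.Perm (Fin (n + 1)), ∑ τ : Equiv.Perm (Fin (n + 1)),
      ((Equiv.Perm.sign σ : ℤ) : ℝ) * ((Equiv.Perm.sign τ : ℤ) : ℝ) *
        (F (σ 0) (τ 0) * ∏ i : Fin n,
          (if (σ i.succ : ℕ) = (τ i.succ : ℕ) then h (σ i.succ) else 0))
      = (∏ k : Fin (n + 1), h k) * (F (σ 0) (σ 0) / h (σ 0)) := by
    intro σ
    rw [Finset.sum_eq_single σ]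
    · have h1 : ((Equiv.Perm.sign σ : ℤ) : ℝ) * ((Equiv.Perm.sign σ : ℤ) : ℝ) = 1 := by
        rw [← Int.cast_mul, ← Units.val_mul, Int.units_mul_self]; simp
      have h2 : ∏ k : Fin (n + 1), h k = h (σ 0) * ∏ i : Fin n, h (σ i.succ) := by
        rw [← Equiv.prod_comp σ, Fin.prod_univ_succ]
      rw [h1, h2]
      simp only [if_true]
      field_simp [hh]
    · intro τ _ hτ
      obtain ⟨i, hi⟩ : ∃ i : Fin n, σ i.succ ≠ τ i.succ := by
        by_contra hcon
        push Not at hcon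
        exact hτ (Equiv.Perm.eq_of_eq_on_succ hcon).symm
      rw [Finset.prod_eq_zero (Finset.mem_univ i)]
      · simp
      · rw [if_neg]
        exact fun hc => hi (Fin.ext hc)
    · simp
  simp only [key]
  rw [← Finset.mul_sum, Equiv.Perm.sum_apply_zero (fun k => F k k / h k)]
  ring

/-- The one-point marginal of an orthogonal polynomial ensemble. -/
theorem marginalDensity_eq_sum {w : ℝ → ℝ} {Ω : Set ℝ} {n : ℕ} {f : ℕ → ℝ → ℝ} {h : ℕ → ℝ}
    {κ : ℝ} (hκ : κ ≠ 0)
    (hdet : ∀ x : Fin (n + 1) → ℝ, (∏ j, ∏ k ∈ Finset.Ioi j, (x k - x j)) * κ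
      = (Matrix.of fun i j : Fin (n + 1) => f i (x j)).det)
    (hint : ∀ j k, IntegrableOn (fun t => w t * (f j t * f k t)) Ω)
    (horth : ∀ j k, ∫ t in Ω, w t * (f j t * f k t) = if j = k then h j else 0)
    (hh : ∀ j, h j ≠ 0) (x : ℝ) :
    marginalDensity w Ω (n + 1) x
      = 1 / ((n : ℝ) + 1) * ∑ k ∈ Finset.range (n + 1), w x * f k x ^ 2 / h k := by
  -- Numerator and denominator share the factor n! ∏ h, which cancels in the quotient. Here index 0
  -- is integrated too, so F is the diagonal matrix of the norms and its sum contributes n + 1.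
  have hZ : partitionFunction w Ω (n + 1) * κ ^ 2
      = (n.factorial : ℝ) * (∏ k : Fin (n + 1), h k) * ((n : ℝ) + 1) := by
    rw [partitionFunction, ← integral_mul_const, volume_pi, Measure.restrict_pi_pi]
    simp_rw [jointWeight_mul_sq_eq_sum (hdet _)]
    have hI : ∀ σ τ : Equiv.Perm (Fin (n + 1)), Integrable (fun y : Fin (n + 1) → ℝ =>
        ((Equiv.Perm.sign σ : ℤ) : ℝ) * ((Equiv.Perm.sign τ : ℤ) : ℝ) *
          ∏ i, (w (y i) * (f (σ i) (y i) * f (τ i) (y i))))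
        (Measure.pi fun _ => volume.restrict Ω) := fun σ τ =>
      (Integrable.fintype_prod (f := fun i t => w t * (f (σ i) t * f (τ i) t))
        fun i => hint _ _).const_mul _
    rw [integral_finsetSum _ fun σ _ => integrable_finsetSum _ fun τ _ => hI σ τ]
    simp_rw [integral_finsetSum _ fun τ _ => hI _ τ, integral_const_mul]
    have h3 : ∀ σ τ : Equiv.Perm (Fin (n + 1)),
        ∫ y : Fin (n + 1) → ℝ, ∏ i, (w (y i) * (f (σ i) (y i) * f (τ i) (y i)))
          ∂(Measure.pi fun _ => volume.restrict Ω)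
        = (fun a b : Fin (n + 1) => if (a : ℕ) = b then h a else 0) (σ 0) (τ 0) *
          ∏ i : Fin n, (if (σ i.succ : ℕ) = (τ i.succ : ℕ) then h (σ i.succ) else 0) := by
      intro σ τ
      rw [integral_fintype_prod_eq_prod (fun i t => w t * (f (σ i) t * f (τ i) t))]
      simp_rw [horth]
      rw [Fin.prod_univ_succ]
    simp_rw [h3]
    refine (sum_sign_mul_prod_orthogonal h hh
      fun a b => if (a : ℕ) = b then h a else 0).trans ?_
    simp [hh]
  have hnum : (∫ y in Set.univ.pi (fun _ : Fin n => Ω),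
      jointWeight w (n + 1) (Fin.cons x y : Fin (n + 1) → ℝ)) * κ ^ 2
      = (n.factorial : ℝ) * (∏ k : Fin (n + 1), h k) *
        ∑ k : Fin (n + 1), w x * (f k x * f k x) / h k := by
    rw [← integral_mul_const, volume_pi, Measure.restrict_pi_pi]
    simp_rw [jointWeight_mul_sq_eq_sum (hdet _)]
    simp_rw [Fin.prod_univ_succ, Fin.cons_zero, Fin.cons_succ]
    have hI : ∀ σ τ : Equiv.Perm (Fin (n + 1)), Integrable (fun y : Fin n → ℝ =>
        ((Equiv.Perm.sign σ : ℤ) : ℝ) * ((Equiv.Perm.sign τ : ℤ) : ℝ) *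
          (w x * (f (σ 0) x * f (τ 0) x) *
          ∏ i : Fin n, (w (y i) * (f (σ i.succ) (y i) * f (τ i.succ) (y i)))))
        (Measure.pi fun _ => volume.restrict Ω) := fun σ τ =>
      ((Integrable.fintype_prod (f := fun i t => w t * (f (σ (Fin.succ i)) t * f (τ i.succ) t))
        fun i => hint _ _).const_mul _).const_mul _
    rw [integral_finsetSum _ fun σ _ => integrable_finsetSum _ fun τ _ => hI σ τ]
    simp_rw [integral_finsetSum _ fun τ _ => hI _ τ, integral_const_mul]
    have h3 : ∀ σ τ : Equiv.Perm (Fin (n + 1)),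
        ∫ y : Fin n → ℝ, ∏ i : Fin n, (w (y i) * (f (σ i.succ) (y i) * f (τ i.succ) (y i)))
          ∂(Measure.pi fun _ => volume.restrict Ω)
        = ∏ i : Fin n, (if (σ i.succ : ℕ) = (τ i.succ : ℕ) then h (σ i.succ) else 0) := by
      intro σ τ
      rw [integral_fintype_prod_eq_prod (fun i t => w t * (f (σ (Fin.succ i)) t * f (τ i.succ) t))]
      simp_rw [horth]
    simp_rw [h3]
    rw [← Fin.prod_univ_succ (fun k : Fin (n + 1) => h k)]
    exact sum_sign_mul_prod_orthogonal h hh fun a b => w x * (f a x * f b x)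
  have hZ0 : partitionFunction w Ω (n + 1) ≠ 0 := by
    intro h0
    rw [h0, zero_mul] at hZ
    have h1 : (∏ k : Fin (n + 1), h k) ≠ 0 := Finset.prod_ne_zero_iff.mpr fun k _ => hh k
    have h2 : ((n : ℝ) + 1) ≠ 0 := by positivity
    have h3 : (n.factorial : ℝ) ≠ 0 := by positivity
    exact mul_ne_zero (mul_ne_zero h3 h1) h2 hZ.symm
  have hprod : (∏ k : Fin (n + 1), h k) ≠ 0 := Finset.prod_ne_zero_iff.mpr fun k _ => hh k
  have h2 : ((n : ℝ) + 1) ≠ 0 := by positivity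
  have h3 : (n.factorial : ℝ) ≠ 0 := by positivity
  simp only [marginalDensity, jointDensity]
  rw [integral_div, ← mul_div_mul_right _ _ (pow_ne_zero 2 hκ), hnum, hZ,
    Finset.sum_range fun k => w x * f k x ^ 2 / h k]
  simp_rw [sq]
  field_simp

/-! ### Monic Laguerre and Hermite polynomials: differential equations, norms, Christoffel–Darboux
sums -/

open Polynomial in
/-- Monic Laguerre polynomials. -/
noncomputable def laguerreMonic (α : ℝ) : ℕ → ℝ[X]
  | 0 => 1
  | n + 1 => (X - C ((n : ℝ) + α + 1)) * laguerreMonic α n - X * derivative (laguerreMonic α n)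

open Polynomial in
/-- Monic Hermite polynomials for the weight `exp (-x²)`. -/
noncomputable def hermiteMonic : ℕ → ℝ[X]
  | 0 => 1
  | n + 1 => X * hermiteMonic n - C (1 / 2 : ℝ) * derivative (hermiteMonic n)

section Algebra
open Polynomial

theorem Polynomial.monic_natDegree_X_mul_sub {p q : ℝ[X]} {n : ℕ} (hp : p.Monic)
    (hn : p.natDegree = n) (hq : q.degree < ((n + 1 : ℕ) : WithBot ℕ)) :
    (X * p + q).Monic ∧ (X * p + q).natDegree = n + 1 := by
  have h1 : (X * p).Monic := monic_X.mul hp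
  have h2 : (X * p).natDegree = n + 1 := by
    rw [monic_X.natDegree_mul hp, natDegree_X, hn, add_comm]
  have h3 : (X * p).degree = ((n + 1 : ℕ) : WithBot ℕ) := by rw [degree_eq_natDegree h1.ne_zero, h2]
  have h4 : q.degree < (X * p).degree := by rw [h3]; exact hq
  exact ⟨h1.add_of_left h4, by rw [natDegree_eq_of_degree_eq (degree_add_eq_left_of_degree_lt h4), h2]⟩

theorem laguerreMonic_monic (α : ℝ) (n : ℕ) :
    (laguerreMonic α n).Monic ∧ (laguerreMonic α n).natDegree = n := by
  induction n with
  | zero => simp [laguerreMonic]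
  | succ n ih =>
    have h : laguerreMonic α (n + 1) = X * laguerreMonic α n +
        (-(C ((n : ℝ) + α + 1) * laguerreMonic α n + X * derivative (laguerreMonic α n))) := by
      rw [laguerreMonic]; ring
    rw [h]
    refine Polynomial.monic_natDegree_X_mul_sub ih.1 ih.2 ?_
    rw [degree_neg]
    refine (degree_lt_iff_coeff_zero _ _).mpr fun m hm => ?_
    have h0 : ∀ k, n < k → (laguerreMonic α n).coeff k = 0 := fun k hk =>
      coeff_eq_zero_of_natDegree_lt (by rw [ih.2]; exact hk)
    obtain ⟨m, rfl⟩ : ∃ k, m = k + 1 := ⟨m - 1, by omega⟩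
    rw [coeff_add, coeff_C_mul, coeff_X_mul, coeff_derivative, h0 (m + 1) (by omega)]
    simp

theorem hermiteMonic_monic (n : ℕ) :
    (hermiteMonic n).Monic ∧ (hermiteMonic n).natDegree = n := by
  induction n with
  | zero => simp [hermiteMonic]
  | succ n ih =>
    have h : hermiteMonic (n + 1) = X * hermiteMonic n +
        (-(C (1 / 2 : ℝ) * derivative (hermiteMonic n))) := by
      rw [hermiteMonic]; ring
    rw [h]
    refine Polynomial.monic_natDegree_X_mul_sub ih.1 ih.2 ?_
    rw [degree_neg]
    refine (degree_lt_iff_coeff_zero _ _).mpr fun m hm => ?_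
    have h0 : ∀ k, n < k → (hermiteMonic n).coeff k = 0 := fun k hk =>
      coeff_eq_zero_of_natDegree_lt (by rw [ih.2]; exact hk)
    rw [coeff_C_mul, coeff_derivative, h0 (m + 1) (by omega)]
    simp

/-- The two facts are proved together: differentiating the defining recursion and using the equation
in degree n gives the derivative in degree n + 1, and this derivative formula carries the equation
from degree n to degree n + 1. -/
theorem laguerreMonic_ode_and_derivative (α : ℝ) (n : ℕ) :
    X * derivative (derivative (laguerreMonic α n)) + (C (α + 1) - X) * derivative (laguerreMonic α n)
      + C (n : ℝ) * laguerreMonic α n = 0 ∧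
    derivative (laguerreMonic α (n + 1))
      = C ((n : ℝ) + 1) * (laguerreMonic α n - derivative (laguerreMonic α n)) := by
  have step : ∀ m : ℕ, X * derivative (derivative (laguerreMonic α m))
      + (C (α + 1) - X) * derivative (laguerreMonic α m) + C (m : ℝ) * laguerreMonic α m = 0 →
      derivative (laguerreMonic α (m + 1))
      = C ((m : ℝ) + 1) * (laguerreMonic α m - derivative (laguerreMonic α m)) := by
    intro m hm
    rw [laguerreMonic]
    simp only [derivative_sub, derivative_mul, derivative_X, derivative_C, map_add, map_one,
      derivative_one] at hm ⊢
    linear_combination -hm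
  induction n with
  | zero => exact ⟨by simp [laguerreMonic], step 0 (by simp [laguerreMonic])⟩
  | succ n ih =>
    refine ⟨?_, step (n + 1) ?_⟩ <;>
    · obtain ⟨h1, h2⟩ := ih
      rw [h2]
      simp only [derivative_mul, derivative_C, derivative_sub, map_add, map_one, Nat.cast_add,
        Nat.cast_one, derivative_one] at h1 h2 ⊢
      rw [laguerreMonic]
      simp only [map_add, map_one]
      linear_combination -(C (n : ℝ) + 1) * h1

theorem laguerreMonic_ode (α : ℝ) (n : ℕ) (x : ℝ) :
    x * (derivative (derivative (laguerreMonic α n))).eval x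
      + (α + 1 - x) * (derivative (laguerreMonic α n)).eval x
      + n * (laguerreMonic α n).eval x = 0 := by
  have := congrArg (eval x) (laguerreMonic_ode_and_derivative α n).1
  simpa using this

theorem derivative_hermiteMonic (n : ℕ) :
    derivative (hermiteMonic (n + 1)) = C ((n : ℝ) + 1) * hermiteMonic n := by
  induction n with
  | zero => simp [hermiteMonic]
  | succ n ih =>
    rw [hermiteMonic, derivative_sub, derivative_mul, derivative_mul, ih, hermiteMonic]
    simp only [derivative_mul, derivative_C, derivative_X, map_add, map_one, Nat.cast_add,
      Nat.cast_one, derivative_one]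
    ring

/-- The squared norm of the monic Laguerre polynomial. -/
noncomputable def laguerreNorm (α : ℝ) (n : ℕ) : ℝ := n.factorial * Real.Gamma (n + α + 1)

/-- The squared norm of the monic Hermite polynomial. -/
noncomputable def hermiteNorm (n : ℕ) : ℝ := n.factorial / 2 ^ n * √Real.pi

theorem laguerreNorm_pos {α : ℝ} (hα : -1 < α) (n : ℕ) : 0 < laguerreNorm α n := by
  have : 0 < Real.Gamma (n + α + 1) :=
    Real.Gamma_pos_of_pos (by have : (0 : ℝ) ≤ n := n.cast_nonneg; linarith)
  unfold laguerreNorm; positivity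

theorem laguerreNorm_succ {α : ℝ} (hα : -1 < α) (n : ℕ) :
    laguerreNorm α (n + 1) = (n + 1) * (n + α + 1) * laguerreNorm α n := by
  have h0 : (n : ℝ) + α + 1 ≠ 0 := by have : (0 : ℝ) ≤ n := n.cast_nonneg; linarith
  have h : ((n + 1 : ℕ) : ℝ) + α + 1 = (n + α + 1) + 1 := by push_cast; ring
  rw [laguerreNorm, laguerreNorm, h, Real.Gamma_add_one h0, Nat.factorial_succ]
  push_cast; ring

theorem hermiteNorm_pos (n : ℕ) : 0 < hermiteNorm n := by
  unfold hermiteNorm; positivity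

theorem hermiteNorm_succ (n : ℕ) : hermiteNorm (n + 1) = (n + 1) / 2 * hermiteNorm n := by
  rw [hermiteNorm, hermiteNorm, Nat.factorial_succ]
  push_cast; rw [pow_succ]; field_simp

/-- Christoffel–Darboux kernel on the diagonal in terms of the top Laguerre polynomial. -/
theorem laguerre_kernel {α : ℝ} (hα : -1 < α) (N : ℕ) (x : ℝ) :
    x * ∑ k ∈ Finset.range N, (laguerreMonic α k).eval x ^ 2 / laguerreNorm α k
      = ((x * (derivative (laguerreMonic α N)).eval x) ^ 2
        - (x - α) * (laguerreMonic α N).eval x * (x * (derivative (laguerreMonic α N)).eval x)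
        + N * x * (laguerreMonic α N).eval x ^ 2) / laguerreNorm α N := by
  induction N with
  | zero => simp [laguerreMonic]
  | succ N ih =>
    -- No three-term recurrence is needed: the polynomial of degree N + 1 and its derivative are
    -- both expressed through those of degree N, so the inductive step is a rational identity in the
    -- value and the derivative.
    rw [Finset.sum_range_succ, mul_add, ih, laguerreNorm_succ hα,
      (laguerreMonic_ode_and_derivative α N).2, laguerreMonic]
    have h0 : (N : ℝ) + α + 1 ≠ 0 := by have : (0 : ℝ) ≤ N := N.cast_nonneg; linarith
    have h1 := (laguerreNorm_pos hα N).ne'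
    have h2 : (N : ℝ) + 1 ≠ 0 := by positivity
    simp only [eval_sub, eval_mul, eval_X, eval_C]
    push_cast
    field_simp
    ring

theorem hermite_kernel (N : ℕ) (x : ℝ) :
    ∑ k ∈ Finset.range N, (hermiteMonic k).eval x ^ 2 / hermiteNorm k
      = ((derivative (hermiteMonic N)).eval x ^ 2 / 2
        - x * (hermiteMonic N).eval x * (derivative (hermiteMonic N)).eval x
        + N * (hermiteMonic N).eval x ^ 2) / hermiteNorm N := by
  induction N with
  | zero => simp [hermiteMonic]
  | succ N ih =>
    rw [Finset.sum_range_succ, ih, hermiteNorm_succ, derivative_hermiteMonic, hermiteMonic]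
    have h1 := (hermiteNorm_pos N).ne'
    have h2 : (N : ℝ) + 1 ≠ 0 := by positivity
    simp only [eval_sub, eval_mul, eval_X, eval_C]
    push_cast
    field_simp
    ring

theorem laguerreMonic_eval_zero {α : ℝ} (hα : -1 < α) (n : ℕ) :
    (laguerreMonic α n).eval 0 = (-1) ^ n * (Real.Gamma (n + α + 1) / Real.Gamma (α + 1)) := by
  induction n with
  | zero =>
    have : Real.Gamma (α + 1) ≠ 0 := (Real.Gamma_pos_of_pos (by linarith)).ne'
    simp [laguerreMonic, this]
  | succ n ih =>
    have h0 : (n : ℝ) + α + 1 ≠ 0 := by have : (0 : ℝ) ≤ n := n.cast_nonneg; linarith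
    have h : ((n + 1 : ℕ) : ℝ) + α + 1 = (n + α + 1) + 1 := by push_cast; ring
    rw [laguerreMonic, h, Real.Gamma_add_one h0]
    simp only [eval_sub, eval_mul, eval_X, eval_C, ih]
    ring

end Algebra

/-! ### Orthogonality from the recursion of the moments -/

section Moments
open Polynomial

/-- Integration of polynomials against a weight with finite moments. -/
noncomputable def momentFunctional (w : ℝ → ℝ) (Ω : Set ℝ)
    (h : ∀ q : ℝ[X], IntegrableOn (fun t => w t * q.eval t) Ω) : ℝ[X] →ₗ[ℝ] ℝ where
  toFun q := ∫ t in Ω, w t * q.eval t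
  map_add' p q := by
    rw [← integral_add (h p) (h q)]
    simp [mul_add]
  map_smul' c q := by
    rw [RingHom.id_apply, smul_eq_mul, ← integral_const_mul]
    simp only [eval_smul, smul_eq_mul]
    congr 1; ext t; ring

theorem integrableOn_weight_mul_eval {w : ℝ → ℝ} {Ω : Set ℝ}
    (h : ∀ k : ℕ, IntegrableOn (fun t => w t * t ^ k) Ω) (q : ℝ[X]) :
    IntegrableOn (fun t => w t * q.eval t) Ω := by
  simp_rw [eval_eq_sum_range, Finset.mul_sum]
  refine integrable_finsetSum _ fun k _ => ?_
  refine ((h k).const_mul (q.coeff k)).congr (Eventually.of_forall fun t => ?_)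
  simp only; ring

/-- Only the top monomial of `q` survives against `p`. This one formula yields both the
orthogonality (top coefficient 0) and the norm (top coefficient 1). -/
theorem LinearMap.apply_mul_eq_of_apply_X_pow_mul_eq_zero (M : ℝ[X] →ₗ[ℝ] ℝ) {p q : ℝ[X]} {n : ℕ}
    (h : ∀ k < n, M (X ^ k * p) = 0) (hq : q.natDegree ≤ n) :
    M (q * p) = q.coeff n * M (X ^ n * p) := by
  conv_lhs => rw [q.as_sum_range' (n + 1) (by omega)]
  rw [Finset.sum_mul, map_sum, Finset.sum_range_succ, Finset.sum_eq_zero, zero_add]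
  · rw [← C_mul_X_pow_eq_monomial, mul_assoc, ← smul_eq_C_mul, map_smul, smul_eq_mul]
  · intro k hk
    rw [← C_mul_X_pow_eq_monomial, mul_assoc, ← smul_eq_C_mul, map_smul,
      h k (Finset.mem_range.mp hk), smul_zero]

/-- Orthogonality relations from the vanishing of the low moments. -/
theorem LinearMap.orthogonal_of_apply_X_pow_mul (M : ℝ[X] →ₗ[ℝ] ℝ) {p : ℕ → ℝ[X]} {h : ℕ → ℝ}
    (hp : ∀ n, (p n).Monic ∧ (p n).natDegree = n)
    (hM : ∀ n, ∀ k < n, M (X ^ k * p n) = 0) (hn : ∀ n, M (X ^ n * p n) = h n) (j k : ℕ) :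
    M (p j * p k) = if j = k then h j else 0 := by
  have key : ∀ j k, j < k → M (p j * p k) = 0 := by
    intro j k hjk
    rw [M.apply_mul_eq_of_apply_X_pow_mul_eq_zero (hM k) (by rw [(hp j).2]; exact hjk.le),
      coeff_eq_zero_of_natDegree_lt (by rw [(hp j).2]; exact hjk), zero_mul]
  rcases lt_trichotomy j k with hjk | rfl | hjk
  · rw [key j k hjk, if_neg hjk.ne]
  · rw [if_pos rfl, M.apply_mul_eq_of_apply_X_pow_mul_eq_zero (hM j) (hp j).2.le, hn]
    have := (hp j).1.coeff_natDegree
    rw [(hp j).2] at this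
    rw [this, one_mul]
  · rw [mul_comm, key k j hjk, if_neg hjk.ne']

/-- The moment recursion is integration by parts in algebraic form, M(X q') = M(X q) − (α+1) M(q).
Applied to X^k times a Laguerre polynomial, it shows that raising the degree from n to n + 1
multiplies by k − n. The product therefore vanishes for k < n and equals n! for k = n. -/
theorem laguerre_functional {α : ℝ} (M : ℝ[X] →ₗ[ℝ] ℝ)
    (hM : ∀ k : ℕ, M (X ^ (k + 1)) = (α + 1 + k) * M (X ^ k)) (n k : ℕ) :
    M (X ^ k * laguerreMonic α n) = (∏ j ∈ Finset.range n, ((k : ℝ) - j)) * M (X ^ k) := by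
  have ibp : ∀ q : ℝ[X], M (X * derivative q) = M (X * q) - (α + 1) * M q := by
    intro q
    induction q using Polynomial.induction_on' with
    | add p q hp hq =>
      rw [derivative_add, mul_add, map_add, hp, hq, mul_add, map_add, map_add]; ring
    | monomial m a =>
      rcases m with _ | m
      · have h1 : X * derivative (monomial 0 a : ℝ[X]) = 0 := by simp
        have h2 : X * (monomial 0 a : ℝ[X]) = a • X ^ (0 + 1) := by
          rw [monomial_zero_left, smul_eq_C_mul]; ring
        have h3 : (monomial 0 a : ℝ[X]) = a • X ^ 0 := by
          rw [monomial_zero_left, smul_eq_C_mul]; ring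
        rw [h1, h2, h3, map_smul, map_smul, hM, map_zero]
        simp; ring
      · have h1 : X * derivative (monomial (m + 1) a : ℝ[X]) = (a * (m + 1)) • X ^ (m + 1) := by
          rw [derivative_monomial, ← C_mul_X_pow_eq_monomial, smul_eq_C_mul]
          simp; ring
        have h2 : X * (monomial (m + 1) a : ℝ[X]) = a • X ^ (m + 1 + 1) := by
          rw [← C_mul_X_pow_eq_monomial, smul_eq_C_mul]; ring
        have h3 : (monomial (m + 1) a : ℝ[X]) = a • X ^ (m + 1) := by
          rw [← C_mul_X_pow_eq_monomial, smul_eq_C_mul]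
        rw [h1, h2, h3, map_smul, map_smul, map_smul, hM (m + 1)]
        simp; ring
  induction n with
  | zero => simp [laguerreMonic]
  | succ n ih =>
    have h1 := ibp (X ^ k * laguerreMonic α n)
    have h2 : X * derivative (X ^ k * laguerreMonic α n)
        = (k : ℝ) • (X ^ k * laguerreMonic α n)
          + X ^ k * (X * derivative (laguerreMonic α n)) := by
      rw [derivative_mul, derivative_X_pow, smul_eq_C_mul]
      rcases k with _ | k
      · simp
      · simp; ring
    have h3 : X ^ k * laguerreMonic α (n + 1)
        = X * (X ^ k * laguerreMonic α n) - ((n : ℝ) + α + 1) • (X ^ k * laguerreMonic α n)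
          - X ^ k * (X * derivative (laguerreMonic α n)) := by
      rw [laguerreMonic, smul_eq_C_mul]; ring
    rw [h2, map_add, map_smul, smul_eq_mul] at h1
    rw [h3, map_sub, map_sub, map_smul, smul_eq_mul, Finset.prod_range_succ]
    linear_combination (-1 : ℝ) * h1 + ((k : ℝ) - n) * ih

/-- The moment recursion amounts to M(q') = 2 M(X q). Each raising of the degree lowers the
accompanying power of X by one and contributes k/2. -/
theorem hermite_functional (M : ℝ[X] →ₗ[ℝ] ℝ) (hM1 : M X = 0)
    (hM : ∀ k : ℕ, M (X ^ (k + 2)) = (k + 1) / 2 * M (X ^ k)) (n : ℕ) :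
    (∀ k < n, M (X ^ k * hermiteMonic n) = 0) ∧
      M (X ^ n * hermiteMonic n) = n.factorial / 2 ^ n * M 1 := by
  have ibp : ∀ q : ℝ[X], M (derivative q) = 2 * M (X * q) := by
    intro q
    induction q using Polynomial.induction_on' with
    | add p q hp hq => rw [derivative_add, map_add, hp, hq, mul_add, map_add]; ring
    | monomial m a =>
      rcases m with _ | m
      · have h2 : X * (monomial 0 a : ℝ[X]) = a • X := by
          rw [monomial_zero_left, smul_eq_C_mul]; ring
        rw [h2, map_smul, hM1]; simp
      · have h1 : derivative (monomial (m + 1) a : ℝ[X]) = (a * (m + 1)) • X ^ m := by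
          rw [derivative_monomial, ← C_mul_X_pow_eq_monomial, smul_eq_C_mul]
          simp
        have h2 : X * (monomial (m + 1) a : ℝ[X]) = a • X ^ (m + 2) := by
          rw [← C_mul_X_pow_eq_monomial, smul_eq_C_mul]; ring
        rw [h1, h2, map_smul, map_smul, hM, smul_eq_mul, smul_eq_mul]; ring
  -- The truncated `k - 1` at k = 0 is harmless, since the factor k/2 vanishes there.
  have step : ∀ n k : ℕ, M (X ^ k * hermiteMonic (n + 1))
      = (k : ℝ) / 2 * M (X ^ (k - 1) * hermiteMonic n) := by
    intro n k
    have h1 := ibp (X ^ k * hermiteMonic n)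
    have h2 : derivative (X ^ k * hermiteMonic n) = (k : ℝ) • (X ^ (k - 1) * hermiteMonic n)
        + X ^ k * derivative (hermiteMonic n) := by
      rw [derivative_mul, derivative_X_pow, smul_eq_C_mul]; simp; ring
    have h3 : X ^ k * hermiteMonic (n + 1) = X * (X ^ k * hermiteMonic n)
        - (1 / 2 : ℝ) • (X ^ k * derivative (hermiteMonic n)) := by
      rw [hermiteMonic, smul_eq_C_mul]; ring
    rw [h2, map_add, map_smul, smul_eq_mul] at h1
    rw [h3, map_sub, map_smul, smul_eq_mul]
    linear_combination (-1 / 2 : ℝ) * h1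
  induction n with
  | zero => simp [hermiteMonic]
  | succ n ih =>
    refine ⟨fun k hk => ?_, ?_⟩
    · rw [step]
      rcases k with _ | k
      · simp
      · rw [Nat.add_sub_cancel, ih.1 k (by omega), mul_zero]
    · rw [step, Nat.add_sub_cancel, ih.2, Nat.factorial_succ, pow_succ]
      push_cast; ring

end Moments

/-! ### The GUE and LUE densities as sums over fixed polynomials -/

section Density
open Polynomial

/-- The weights depend on N only through a dilation, so the dilation is moved into the argument of
polynomials that do not depend on N. The constant `c` and the dilation factor of the Vandermonde
product drop out by normalisation; the Jacobian `a` remains. -/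
theorem marginalDensity_comp_mul {w : ℝ → ℝ} {Ω : Set ℝ} (hΩ : MeasurableSet Ω) {a c : ℝ}
    (ha : 0 < a) (hc : c ≠ 0) (hΩa : ∀ t, a * t ∈ Ω ↔ t ∈ Ω) {p : ℕ → ℝ[X]} {h : ℕ → ℝ}
    (hp : ∀ n, (p n).Monic ∧ (p n).natDegree = n)
    (hint : ∀ q : ℝ[X], IntegrableOn (fun t => w t * q.eval t) Ω)
    (horth : ∀ j k, ∫ t in Ω, w t * (p j * p k).eval t = if j = k then h j else 0)
    (hh : ∀ j, h j ≠ 0) (n : ℕ) (x : ℝ) :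
    marginalDensity (fun t => c * w (a * t)) Ω (n + 1) x
      = a / ((n : ℝ) + 1) * ∑ k ∈ Finset.range (n + 1), w (a * x) * (p k).eval (a * x) ^ 2 / h k := by
  have hind : ∀ F : ℝ → ℝ, Ω.indicator (fun t => F (a * t)) = fun t => Ω.indicator F (a * t) := by
    intro F; ext t
    by_cases ht : t ∈ Ω
    · rw [Set.indicator_of_mem ht, Set.indicator_of_mem ((hΩa t).2 ht)]
    · rw [Set.indicator_of_notMem ht, Set.indicator_of_notMem (fun h' => ht ((hΩa t).1 h'))]
  have hform : ∀ j k, (fun t => c * w (a * t) * ((p j).eval (a * t) * (p k).eval (a * t)))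
      = fun t => c * (fun s => w s * (p j * p k).eval s) (a * t) := by
    intro j k; ext t; simp only [eval_mul]; ring
  have hcomp : ∀ F : ℝ → ℝ, ∫ t in Ω, F (a * t) = a⁻¹ * ∫ t in Ω, F t := by
    intro F
    rw [← integral_indicator hΩ, hind, Measure.integral_comp_mul_left, integral_indicator hΩ,
      abs_of_pos (inv_pos.mpr ha), smul_eq_mul]
  have hκ : (∏ j : Fin (n + 1), ∏ _k ∈ Finset.Ioi j, a) ≠ 0 :=
    Finset.prod_ne_zero_iff.mpr fun j _ => Finset.prod_ne_zero_iff.mpr fun _ _ => ha.ne'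
  rw [marginalDensity_eq_sum (f := fun k t => (p k).eval (a * t)) (h := fun k => c * a⁻¹ * h k)
    hκ]
  · have : ∀ k, c * w (a * x) * (p k).eval (a * x) ^ 2 / (c * a⁻¹ * h k)
        = a * (w (a * x) * (p k).eval (a * x) ^ 2 / h k) := by
      intro k; have := hh k; field_simp
    simp_rw [this]
    rw [← Finset.mul_sum]; ring
  · intro y
    have h1 := Matrix.det_eval_matrixOfPolynomials_eq_det_vandermonde (fun i => a * y i)
      (fun i : Fin (n + 1) => p i) (fun i => (hp i).2) (fun i => (hp i).1)
    rw [Matrix.det_vandermonde] at h1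
    rw [← Matrix.det_transpose, ← Finset.prod_mul_distrib]
    simp_rw [← Finset.prod_mul_distrib]
    refine Eq.trans ?_ (h1.trans ?_)
    · refine Finset.prod_congr rfl fun j _ => Finset.prod_congr rfl fun k _ => by ring
    · rfl
  · intro j k
    rw [hform]
    refine Integrable.const_mul ?_ c
    rw [← IntegrableOn, ← integrable_indicator_iff hΩ,
      hind fun s => w s * (p j * p k).eval s]
    exact ((integrable_indicator_iff hΩ).mpr (hint (p j * p k))).comp_mul_left' ha.ne'
  · intro j k
    rw [hform, integral_const_mul, hcomp fun s => w s * (p j * p k).eval s, horth]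
    split_ifs <;> ring
  · intro j
    exact mul_ne_zero (mul_ne_zero hc (inv_ne_zero ha.ne')) (hh j)

theorem laguerre_moment {α : ℝ} (hα : -1 < α) (k : ℕ) :
    IntegrableOn (fun t => t ^ α * Real.exp (-t) * t ^ k) (Set.Ioi 0) ∧
    ∫ t in Set.Ioi (0 : ℝ), t ^ α * Real.exp (-t) * t ^ k = Real.Gamma (k + α + 1) := by
  have hpos : 0 < (k : ℝ) + α + 1 := by have : (0 : ℝ) ≤ k := k.cast_nonneg; linarith
  have hfun : Set.EqOn (fun t : ℝ => Real.exp (-t) * t ^ ((k : ℝ) + α + 1 - 1))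
      (fun t => t ^ α * Real.exp (-t) * t ^ k) (Set.Ioi 0) := by
    intro t ht
    have ht' : (0 : ℝ) < t := ht
    simp only
    rw [add_sub_cancel_right, Real.rpow_add ht', Real.rpow_natCast]; ring
  refine ⟨(Real.GammaIntegral_convergent hpos).congr_fun hfun measurableSet_Ioi, ?_⟩
  rw [Real.Gamma_eq_integral hpos, setIntegral_congr_fun measurableSet_Ioi hfun]

theorem lueDensity_eq_sum {α : ℝ} (hα : -1 < α) {N : ℕ} (hN : 0 < N) {x : ℝ} (hx : 0 < x) :
    lueDensity α N x = 4 * ((4 * N * x) ^ α * Real.exp (-(4 * N * x)) *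
      ∑ k ∈ Finset.range N, (laguerreMonic α k).eval (4 * N * x) ^ 2 / laguerreNorm α k) := by
  obtain ⟨n, rfl⟩ : ∃ n, N = n + 1 := ⟨N - 1, by omega⟩
  set a : ℝ := 4 * ((n + 1 : ℕ) : ℝ) with ha_def
  have ha : 0 < a := by positivity
  have hint := integrableOn_weight_mul_eval (w := fun t => t ^ α * Real.exp (-t))
    fun k => (laguerre_moment hα k).1
  have hfunctional := laguerre_functional (α := α) (momentFunctional _ _ hint) (by
    intro k
    have h1 : ∀ k : ℕ, momentFunctional _ _ hint (X ^ k) = Real.Gamma (k + α + 1) := by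
      intro k
      rw [← (laguerre_moment hα k).2]
      simp [momentFunctional]
    have h0 : (k : ℝ) + α + 1 ≠ 0 := by have : (0 : ℝ) ≤ k := k.cast_nonneg; linarith
    rw [h1, h1, show ((k + 1 : ℕ) : ℝ) + α + 1 = (k + α + 1) + 1 by push_cast; ring,
      Real.Gamma_add_one h0]; ring)
  have horth := (momentFunctional _ _ hint).orthogonal_of_apply_X_pow_mul
    (h := laguerreNorm α) (laguerreMonic_monic α)
    (by
      intro m k hk
      rw [hfunctional, Finset.prod_eq_zero (Finset.mem_range.mpr hk) (sub_self _), zero_mul])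
    (by
      intro m
      have h1 : momentFunctional _ _ hint (X ^ m) = Real.Gamma (m + α + 1) := by
        rw [← (laguerre_moment hα m).2]
        simp [momentFunctional]
      rw [hfunctional, h1, laguerreNorm]
      congr 1
      -- The factors m − j for j < m, read in reverse order, are those of m!.
      rw [← Finset.prod_range_reflect, ← Finset.prod_range_add_one_eq_factorial, Nat.cast_prod]
      refine Finset.prod_congr rfl fun j hj => ?_
      have hj' := Finset.mem_range.mp hj
      rw [Nat.sub_sub, Nat.cast_sub (by omega)]
      push_cast; ring)
  have hc : a ^ (-α) ≠ 0 := (Real.rpow_pos_of_pos ha _).ne'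
  have hw : ∀ t ∈ Set.Ioi (0 : ℝ), lueWeight α (n + 1) t
      = a ^ (-α) * ((a * t) ^ α * Real.exp (-(a * t))) := by
    intro t ht
    have ht' : (0 : ℝ) < t := ht
    rw [lueWeight, Real.mul_rpow ha.le ht'.le, ← mul_assoc, ← mul_assoc, ← Real.rpow_add ha]
    simp only [neg_add_cancel, Real.rpow_zero, one_mul]
    congr 2; rw [ha_def]; ring
  -- Real powers factor only over nonnegative bases, so the two weights are matched on the half-line
  -- alone. This suffices, because every integral runs over it and x is positive.
  have hcongr : lueDensity α (n + 1) x
      = marginalDensity (fun t => a ^ (-α) * ((a * t) ^ α * Real.exp (-(a * t)))) (Set.Ioi 0)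
        (n + 1) x := by
    have hJ : ∀ (m : ℕ) (y : Fin m → ℝ), (∀ i, y i ∈ Set.Ioi (0 : ℝ)) →
        jointWeight (lueWeight α (n + 1)) m y
        = jointWeight (fun t => a ^ (-α) * ((a * t) ^ α * Real.exp (-(a * t)))) m y := by
      intro m y hy
      simp only [jointWeight]
      congr 1
      exact Finset.prod_congr rfl fun i _ => hw _ (hy i)
    simp only [lueDensity, marginalDensity, jointDensity, partitionFunction]
    have hm : ∀ m : ℕ, MeasurableSet (Set.univ.pi fun _ : Fin m => Set.Ioi (0 : ℝ)) := fun m =>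
      MeasurableSet.univ_pi fun _ => measurableSet_Ioi
    rw [setIntegral_congr_fun (hm (n + 1)) fun y hy => hJ _ y fun i => hy i (Set.mem_univ i)]
    refine setIntegral_congr_fun (hm n) fun y hy => ?_
    rw [hJ]
    intro i
    refine Fin.cases ?_ (fun j => ?_) i
    · simpa using hx
    · simpa using hy j (Set.mem_univ j)
  rw [hcongr, marginalDensity_comp_mul (w := fun t => t ^ α * Real.exp (-t)) measurableSet_Ioi ha hc
    (fun t => by simp [ha]) (laguerreMonic_monic α) hint horth (fun j => (laguerreNorm_pos hα j).ne'),
    Finset.mul_sum, Finset.mul_sum, Finset.mul_sum]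
  refine Finset.sum_congr rfl fun k _ => ?_
  have : ((n : ℝ) + 1) ≠ 0 := by positivity
  have h2 : a / ((n : ℝ) + 1) = 4 := by rw [ha_def]; push_cast; field_simp
  rw [h2]; ring

theorem integrable_exp_neg_sq_mul_pow (k : ℕ) :
    Integrable (fun t : ℝ => Real.exp (-t ^ 2) * t ^ k) := by
  have := integrable_rpow_mul_exp_neg_mul_sq one_pos (s := k)
    (lt_of_lt_of_le (by norm_num) k.cast_nonneg)
  refine this.congr (Eventually.of_forall fun t => ?_)
  simp only [Real.rpow_natCast]
  rw [mul_comm]; congr 2; ring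

theorem gueDensity_eq_sum {N : ℕ} (hN : 0 < N) (x : ℝ) :
    gueDensity N x = √(2 * N) / N * (Real.exp (-(√(2 * N) * x) ^ 2) *
      ∑ k ∈ Finset.range N, (hermiteMonic k).eval (√(2 * N) * x) ^ 2 / hermiteNorm k) := by
  obtain ⟨n, rfl⟩ : ∃ n, N = n + 1 := ⟨N - 1, by omega⟩
  set a : ℝ := √(2 * ((n + 1 : ℕ) : ℝ)) with ha_def
  have ha : 0 < a := by positivity
  have hint := integrableOn_weight_mul_eval (w := fun t => Real.exp (-t ^ 2)) (Ω := Set.univ)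
    fun k => (integrable_exp_neg_sq_mul_pow k).integrableOn
  have hval : ∀ k : ℕ, momentFunctional _ _ hint (X ^ k) = ∫ t : ℝ, Real.exp (-t ^ 2) * t ^ k := by
    intro k; simp [momentFunctional]
  have hd : ∀ t : ℝ, HasDerivAt (fun t : ℝ => Real.exp (-t ^ 2)) (-2 * t * Real.exp (-t ^ 2)) t := by
    intro t
    have : HasDerivAt (fun t : ℝ => -t ^ 2) (-(2 * t)) t :=
      (hasDerivAt_pow 2 t).neg.congr_deriv (by simp)
    convert this.exp using 1
    ring
  have hfunctional := hermite_functional (momentFunctional _ _ hint) (by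
      have h0 := hval 1
      rw [pow_one] at h0
      rw [h0]
      -- The first moment is, up to the factor −2, the integral of the derivative of the Gaussian.
      have h1 := integral_eq_zero_of_hasDerivAt_of_integrable hd
        (((integrable_exp_neg_sq_mul_pow 1).const_mul (-2)).congr
          (Eventually.of_forall fun t => by beta_reduce; ring))
        ((integrable_exp_neg_sq_mul_pow 0).congr (Eventually.of_forall fun t => by simp))
      have h2 : ∫ t : ℝ, -2 * t * Real.exp (-t ^ 2) = -2 * ∫ t : ℝ, Real.exp (-t ^ 2) * t ^ 1 := by
        rw [← integral_const_mul]; congr 1; ext t; ring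
      rw [h2] at h1; linarith) (by
      intro k
      rw [hval, hval]
      have h1 := integral_eq_zero_of_hasDerivAt_of_integrable
        (f := fun t : ℝ => Real.exp (-t ^ 2) * t ^ (k + 1))
        (f' := fun t => (k + 1) * (Real.exp (-t ^ 2) * t ^ k)
          + -2 * (Real.exp (-t ^ 2) * t ^ (k + 2)))
        (fun t => by
          refine ((hd t).mul (hasDerivAt_pow (k + 1) t)).congr_deriv ?_
          rw [Nat.add_sub_cancel]; push_cast; ring)
        (((integrable_exp_neg_sq_mul_pow k).const_mul _).add
          ((integrable_exp_neg_sq_mul_pow (k + 2)).const_mul _))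
        (integrable_exp_neg_sq_mul_pow (k + 1))
      rw [integral_add ((integrable_exp_neg_sq_mul_pow k).const_mul _)
          ((integrable_exp_neg_sq_mul_pow (k + 2)).const_mul _), integral_const_mul,
        integral_const_mul] at h1
      linarith)
  have horth := (momentFunctional _ _ hint).orthogonal_of_apply_X_pow_mul
    (h := hermiteNorm) hermiteMonic_monic (fun m => (hfunctional m).1)
    (by
      intro m
      have h1 := hval 0
      rw [pow_zero] at h1
      rw [(hfunctional m).2, h1, hermiteNorm]
      have h2 := integral_gaussian 1
      simp only [neg_mul, one_mul, div_one] at h2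
      simp [h2])
  have hw : gueWeight (n + 1) = fun t => 1 * Real.exp (-(a * t) ^ 2) := by
    ext t
    rw [gueWeight, one_mul, mul_pow, ha_def, Real.sq_sqrt (by positivity)]
    congr 1; ring
  rw [gueDensity, hw, marginalDensity_comp_mul (w := fun t => Real.exp (-t ^ 2)) MeasurableSet.univ
    ha one_ne_zero (fun _ => Iff.rfl) hermiteMonic_monic hint horth
    (fun j => (hermiteNorm_pos j).ne'), Finset.mul_sum, Finset.mul_sum, Finset.mul_sum]
  refine Finset.sum_congr rfl fun k _ => ?_
  push_cast; ring

end Density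

/-! ### The phase g with g' = √(1−y²), and its behaviour near 0 -/

section BulkPhase

/-- The primitive of `√(1 - y²)` vanishing at `0`. -/
noncomputable def bulkPhase (y : ℝ) : ℝ := (Real.arcsin y + y * √(1 - y ^ 2)) / 2

theorem hasDerivAt_sqrt_one_sub_sq {y : ℝ} (hy : |y| < 1) :
    HasDerivAt (fun t : ℝ => √(1 - t ^ 2)) (-y / √(1 - y ^ 2)) y := by
  have h1 : 0 < 1 - y ^ 2 := by have := (sq_lt_one_iff_abs_lt_one y).mpr hy; linarith
  have h2 : HasDerivAt (fun t : ℝ => 1 - t ^ 2) (-(2 * y)) y :=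
    ((hasDerivAt_pow 2 y).const_sub 1).congr_deriv (by simp)
  refine (h2.sqrt h1.ne').congr_deriv ?_
  have := Real.sqrt_pos.mpr h1
  field_simp

theorem hasDerivAt_bulkPhase {y : ℝ} (hy : |y| < 1) :
    HasDerivAt bulkPhase (√(1 - y ^ 2)) y := by
  have h1 : 0 < 1 - y ^ 2 := by have := (sq_lt_one_iff_abs_lt_one y).mpr hy; linarith
  obtain ⟨hl, hr⟩ := abs_lt.mp hy
  have h := ((Real.hasDerivAt_arcsin hl.ne' hr.ne).add
    ((hasDerivAt_id y).mul (hasDerivAt_sqrt_one_sub_sq hy))).div_const 2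
  refine h.congr_deriv ?_
  have h2 := Real.sqrt_pos.mpr h1
  have h3 := Real.sq_sqrt h1.le
  simp only [id]
  field_simp
  rw [h3]; ring

theorem bulkPhase_zero : bulkPhase 0 = 0 := by simp [bulkPhase]

/-- The first two bounds integrate 1 − t²/2 − t⁴/2 ≤ √(1−t²) ≤ 1 − t²/2. The third holds because g −
t√(1−t²) has derivative t²/√(1−t²). -/
theorem bulkPhase_le_and_ge {y : ℝ} (hy0 : 0 ≤ y) (hy : y < 1) :
    bulkPhase y ≤ y - y ^ 3 / 6 ∧ y - y ^ 3 / 6 - y ^ 5 / 10 ≤ bulkPhase y ∧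
      y * √(1 - y ^ 2) ≤ bulkPhase y := by
  have key : ∀ f f' : ℝ → ℝ, (∀ t ∈ Set.Icc 0 y, HasDerivAt f (f' t) t) →
      (∀ t ∈ Set.Icc 0 y, 0 ≤ f' t) → f 0 ≤ f y := by
    intro f f' hf hf'
    refine (monotoneOn_of_hasDerivWithinAt_nonneg (convex_Icc 0 y)
      (fun t ht => (hf t ht).continuousAt.continuousWithinAt)
      (fun t ht => (hf t (interior_subset ht)).hasDerivWithinAt)
      (fun t ht => hf' t (interior_subset ht))) (Set.left_mem_Icc.mpr hy0)
      (Set.right_mem_Icc.mpr hy0) hy0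
  have habs : ∀ t ∈ Set.Icc 0 y, |t| < 1 := fun t ht => by
    rw [abs_of_nonneg ht.1]; exact ht.2.trans_lt hy
  have hup : ∀ t ∈ Set.Icc 0 y, √(1 - t ^ 2) ≤ 1 - t ^ 2 / 2 := fun t ht => by
    have h1 := (sq_lt_one_iff_abs_lt_one t).mpr (habs t ht)
    rw [Real.sqrt_le_left (by nlinarith)]
    nlinarith [sq_nonneg (t ^ 2)]
  have hlo : ∀ t ∈ Set.Icc 0 y, 1 - t ^ 2 / 2 - t ^ 4 / 2 ≤ √(1 - t ^ 2) := fun t ht => by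
    have h1 := (sq_lt_one_iff_abs_lt_one t).mpr (habs t ht)
    apply Real.le_sqrt_of_sq_le
    have h2 : 0 ≤ t ^ 4 * (1 - t ^ 2) * (3 + t ^ 2) :=
      mul_nonneg (mul_nonneg (by positivity) (by linarith)) (by positivity)
    linarith
  have hp3 : ∀ t : ℝ, HasDerivAt (fun t : ℝ => t - t ^ 3 / 6) (1 - t ^ 2 / 2) t := fun t =>
    ((hasDerivAt_id t).sub ((hasDerivAt_pow 3 t).div_const 6)).congr_deriv (by norm_num; ring)
  have hp5 : ∀ t : ℝ, HasDerivAt (fun t : ℝ => t - t ^ 3 / 6 - t ^ 5 / 10)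
      (1 - t ^ 2 / 2 - t ^ 4 / 2) t := fun t =>
    ((hp3 t).sub ((hasDerivAt_pow 5 t).div_const 10)).congr_deriv (by norm_num; ring)
  refine ⟨?_, ?_, ?_⟩
  · have := key (fun t => (t - t ^ 3 / 6) - bulkPhase t) _
      (fun t ht => (hp3 t).sub (hasDerivAt_bulkPhase (habs t ht)))
      (fun t ht => sub_nonneg.mpr (hup t ht))
    simp only [bulkPhase_zero] at this; linarith
  · have := key (fun t => bulkPhase t - (t - t ^ 3 / 6 - t ^ 5 / 10)) _
      (fun t ht => (hasDerivAt_bulkPhase (habs t ht)).sub (hp5 t))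
      (fun t ht => sub_nonneg.mpr (hlo t ht))
    simp only [bulkPhase_zero] at this; linarith
  · have := key (fun t => bulkPhase t - t * √(1 - t ^ 2)) _
      (fun t ht => (hasDerivAt_bulkPhase (habs t ht)).sub
        ((hasDerivAt_id t).mul (hasDerivAt_sqrt_one_sub_sq (habs t ht))))
      (fun t ht => by
        have h1 := (sq_lt_one_iff_abs_lt_one t).mpr (habs t ht)
        have h2 : 0 < √(1 - t ^ 2) := Real.sqrt_pos.mpr (by linarith)
        have h3 : √(1 - t ^ 2) - (1 * √(1 - t ^ 2) + id t * (-t / √(1 - t ^ 2)))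
            = t ^ 2 / √(1 - t ^ 2) := by simp only [id]; ring
        rw [h3]; positivity)
    simp only [bulkPhase_zero] at this; linarith

/-- Both g and y√(1−y²) are y(1 + O(y²)), so the two singularities y⁻² cancel. Uniformity down to y
= 0 is the point: it makes the potentials of the two equations differ by O(L⁻²) everywhere. -/
theorem abs_inv_bulkPhase_sq_sub_le {y c₁ : ℝ} (hc₁ : 0 < c₁) (hy0 : 0 < y) (hy : y < 1)
    (hc : c₁ ≤ √(1 - y ^ 2)) :
    |1 / (bulkPhase y) ^ 2 - 1 / (y * √(1 - y ^ 2)) ^ 2| ≤ 2 / c₁ ^ 4 := by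
  obtain ⟨h1, -, h3⟩ := bulkPhase_le_and_ge hy0.le hy
  set g := bulkPhase y
  set c := √(1 - y ^ 2)
  have hcc : c ^ 2 = 1 - y ^ 2 := Real.sq_sqrt (by nlinarith)
  have hc0 : 0 < c := hc₁.trans_le hc
  have hyc : 0 < y * c := by positivity
  have hg : 0 < g := hyc.trans_le h3
  have hgy : g ≤ y := by have : 0 < y ^ 3 := by positivity
                         linarith
  have h4 : 1 / g ^ 2 - 1 / (y * c) ^ 2 = -((g - y * c) * (g + y * c)) / (g ^ 2 * (y * c) ^ 2) := by
    field_simp; ring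
  have hcle : c ≤ 1 := by nlinarith
  rw [h4, abs_div, abs_neg, abs_of_nonneg (mul_nonneg (by linarith) (by linarith)),
    abs_of_pos (by positivity), div_le_div_iff₀ (by positivity) (by positivity)]
  have h5 : (g - y * c) * (g + y * c) ≤ y ^ 2 * y ^ 2 := by
    have : (g - y * c) * (g + y * c) = g ^ 2 - y ^ 2 * c ^ 2 := by ring
    rw [this, hcc]
    have : g ^ 2 ≤ y ^ 2 := by gcongr
    nlinarith
  have h6 : y ^ 2 * y ^ 2 * c₁ ^ 4 ≤ g ^ 2 * (y * c) ^ 2 := by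
    have e1 : (y * c₁) ^ 2 ≤ g ^ 2 := by gcongr; exact (mul_le_mul_of_nonneg_left hc hy0.le).trans h3
    have e2 : (y * c₁) ^ 2 ≤ (y * c) ^ 2 := by gcongr
    calc y ^ 2 * y ^ 2 * c₁ ^ 4 = (y * c₁) ^ 2 * (y * c₁) ^ 2 := by ring
      _ ≤ _ := by gcongr
  calc (g - y * c) * (g + y * c) * c₁ ^ 4 ≤ y ^ 2 * y ^ 2 * c₁ ^ 4 := by gcongr
    _ ≤ g ^ 2 * (y * c) ^ 2 := h6
    _ ≤ 2 * (g ^ 2 * (y * c) ^ 2) := by nlinarith [mul_pos (pow_pos hg 2) (pow_pos hyc 2)]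

/-- Up to the factor 2γ these are the derivatives of −γ/(y²(1−y²)) and −γ/g². With t = y², both
equal y⁻³(1 + O(t²)), the terms of order t vanishing in each of them, so the difference is O(y) and
in particular bounded. -/
theorem abs_potential_deriv_sub_le {y c₁ : ℝ} (hc₁ : 0 < c₁) (hy0 : 0 < y) (hy : y < 1)
    (hc : c₁ ≤ √(1 - y ^ 2)) :
    |(1 - 2 * y ^ 2) / (y ^ 3 * √(1 - y ^ 2) ^ 4) - √(1 - y ^ 2) / bulkPhase y ^ 3|
      ≤ 7 / c₁ ^ 7 := by
  obtain ⟨h1, h2, h3⟩ := bulkPhase_le_and_ge hy0.le hy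
  set g := bulkPhase y
  set c := √(1 - y ^ 2)
  have hcc : c ^ 2 = 1 - y ^ 2 := Real.sq_sqrt (by nlinarith)
  have hc0 : 0 < c := hc₁.trans_le hc
  have hyc : 0 < y * c := by positivity
  have hg : 0 < g := hyc.trans_le h3
  -- The relative defect a = 1 − g/y satisfies a = t/6 + O(t²), hence (1−a)³ = 1 − t/2 + O(t²),
  -- which matches √(1−t) to first order.
  obtain ⟨a, ha⟩ : ∃ a, g = y * (1 - a) := ⟨1 - g / y, by field_simp; ring⟩
  set t := y ^ 2 with ht
  have ht0 : 0 < t := by positivity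
  have ht1 : t < 1 := by nlinarith
  have ha1 : t / 6 ≤ a := by
    rw [ha] at h1
    have : y * (t / 6) ≤ y * a := by rw [ht]; linarith
    exact le_of_mul_le_mul_left this hy0
  have ha2 : a ≤ t / 6 + t ^ 2 / 10 := by
    rw [ha] at h2
    have : y * a ≤ y * (t / 6 + t ^ 2 / 10) := by rw [ht]; linarith
    exact le_of_mul_le_mul_left this hy0
  have hcu : c ≤ 1 - t / 2 := by
    refine le_of_sq_le_sq ?_ (by linarith)
    rw [hcc]; nlinarith
  have hcl : 1 - t / 2 - t ^ 2 / 2 ≤ c := by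
    apply Real.le_sqrt_of_sq_le
    have h2 : 0 ≤ t ^ 2 * (1 - t) * (3 + t) :=
      mul_nonneg (mul_nonneg (by positivity) (by linarith)) (by positivity)
    rw [← ht]; linarith
  have hcube : |(1 - a) ^ 3 - (1 - t / 2)| ≤ 5 * t ^ 2 := by
    have ha0 : 0 ≤ a := by linarith
    have hat : a ≤ t := by nlinarith
    have haa : a ^ 2 ≤ t ^ 2 := by gcongr
    have ha3 : a ^ 3 ≤ t ^ 2 := by
      calc a ^ 3 = a ^ 2 * a := by ring
        _ ≤ t ^ 2 * 1 := by gcongr; linarith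
        _ = t ^ 2 := by ring
    have ha3' : 0 ≤ a ^ 3 := by positivity
    have ha2' : 0 ≤ a ^ 2 := by positivity
    rw [abs_le]; constructor <;> nlinarith
  have hX : |(1 - 2 * t) * (1 - a) ^ 3 - (1 - t) ^ 2 * c| ≤ 7 * t ^ 2 := by
    have e1 : |1 - 2 * t| ≤ 1 := by rw [abs_le]; constructor <;> linarith
    have e2 : |(1 - 2 * t) * ((1 - a) ^ 3 - (1 - t / 2))| ≤ 5 * t ^ 2 := by
      rw [abs_mul]
      calc _ ≤ 1 * (5 * t ^ 2) := by gcongr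
        _ = _ := one_mul _
    have e3 : |(1 - t) ^ 2 * ((1 - t / 2) - c)| ≤ t ^ 2 / 2 := by
      rw [abs_mul, abs_of_nonneg (sq_nonneg _), abs_of_nonneg (by linarith)]
      calc _ ≤ 1 * (t ^ 2 / 2) := by
            have h1t : (1 - t) ^ 2 ≤ 1 := pow_le_one₀ (by linarith) (by linarith)
            exact mul_le_mul h1t (by linarith) (by linarith) zero_le_one
        _ = _ := one_mul _
    have e4 : (1 - 2 * t) * (1 - a) ^ 3 - (1 - t) ^ 2 * c
        = (1 - 2 * t) * ((1 - a) ^ 3 - (1 - t / 2)) + (1 - t) ^ 2 * ((1 - t / 2) - c)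
          - t ^ 2 * (1 - t / 2) := by ring
    have e5 : 0 ≤ t ^ 2 * (1 - t / 2) := mul_nonneg (sq_nonneg _) (by linarith)
    have e6 : t ^ 2 * (1 - t / 2) ≤ t ^ 2 := by nlinarith [pow_pos ht0 3]
    rw [e4]
    rw [abs_le] at e2 e3 ⊢
    constructor <;> linarith [e2.1, e2.2, e3.1, e3.2]
  have h4 : (1 - 2 * t) / (y ^ 3 * c ^ 4) - c / g ^ 3
      = ((1 - 2 * t) * (1 - a) ^ 3 - (1 - t) ^ 2 * c) * y ^ 3 / (y ^ 3 * c ^ 4 * g ^ 3) := by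
    have hc5 : c ^ 4 = (1 - t) ^ 2 := by rw [← hcc]; ring
    rw [div_sub_div _ _ (by positivity) (by positivity), ← hc5, ha]
    ring
  rw [h4, abs_div, abs_mul, abs_of_pos (show 0 < y ^ 3 by positivity),
    abs_of_pos (show 0 < y ^ 3 * c ^ 4 * g ^ 3 by positivity),
    div_le_div_iff₀ (by positivity) (by positivity)]
  have h5 : y ^ 6 * c₁ ^ 7 ≤ y ^ 3 * c ^ 4 * g ^ 3 := by
    have e1 : (y * c₁) ^ 3 ≤ g ^ 3 := by gcongr; exact (mul_le_mul_of_nonneg_left hc hy0.le).trans h3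
    calc y ^ 6 * c₁ ^ 7 = y ^ 3 * c₁ ^ 4 * (y * c₁) ^ 3 := by ring
      _ ≤ _ := by gcongr
  calc _ ≤ 7 * t ^ 2 * y ^ 3 * c₁ ^ 7 := by gcongr
    _ = 7 * (y ^ 6 * c₁ ^ 7) * y := by rw [ht]; ring
    _ ≤ 7 * (y ^ 6 * c₁ ^ 7) * 1 := by gcongr
    _ = 7 * (y ^ 6 * c₁ ^ 7) := mul_one _
    _ ≤ _ := by gcongr

end BulkPhase

/-! ### Comparison by derivatives, Gronwall for a square root, and the transformed potential -/

section Comparison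
open Set

theorem le_of_hasDerivAt_le {a b : ℝ} (hab : a ≤ b) {f g f' g' : ℝ → ℝ}
    (hf : ∀ s ∈ Icc a b, HasDerivAt f (f' s) s) (hg : ∀ s ∈ Icc a b, HasDerivAt g (g' s) s)
    (h : ∀ s ∈ Icc a b, f' s ≤ g' s) : f b - f a ≤ g b - g a := by
  have := (monotoneOn_of_hasDerivWithinAt_nonneg (convex_Icc a b) (f := fun s => g s - f s)
      (fun t ht => ((hg t ht).sub (hf t ht)).continuousAt.continuousWithinAt)
      (fun t ht => ((hg t (interior_subset ht)).sub (hf t (interior_subset ht))).hasDerivWithinAt)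
      (fun t ht => sub_nonneg.mpr (h t (interior_subset ht)))) (left_mem_Icc.mpr hab)
      (right_mem_Icc.mpr hab) hab
  simp only at this; linarith

theorem abs_sub_le_of_hasDerivAt_le {a b : ℝ} (hab : a ≤ b) {f g f' g' : ℝ → ℝ}
    (hf : ∀ s ∈ Icc a b, HasDerivAt f (f' s) s) (hg : ∀ s ∈ Icc a b, HasDerivAt g (g' s) s)
    (h : ∀ s ∈ Icc a b, |f' s| ≤ g' s) : |f b - f a| ≤ g b - g a := by
  rw [abs_le']
  refine ⟨le_of_hasDerivAt_le hab hf hg fun s hs => (abs_le'.mp (h s hs)).1, ?_⟩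
  have := le_of_hasDerivAt_le hab (fun s hs => (hf s hs).neg) hg
    fun s hs => (abs_le'.mp (h s hs)).2
  simp only [Pi.neg_apply] at this; linarith

/-- A Gronwall inequality for the square root of an energy. -/
theorem sqrt_le_of_hasDerivAt_le {a b : ℝ} (hab : a ≤ b) {e e' κ k F f : ℝ → ℝ}
    (he : ∀ s ∈ Icc a b, HasDerivAt e (e' s) s) (he0 : ∀ s ∈ Icc a b, 0 ≤ e s)
    (hκ : ∀ s ∈ Icc a b, HasDerivAt κ (k s) s) (hk0 : ∀ s ∈ Icc a b, 0 ≤ k s)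
    (hκ0 : ∀ s ∈ Icc a b, 0 ≤ κ s)
    (hF : ∀ s ∈ Icc a b, HasDerivAt F (f s) s) (hf0 : ∀ s ∈ Icc a b, 0 ≤ f s)
    (h : ∀ s ∈ Icc a b, e' s ≤ 2 * k s * e s + 2 * f s * √(e s)) :
    √(e b) ≤ Real.exp (κ b) * (√(e a) + (F b - F a)) := by
  have ha := left_mem_Icc.mpr hab
  have hb := right_mem_Icc.mpr hab
  -- The energy may vanish, and √e is then not differentiable; so e + δ is used and δ tends to 0 at
  -- the end.
  have key : ∀ δ : ℝ, 0 < δ → √(e b) ≤ Real.exp (κ b) * (√(e a + δ) + (F b - F a)) := by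
    intro δ hδ
    have hpos : ∀ s ∈ Icc a b, 0 < e s + δ := fun s hs => by have := he0 s hs; linarith
    -- The quantity √(e+δ) exp(−κ) has derivative at most f, because κ ≥ 0.
    have h1 := le_of_hasDerivAt_le hab
      (fun s hs => (((he s hs).add_const δ).sqrt (hpos s hs).ne').mul (hκ s hs).neg.exp) hF
      (by
        intro s hs
        have hs1 := Real.sqrt_pos.mpr (hpos s hs)
        have hs2 : √(e s) ≤ √(e s + δ) := Real.sqrt_le_sqrt (by linarith)
        have hs3 := Real.sq_sqrt (hpos s hs).le
        have hs4 : e' s / (2 * √(e s + δ)) ≤ k s * √(e s + δ) + f s := by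
          rw [div_le_iff₀ (by positivity)]
          have e1 := h s hs
          have e2 : 2 * f s * √(e s) ≤ 2 * f s * √(e s + δ) :=
            mul_le_mul_of_nonneg_left hs2 (by linarith [hf0 s hs])
          have e3 : 0 ≤ k s * δ := mul_nonneg (hk0 s hs) hδ.le
          nlinarith
        have hexp : Real.exp (-κ s) ≤ 1 := Real.exp_le_one_iff.mpr (by linarith [hκ0 s hs])
        have hexp0 := Real.exp_pos (-κ s)
        have e4 : f s * Real.exp (-κ s) ≤ f s := mul_le_of_le_one_right (hf0 s hs) hexp
        have e5 := mul_le_mul_of_nonneg_right hs4 hexp0.le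
        simp only [Pi.neg_apply]
        nlinarith)
    simp only [Pi.neg_apply, Pi.mul_apply] at h1
    have h2 : √(e a + δ) * Real.exp (-κ a) ≤ √(e a + δ) :=
      mul_le_of_le_one_right (Real.sqrt_nonneg _) (Real.exp_le_one_iff.mpr (by linarith [hκ0 a ha]))
    have h3 : √(e b + δ) * Real.exp (-κ b) ≤ √(e a + δ) + (F b - F a) := by linarith
    have h4 : √(e b) ≤ √(e b + δ) := Real.sqrt_le_sqrt (by linarith)
    calc √(e b) ≤ √(e b + δ) := h4
      _ = Real.exp (κ b) * (√(e b + δ) * Real.exp (-κ b)) := by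
        rw [mul_comm, mul_assoc, ← Real.exp_add]; simp
      _ ≤ _ := by gcongr
  have hlim : Tendsto (fun δ : ℝ => Real.exp (κ b) * (√(e a + δ) + (F b - F a)))
      (nhdsWithin 0 (Ioi 0)) (nhds (Real.exp (κ b) * (√(e a + 0) + (F b - F a)))) := by
    refine Tendsto.mono_left (Continuous.tendsto ?_ 0) nhdsWithin_le_nhds
    fun_prop
  rw [add_zero] at hlim
  exact ge_of_tendsto hlim (eventually_mem_nhdsWithin.mono fun δ hδ => key δ hδ)

/-- The potential of the radial oscillator in the Liouville–Green variables. -/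
noncomputable def liouvillePotential (γ L s : ℝ) : ℝ :=
  1 - γ / (s ^ 2 * (1 - (s / L) ^ 2)) + (2 + 3 * (s / L) ^ 2) / (4 * L ^ 2 * (1 - (s / L) ^ 2) ^ 3)

/-- Grouped for later use: the γ-part is L⁻³ times the function of y = s/L treated in
`abs_potential_deriv_sub_le`, and the rest is L⁻³ times a function that is bounded in the bulk. -/
theorem hasDerivAt_liouvillePotential (γ : ℝ) {L s : ℝ} (hL : 0 < L) (hs : 0 < s) (hsL : s < L) :
    HasDerivAt (liouvillePotential γ L)
      (2 * γ / L ^ 3 * ((1 - 2 * (s / L) ^ 2) / ((s / L) ^ 3 * (1 - (s / L) ^ 2) ^ 2))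
        + 1 / L ^ 3 * (3 / 2 * (s / L) / (1 - (s / L) ^ 2) ^ 3
          + 3 / 2 * (s / L) * (2 + 3 * (s / L) ^ 2) / (1 - (s / L) ^ 2) ^ 4)) s := by
  have hy : s / L < 1 := (div_lt_one hL).mpr hsL
  have hy0 : 0 < s / L := div_pos hs hL
  have hw : 0 < 1 - (s / L) ^ 2 := by nlinarith
  have hsq : HasDerivAt (fun t : ℝ => (t / L) ^ 2) (2 * (s / L) / L) s :=
    (((hasDerivAt_id s).div_const L).pow 2).congr_deriv (by simp; ring)
  have hd : HasDerivAt (fun t : ℝ => 1 - (t / L) ^ 2) (-(2 * (s / L) / L)) s :=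
    hsq.const_sub 1
  have h1 := ((hasDerivAt_const s γ).fun_div ((hasDerivAt_pow 2 s).fun_mul hd)
    (by positivity)).const_sub 1
  have h2 := (((hsq.const_mul 3).const_add 2)).fun_div ((hd.fun_pow 3).const_mul (4 * L ^ 2)) (by positivity)
  refine (h1.fun_add h2).congr_deriv ?_
  obtain ⟨y, hy'⟩ : ∃ y, y = s / L := ⟨_, rfl⟩
  have hs' : s = L * y := by rw [hy']; field_simp
  rw [← hy'] at hy hy0 hw ⊢
  simp only [Nat.cast_ofNat]
  rw [hs']
  field_simp
  ring

end Comparison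

/-! ### First-order comparison with Bessel's equation -/

section Comparison
open Set

/-- The Liouville–Green phase. -/
noncomputable def liouvillePhase (L s : ℝ) : ℝ := L * bulkPhase (s / L)

theorem hasDerivAt_liouvillePhase {L s : ℝ} (hL : 0 < L) (hs : 0 ≤ s) (hsL : s < L) :
    HasDerivAt (liouvillePhase L) (√(1 - (s / L) ^ 2)) s := by
  have hy : |s / L| < 1 := by
    rw [abs_of_nonneg (div_nonneg hs hL.le)]; exact (div_lt_one hL).mpr hsL
  refine (((hasDerivAt_bulkPhase hy).comp s ((hasDerivAt_id s).div_const L)).const_mul L).congr_deriv ?_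
  field_simp

/-- Elementary bounds for the Liouville–Green data on the bulk. -/
theorem liouville_bounds {c₁ L s : ℝ} (γ : ℝ) (hc₁ : 0 < c₁) (hL : 0 < L) (hs : 0 < s) (hsL : s < L)
    (hc : c₁ ≤ √(1 - (s / L) ^ 2)) :
    c₁ * s ≤ liouvillePhase L s ∧ liouvillePhase L s ≤ s ∧
    |liouvillePotential γ L s - (1 - γ / liouvillePhase L s ^ 2)|
      ≤ (2 * |γ| / c₁ ^ 4 + 5 / (4 * c₁ ^ 6)) / L ^ 2 := by
  have hy : s / L < 1 := (div_lt_one hL).mpr hsL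
  have hy0 : 0 < s / L := div_pos hs hL
  have h1 := abs_inv_bulkPhase_sq_sub_le hc₁ hy0 hy hc
  obtain ⟨h2, -, h3⟩ := bulkPhase_le_and_ge hy0.le hy
  rw [liouvillePhase, liouvillePotential]
  obtain ⟨y, hy'⟩ : ∃ y, y = s / L := ⟨_, rfl⟩
  have hs' : s = L * y := by rw [hy']; field_simp
  rw [← hy'] at h1 h2 h3 hc hy hy0 ⊢
  have hcc : √(1 - y ^ 2) ^ 2 = 1 - y ^ 2 := Real.sq_sqrt (by nlinarith)
  set c := √(1 - y ^ 2)
  set g := bulkPhase y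
  have hc0 : 0 < c := hc₁.trans_le hc
  have hg : 0 < g := lt_of_lt_of_le (by positivity) h3
  refine ⟨?_, ?_, ?_⟩
  · rw [hs']
    calc c₁ * (L * y) = L * (y * c₁) := by ring
      _ ≤ L * (y * c) := by gcongr
      _ ≤ _ := by gcongr
  · rw [hs']
    gcongr
    have : 0 < y ^ 3 := by positivity
    linarith
  · have e1 : 1 - γ / (s ^ 2 * (1 - y ^ 2)) + (2 + 3 * y ^ 2) / (4 * L ^ 2 * (1 - y ^ 2) ^ 3)
        - (1 - γ / (L * g) ^ 2)
        = (γ * (1 / g ^ 2 - 1 / (y * c) ^ 2) + (2 + 3 * y ^ 2) / (4 * c ^ 6)) / L ^ 2 := by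
      have : c ^ 6 = (1 - y ^ 2) ^ 3 := by rw [← hcc]; ring
      rw [this, mul_pow y c, hcc, hs']
      have hw : 1 - y ^ 2 ≠ 0 := by rw [← hcc]; positivity
      field_simp
      ring
    rw [e1, abs_div, abs_of_pos (show 0 < L ^ 2 by positivity)]
    gcongr
    refine (abs_add_le _ _).trans (add_le_add ?_ ?_)
    · rw [abs_mul]
      calc _ ≤ |γ| * (2 / c₁ ^ 4) := by gcongr
        _ = _ := by ring
    · rw [abs_of_pos (by positivity)]
      gcongr
      nlinarith

/-- Solutions of the Liouville–Green normal form stay close to solutions of Bessel's equation. -/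
theorem liouville_comparison {γ b c₁ s₀ K : ℝ} (hc₁ : 0 < c₁) (hs₀ : 0 < s₀)
    (hb : 0 ≤ b) (hK : 0 ≤ K) :
    ∃ C, 0 ≤ C ∧ ∀ L s₁ : ℝ, 1 ≤ L → s₀ ≤ s₁ → s₁ < L → c₁ ≤ √(1 - (s₁ / L) ^ 2) →
      ∀ P M B B₁ : ℝ → ℝ,
      (∀ s ∈ Icc s₀ s₁, HasDerivAt P (√(1 - (s / L) ^ 2) * M s) s) →
      (∀ s ∈ Icc s₀ s₁,
        HasDerivAt M (-(√(1 - (s / L) ^ 2) * liouvillePotential γ L s * P s)) s) →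
      (∀ t > 0, HasDerivAt B (B₁ t) t) →
      (∀ t > 0, HasDerivAt B₁ (-((1 - γ / t ^ 2) * B t)) t) →
      (∀ t ≥ c₁ * s₀, |B t| ≤ b ∧ |B₁ t| ≤ b) →
      |P s₀ - B (liouvillePhase L s₀)| ≤ K / L ^ 2 →
      |M s₀ - B₁ (liouvillePhase L s₀)| ≤ K / L ^ 2 →
      (∀ s ∈ Icc s₀ s₁, |P s - B (liouvillePhase L s)| ≤ C * s / L ^ 2 ∧
        |M s - B₁ (liouvillePhase L s)| ≤ C * s / L ^ 2) := by
  set Ψ := 2 * |γ| / c₁ ^ 4 + 5 / (4 * c₁ ^ 6) with hΨ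
  have hΨ0 : 0 ≤ Ψ := by positivity
  refine ⟨Real.exp (|γ| / c₁ ^ 2 / s₀ + Ψ) * (2 * K / s₀ + Ψ * b), by positivity, ?_⟩
  intro L s₁ hL hs₀₁ hs₁L hcs₁ P M B B₁ hP hM hB hB₁ hBb hP0 hM0
  have hL0 : 0 < L := by linarith
  have hcs : ∀ s ∈ Icc s₀ s₁, c₁ ≤ √(1 - (s / L) ^ 2) := fun s hs => hcs₁.trans <|
    Real.sqrt_le_sqrt (sub_le_sub_left (pow_le_pow_left₀
      (div_nonneg (hs₀.le.trans hs.1) hL0.le) (div_le_div_of_nonneg_right hs.2 hL0.le) 2) 1)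
  have hcle : ∀ s : ℝ, √(1 - (s / L) ^ 2) ≤ 1 := fun s => by
    rw [Real.sqrt_le_left zero_le_one]; nlinarith [sq_nonneg (s / L)]
  have hpos : ∀ s ∈ Icc s₀ s₁, 0 < s := fun s hs => hs₀.trans_le hs.1
  have hbd := fun s (hs : s ∈ Icc s₀ s₁) =>
    liouville_bounds γ hc₁ hL0 (hpos s hs) (hs.2.trans_lt hs₁L) (hcs s hs)
  have hξpos : ∀ s ∈ Icc s₀ s₁, 0 < liouvillePhase L s := fun s hs =>
    lt_of_lt_of_le (mul_pos hc₁ (hpos s hs)) (hbd s hs).1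
  have hξd := fun s (hs : s ∈ Icc s₀ s₁) =>
    hasDerivAt_liouvillePhase hL0 (hpos s hs).le (hs.2.trans_lt hs₁L)
  set ξ := liouvillePhase L
  have hBξ := fun s (hs : s ∈ Icc s₀ s₁) => (hB _ (hξpos s hs)).comp s (hξd s hs)
  have hB₁ξ := fun s (hs : s ∈ Icc s₀ s₁) => (hB₁ _ (hξpos s hs)).comp s (hξd s hs)
  have main : ∀ s ∈ Icc s₀ s₁, √((P s - B (ξ s)) ^ 2 + (M s - B₁ (ξ s)) ^ 2)
      ≤ Real.exp (|γ| / c₁ ^ 2 / s₀ + Ψ) * (2 * K / s₀ + Ψ * b) * s / L ^ 2 := by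
    intro s₂ hs₂
    have hsub : Icc s₀ s₂ ⊆ Icc s₀ s₁ := Icc_subset_Icc_right hs₂.2
    -- The growth rate is |γ|/(c₁² s²) + Ψ/L². Its integral from s₀ to s ≤ L is bounded
    -- independently of L, so Gronwall costs only a constant. The source Ψ b/L², integrated over
    -- length s, gives the rate s/L².
    have hg := sqrt_le_of_hasDerivAt_le hs₂.1
      (e := fun s => (P s - B (ξ s)) ^ 2 + (M s - B₁ (ξ s)) ^ 2)
      (κ := fun s => |γ| / c₁ ^ 2 * (1 / s₀ - s⁻¹) + Ψ / L ^ 2 * (s - s₀))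
      (k := fun s => |γ| / c₁ ^ 2 / s ^ 2 + Ψ / L ^ 2)
      (F := fun s => Ψ * b / L ^ 2 * s) (f := fun _ => Ψ * b / L ^ 2)
      (fun s hs => (((hP s (hsub hs)).sub (hBξ s (hsub hs))).fun_pow 2).fun_add
        (((hM s (hsub hs)).sub (hB₁ξ s (hsub hs))).fun_pow 2))
      (fun s _ => by positivity)
      (fun s hs => by
        have hs0 := hpos s (hsub hs)
        refine ((((hasDerivAt_inv hs0.ne').const_sub (1 / s₀)).const_mul (|γ| / c₁ ^ 2)).fun_add
          (((hasDerivAt_id s).sub_const s₀).const_mul (Ψ / L ^ 2))).congr_deriv ?_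
        field_simp)
      (fun s _ => by positivity)
      (fun s hs => by
        have hs0 := hpos s (hsub hs)
        have : s⁻¹ ≤ 1 / s₀ := by rw [one_div]; exact inv_anti₀ hs₀ hs.1
        exact add_nonneg (mul_nonneg (by positivity) (by linarith))
          (mul_nonneg (by positivity) (by linarith [hs.1])))
      (fun s _ => ((hasDerivAt_id s).const_mul _).congr_deriv (by simp))
      (fun s _ => by positivity)
      (by
        intro s hs
        have hs' := hsub hs
        obtain ⟨b1, b2, b3⟩ := hbd s hs'
        have hs0 := hpos s hs'
        have hξ0 := hξpos s hs'
        have hBs : |B (ξ s)| ≤ b := (hBb _ ((mul_le_mul_of_nonneg_left hs.1 hc₁.le).trans b1)).1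
        simp only [Pi.sub_apply, Function.comp_apply]
        set c := √(1 - (s / L) ^ 2)
        have hc0 : 0 < c := hc₁.trans_le (hcs s hs')
        have hc1 : c ≤ 1 := hcle s
        set q := liouvillePotential γ L s
        set x := P s - B (ξ s) with hx
        set m := M s - B₁ (ξ s) with hm
        set e := x ^ 2 + m ^ 2 with he
        have hxe : |x| ≤ √e := Real.abs_le_sqrt (by rw [he]; nlinarith [sq_nonneg m])
        have hme : |m| ≤ √e := Real.abs_le_sqrt (by rw [he]; nlinarith [sq_nonneg x])
        have hee : √e ^ 2 = e := Real.sq_sqrt (by positivity)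
        have hγ : |γ / ξ s ^ 2| ≤ |γ| / c₁ ^ 2 / s ^ 2 := by
          rw [abs_div, abs_of_pos (pow_pos hξ0 2), div_div, ← mul_pow]
          gcongr
        -- The rotation common to both systems cancels in the squared distance; only γ/ξ² and the
        -- mismatch of the potentials remain.
        have eq1 : (2 : ℕ) * x ^ (2 - 1) * (c * M s - B₁ (ξ s) * c)
            + (2 : ℕ) * m ^ (2 - 1) * (-(c * q * P s) - -((1 - γ / ξ s ^ 2) * B (ξ s)) * c)
            = 2 * c * m * (γ / ξ s ^ 2 * x - (q - (1 - γ / ξ s ^ 2)) * (x + B (ξ s))) := by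
          rw [hx, hm]; push_cast; ring
        refine (le_of_eq eq1).trans ((le_abs_self _).trans ?_)
        have hR : |γ / ξ s ^ 2 * x - (q - (1 - γ / ξ s ^ 2)) * (x + B (ξ s))|
            ≤ |γ| / c₁ ^ 2 / s ^ 2 * √e + Ψ / L ^ 2 * (√e + b) := by
          refine (abs_sub _ _).trans (add_le_add ?_ ?_)
          · rw [abs_mul]; gcongr
          · rw [abs_mul]; gcongr
            exact (abs_add_le _ _).trans (add_le_add hxe hBs)
        rw [abs_mul, abs_mul, abs_mul, abs_two, abs_of_pos hc0]
        calc _ ≤ 2 * 1 * √e * (|γ| / c₁ ^ 2 / s ^ 2 * √e + Ψ / L ^ 2 * (√e + b)) := by gcongr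
          _ = 2 * (|γ| / c₁ ^ 2 / s ^ 2 + Ψ / L ^ 2) * √e ^ 2 + 2 * (Ψ * b / L ^ 2) * √e := by ring
          _ = _ := by rw [hee])
    refine hg.trans ?_
    have hs₂0 := hpos s₂ hs₂
    have hLsq : L ≤ L ^ 2 := by nlinarith
    have k1 : |γ| / c₁ ^ 2 * (1 / s₀ - s₂⁻¹) + Ψ / L ^ 2 * (s₂ - s₀) ≤ |γ| / c₁ ^ 2 / s₀ + Ψ := by
      have e1 : |γ| / c₁ ^ 2 * (1 / s₀ - s₂⁻¹) ≤ |γ| / c₁ ^ 2 * (1 / s₀) := by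
        gcongr; linarith [inv_pos.mpr hs₂0]
      have e2 : Ψ / L ^ 2 * (s₂ - s₀) ≤ Ψ := by
        rw [div_mul_eq_mul_div, div_le_iff₀ (by positivity)]
        gcongr; linarith [hs₂.2]
      calc _ ≤ _ := add_le_add e1 e2
        _ = _ := by ring
    have k2 : √((P s₀ - B (ξ s₀)) ^ 2 + (M s₀ - B₁ (ξ s₀)) ^ 2) ≤ 2 * K / L ^ 2 := by
      apply Real.sqrt_le_iff.mpr ⟨by positivity, ?_⟩
      have e1 := sq_le_sq' (abs_le.mp hP0).1 (abs_le.mp hP0).2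
      have e2 := sq_le_sq' (abs_le.mp hM0).1 (abs_le.mp hM0).2
      have e3 : (2 * K / L ^ 2) ^ 2 = 4 * (K / L ^ 2) ^ 2 := by ring
      rw [e3]; nlinarith [sq_nonneg (K / L ^ 2)]
    have k3 : √((P s₀ - B (ξ s₀)) ^ 2 + (M s₀ - B₁ (ξ s₀)) ^ 2)
        + (Ψ * b / L ^ 2 * s₂ - Ψ * b / L ^ 2 * s₀) ≤ (2 * K / s₀ + Ψ * b) * s₂ / L ^ 2 := by
      have e1 : 2 * K / L ^ 2 ≤ 2 * K / s₀ * s₂ / L ^ 2 := by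
        refine div_le_div_of_nonneg_right ?_ (by positivity)
        rw [div_mul_eq_mul_div, le_div_iff₀ hs₀]
        exact mul_le_mul_of_nonneg_left hs₂.1 (by positivity)
      have e2 : 0 ≤ Ψ * b / L ^ 2 * s₀ := by positivity
      calc _ ≤ 2 * K / s₀ * s₂ / L ^ 2 + Ψ * b / L ^ 2 * s₂ := by linarith
        _ = _ := by ring
    calc _ ≤ Real.exp (|γ| / c₁ ^ 2 / s₀ + Ψ) * ((2 * K / s₀ + Ψ * b) * s₂ / L ^ 2) := by
          refine mul_le_mul (Real.exp_le_exp.mpr k1) k3 (add_nonneg (Real.sqrt_nonneg _) ?_)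
            (Real.exp_pos _).le
          rw [← mul_sub]
          exact mul_nonneg (by positivity) (sub_nonneg.mpr hs₂.1)
      _ = _ := by ring
  intro s hs
  have h := main s hs
  exact ⟨(Real.abs_le_sqrt (by nlinarith [sq_nonneg (M s - B₁ (ξ s))])).trans h,
    (Real.abs_le_sqrt (by nlinarith [sq_nonneg (P s - B (ξ s))])).trans h⟩

end Comparison

/-! ### Second-order comparison of energies -/

section Energy
open Set

theorem abs_sq_sub_sq_le {x y b d : ℝ} (hy : |y| ≤ b) (hxy : |x - y| ≤ d) :
    |x ^ 2 - y ^ 2| ≤ d * (2 * b + d) := by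
  have h1 : x ^ 2 - y ^ 2 = (x - y) * (2 * y + (x - y)) := by ring
  rw [h1, abs_mul]
  have h2 : |2 * y + (x - y)| ≤ 2 * b + d := by
    refine (abs_add_le _ _).trans (add_le_add ?_ hxy)
    rw [abs_mul, abs_two]; linarith
  exact mul_le_mul hxy h2 (abs_nonneg _) ((abs_nonneg _).trans hxy)

/-- The difference of the two energy derivatives splits in three: the mismatch of the potentials'
derivatives, O(L⁻³); the Bessel derivative, O(s⁻³), times p − β, which is O(s L⁻²); and the part of
the potential without γ, O(L⁻³). The bound L⁻³ + L⁻² s⁻² integrates over s₀ ≤ s ≤ L to O(L⁻²), so no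
factor s is lost. -/
theorem liouville_energy_deriv_bound {γ b c₁ C L s p β : ℝ} (hc₁ : 0 < c₁) (hc₁' : c₁ ≤ 1)
    (hL : 0 < L) (hs : 0 < s) (hsL : s < L)
    (hc : c₁ ≤ √(1 - (s / L) ^ 2)) (hp : p ≤ (b + C) ^ 2) (hp0 : 0 ≤ p)
    (hpβ : |p - β| ≤ C * s / L ^ 2 * (2 * b + C)) :
    |(2 * γ / L ^ 3 * ((1 - 2 * (s / L) ^ 2) / ((s / L) ^ 3 * (1 - (s / L) ^ 2) ^ 2))
        + 1 / L ^ 3 * (3 / 2 * (s / L) / (1 - (s / L) ^ 2) ^ 3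
          + 3 / 2 * (s / L) * (2 + 3 * (s / L) ^ 2) / (1 - (s / L) ^ 2) ^ 4)) * p
      - 2 * γ * √(1 - (s / L) ^ 2) / liouvillePhase L s ^ 3 * β|
      ≤ ((2 * |γ| * (7 / c₁ ^ 7) + 9 / c₁ ^ 8) * (b + C) ^ 2) / L ^ 3
        + (2 * |γ| / c₁ ^ 3 * (C * (2 * b + C))) / L ^ 2 / s ^ 2 := by
  have hy : s / L < 1 := (div_lt_one hL).mpr hsL
  have hy0 : 0 < s / L := div_pos hs hL
  have hg3 := abs_potential_deriv_sub_le hc₁ hy0 hy hc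
  have hcc : √(1 - (s / L) ^ 2) ^ 2 = 1 - (s / L) ^ 2 := Real.sq_sqrt (by nlinarith)
  have hξl := (liouville_bounds γ hc₁ hL hs hsL hc).1
  have hξ0 : 0 < liouvillePhase L s := lt_of_lt_of_le (by positivity) hξl
  have hξg : liouvillePhase L s = L * bulkPhase (s / L) := rfl
  have hc0 : 0 < √(1 - (s / L) ^ 2) := hc₁.trans_le hc
  have hc1 : √(1 - (s / L) ^ 2) ≤ 1 := by
    rw [Real.sqrt_le_left zero_le_one]; nlinarith [sq_nonneg (s / L)]
  have hg0 : 0 < bulkPhase (s / L) := by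
    rw [hξg] at hξ0; exact pos_of_mul_pos_right hξ0 hL.le
  generalize s / L = y at *
  generalize √(1 - y ^ 2) = c at *
  generalize bulkPhase y = g at *
  generalize liouvillePhase L s = ξ at *
  have hw : c₁ ^ 2 ≤ 1 - y ^ 2 := by rw [← hcc]; gcongr
  have hc4 : (1 - y ^ 2) ^ 2 = c ^ 4 := by rw [← hcc]; ring
  have hχb : 3 / 2 * y / (1 - y ^ 2) ^ 3 + 3 / 2 * y * (2 + 3 * y ^ 2) / (1 - y ^ 2) ^ 4
      ≤ 9 / c₁ ^ 8 := by
    have e1 : 3 / 2 * y / (1 - y ^ 2) ^ 3 ≤ (3 / 2) / c₁ ^ 8 := by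
      have : c₁ ^ 8 ≤ (1 - y ^ 2) ^ 3 := by
        calc c₁ ^ 8 = (c₁ ^ 2) ^ 3 * c₁ ^ 2 := by ring
          _ ≤ (c₁ ^ 2) ^ 3 * 1 := by gcongr; exact pow_le_one₀ hc₁.le hc₁'
          _ ≤ _ := by rw [mul_one]; gcongr
      gcongr; linarith
    have e2 : 3 / 2 * y * (2 + 3 * y ^ 2) / (1 - y ^ 2) ^ 4 ≤ (15 / 2) / c₁ ^ 8 := by
      have : c₁ ^ 8 ≤ (1 - y ^ 2) ^ 4 := by
        calc c₁ ^ 8 = (c₁ ^ 2) ^ 4 := by ring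
          _ ≤ _ := by gcongr
      gcongr
      have : y ^ 2 ≤ 1 := by nlinarith
      nlinarith
    calc _ ≤ (3 / 2) / c₁ ^ 8 + (15 / 2) / c₁ ^ 8 := add_le_add e1 e2
      _ = _ := by ring
  have hw0 : 0 < 1 - y ^ 2 := lt_of_lt_of_le (by positivity) hw
  have hχ0 : 0 ≤ 3 / 2 * y / (1 - y ^ 2) ^ 3 + 3 / 2 * y * (2 + 3 * y ^ 2) / (1 - y ^ 2) ^ 4 := by
    positivity
  rw [hc4]
  generalize 3 / 2 * y / (1 - y ^ 2) ^ 3 + 3 / 2 * y * (2 + 3 * y ^ 2) / (1 - y ^ 2) ^ 4 = χ at *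
  generalize (1 - 2 * y ^ 2) / (y ^ 3 * c ^ 4) = R at *
  have eq1 : (2 * γ / L ^ 3 * R + 1 / L ^ 3 * χ) * p - 2 * γ * c / ξ ^ 3 * β
      = 2 * γ / L ^ 3 * (R - c / g ^ 3) * p + 2 * γ * c / ξ ^ 3 * (p - β) + 1 / L ^ 3 * χ * p := by
    have e2 : 2 * γ / L ^ 3 * (R - c / g ^ 3) = 2 * γ / L ^ 3 * R - 2 * γ * c / ξ ^ 3 := by
      rw [hξg]; field_simp
    rw [e2]; ring
  have t1 : |2 * γ / L ^ 3 * (R - c / g ^ 3) * p| ≤ 2 * |γ| / L ^ 3 * (7 / c₁ ^ 7) * (b + C) ^ 2 := by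
    rw [abs_mul, abs_mul, abs_div, abs_mul, abs_two, abs_of_pos (pow_pos hL 3), abs_of_nonneg hp0]
    gcongr
  have t3 : |1 / L ^ 3 * χ * p| ≤ 1 / L ^ 3 * (9 / c₁ ^ 8) * (b + C) ^ 2 := by
    rw [abs_of_nonneg (by positivity)]
    gcongr
  have t2 : |2 * γ * c / ξ ^ 3 * (p - β)|
      ≤ 2 * |γ| * 1 / (c₁ * s) ^ 3 * (C * s / L ^ 2 * (2 * b + C)) := by
    rw [abs_mul, abs_div, abs_mul, abs_mul, abs_two, abs_of_pos hc0, abs_of_pos (pow_pos hξ0 3)]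
    gcongr
  rw [eq1]
  refine (abs_add_three _ _ _).trans ((add_le_add (add_le_add t1 t2) t3).trans (le_of_eq ?_))
  field_simp
  ring

/-- The energy of a solution of the Liouville–Green normal form agrees to second order with
the energy of the comparison Bessel function. -/
theorem liouville_energy_comparison {γ b c₁ s₀ K C : ℝ} (hc₁ : 0 < c₁) (hc₁' : c₁ ≤ 1)
    (hs₀ : 0 < s₀) (hb : 0 ≤ b) (hK : 0 ≤ K) (hC : 0 ≤ C) :
    ∃ C', 0 ≤ C' ∧ ∀ L s₁ : ℝ, 1 ≤ L → s₀ ≤ s₁ → s₁ < L → c₁ ≤ √(1 - (s₁ / L) ^ 2) →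
      ∀ P M B B₁ : ℝ → ℝ,
      (∀ s ∈ Icc s₀ s₁, HasDerivAt P (√(1 - (s / L) ^ 2) * M s) s) →
      (∀ s ∈ Icc s₀ s₁,
        HasDerivAt M (-(√(1 - (s / L) ^ 2) * liouvillePotential γ L s * P s)) s) →
      (∀ t > 0, HasDerivAt B (B₁ t) t) →
      (∀ t > 0, HasDerivAt B₁ (-((1 - γ / t ^ 2) * B t)) t) →
      (∀ t ≥ c₁ * s₀, |B t| ≤ b ∧ |B₁ t| ≤ b) →
      |P s₀ - B (liouvillePhase L s₀)| ≤ K / L ^ 2 →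
      |M s₀ - B₁ (liouvillePhase L s₀)| ≤ K / L ^ 2 →
      (∀ s ∈ Icc s₀ s₁, |P s - B (liouvillePhase L s)| ≤ C * s / L ^ 2) →
      ∀ s ∈ Icc s₀ s₁, |(M s ^ 2 + liouvillePotential γ L s * P s ^ 2)
        - (B₁ (liouvillePhase L s) ^ 2
          + (1 - γ / liouvillePhase L s ^ 2) * B (liouvillePhase L s) ^ 2)| ≤ C' / L ^ 2 := by
  set Ψ := 2 * |γ| / c₁ ^ 4 + 5 / (4 * c₁ ^ 6) with hΨ
  have hΨ0 : 0 ≤ Ψ := by positivity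
  set A₁ := (2 * |γ| * (7 / c₁ ^ 7) + 9 / c₁ ^ 8) * (b + C) ^ 2 with hA₁
  set A₂ := 2 * |γ| / c₁ ^ 3 * (C * (2 * b + C)) with hA₂
  set A₀ := K * (2 * b + K) + (Ψ * (b + K) ^ 2 + (1 + |γ| / (c₁ * s₀) ^ 2) * (K * (2 * b + K)))
    with hA₀
  refine ⟨A₀ + (A₁ + A₂ / s₀), by positivity, ?_⟩
  intro L s₁ hL hs₀₁ hs₁L hcs₁ P M B B₁ hP hM hB hB₁ hBb hP0 hM0 hPB
  have hL0 : 0 < L := by linarith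
  have hcs : ∀ s ∈ Icc s₀ s₁, c₁ ≤ √(1 - (s / L) ^ 2) := fun s hs => hcs₁.trans <|
    Real.sqrt_le_sqrt (sub_le_sub_left (pow_le_pow_left₀
      (div_nonneg (hs₀.le.trans hs.1) hL0.le) (div_le_div_of_nonneg_right hs.2 hL0.le) 2) 1)
  have hpos : ∀ s ∈ Icc s₀ s₁, 0 < s := fun s hs => hs₀.trans_le hs.1
  have hbd := fun s (hs : s ∈ Icc s₀ s₁) =>
    liouville_bounds γ hc₁ hL0 (hpos s hs) (hs.2.trans_lt hs₁L) (hcs s hs)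
  have hξpos : ∀ s ∈ Icc s₀ s₁, 0 < liouvillePhase L s := fun s hs =>
    lt_of_lt_of_le (mul_pos hc₁ (hpos s hs)) (hbd s hs).1
  have hξd := fun s (hs : s ∈ Icc s₀ s₁) =>
    hasDerivAt_liouvillePhase hL0 (hpos s hs).le (hs.2.trans_lt hs₁L)
  have hBbs : ∀ s ∈ Icc s₀ s₁, |B (liouvillePhase L s)| ≤ b ∧ |B₁ (liouvillePhase L s)| ≤ b :=
    fun s hs => hBb _ ((mul_le_mul_of_nonneg_left hs.1 hc₁.le).trans (hbd s hs).1)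
  set ξ := liouvillePhase L with hξ
  have hBξ := fun s (hs : s ∈ Icc s₀ s₁) => (hB _ (hξpos s hs)).comp s (hξd s hs)
  have hB₁ξ := fun s (hs : s ∈ Icc s₀ s₁) => (hB₁ _ (hξpos s hs)).comp s (hξd s hs)
  have hLsq : L ≤ L ^ 2 := by nlinarith
  have hPb : ∀ s ∈ Icc s₀ s₁, P s ^ 2 ≤ (b + C) ^ 2 := by
    intro s hs
    have h1 : |P s| ≤ b + C := by
      have e1 := hPB s hs
      have e2 : C * s / L ^ 2 ≤ C := by
        rw [div_le_iff₀ (by positivity)]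
        have := hs.2
        gcongr; linarith
      calc |P s| = |B (ξ s) + (P s - B (ξ s))| := by congr 1; ring
        _ ≤ |B (ξ s)| + |P s - B (ξ s)| := abs_add_le _ _
        _ ≤ b + C := add_le_add (hBbs s hs).1 (e1.trans e2)
    exact sq_le_sq' (abs_le.mp h1).1 (abs_le.mp h1).2
  -- In the derivative of M² + qP² the cross terms −2cqMP and 2cqPM cancel, leaving q'P²; the same
  -- happens for the Bessel energy.
  have hder : ∀ s ∈ Icc s₀ s₁, HasDerivAt (fun s => (M s ^ 2 + liouvillePotential γ L s * P s ^ 2)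
        - (B₁ (ξ s) ^ 2 + (1 - γ / ξ s ^ 2) * B (ξ s) ^ 2))
      ((2 * γ / L ^ 3 * ((1 - 2 * (s / L) ^ 2) / ((s / L) ^ 3 * (1 - (s / L) ^ 2) ^ 2))
        + 1 / L ^ 3 * (3 / 2 * (s / L) / (1 - (s / L) ^ 2) ^ 3
          + 3 / 2 * (s / L) * (2 + 3 * (s / L) ^ 2) / (1 - (s / L) ^ 2) ^ 4)) * P s ^ 2
      - 2 * γ * √(1 - (s / L) ^ 2) / ξ s ^ 3 * B (ξ s) ^ 2) s := by
    intro s hs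
    have hξ0 := hξpos s hs
    refine ((((hM s hs).fun_pow 2).fun_add ((hasDerivAt_liouvillePotential γ hL0 (hpos s hs)
        (hs.2.trans_lt hs₁L)).fun_mul ((hP s hs).fun_pow 2))).fun_sub
        (((hB₁ξ s hs).fun_pow 2).fun_add ((((hasDerivAt_const s γ).fun_div ((hξd s hs).fun_pow 2)
          (pow_ne_zero 2 hξ0.ne')).const_sub 1).fun_mul ((hBξ s hs).fun_pow 2)))).congr_deriv ?_
    simp only [Function.comp_apply]
    generalize 2 * γ / L ^ 3 * ((1 - 2 * (s / L) ^ 2) / ((s / L) ^ 3 * (1 - (s / L) ^ 2) ^ 2))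
        + 1 / L ^ 3 * (3 / 2 * (s / L) / (1 - (s / L) ^ 2) ^ 3
          + 3 / 2 * (s / L) * (2 + 3 * (s / L) ^ 2) / (1 - (s / L) ^ 2) ^ 4) = D
    generalize √(1 - (s / L) ^ 2) = c
    generalize liouvillePotential γ L s = q
    have e1 : (0 * ξ s ^ 2 - γ * ((2 : ℕ) * ξ s ^ (2 - 1) * c)) / (ξ s ^ 2) ^ 2
        = -(2 * γ * c / ξ s ^ 3) := by
      field_simp; push_cast; ring
    rw [e1]; push_cast; ring
  intro s₂ hs₂
  have hs₂0 := hpos s₂ hs₂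
  have hs₀m : s₀ ∈ Icc s₀ s₁ := left_mem_Icc.mpr hs₀₁
  have hsub : Icc s₀ s₂ ⊆ Icc s₀ s₁ := Icc_subset_Icc_right hs₂.2
  -- The comparison function A₁ s/L³ − A₂/(L² s) is a primitive of the bound just described.
  have hdiff := abs_sub_le_of_hasDerivAt_le hs₂.1
    (f := fun s => (M s ^ 2 + liouvillePotential γ L s * P s ^ 2)
        - (B₁ (ξ s) ^ 2 + (1 - γ / ξ s ^ 2) * B (ξ s) ^ 2))
    (g := fun s => A₁ / L ^ 3 * s - A₂ / L ^ 2 * s⁻¹)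
    (g' := fun s => A₁ / L ^ 3 + A₂ / L ^ 2 / s ^ 2)
    (fun s hs => hder s (hsub hs))
    (fun s hs => by
      have hs0 := hpos s (hsub hs)
      refine (((hasDerivAt_id s).const_mul (A₁ / L ^ 3)).fun_sub
        ((hasDerivAt_inv hs0.ne').const_mul (A₂ / L ^ 2))).congr_deriv ?_
      field_simp
      ring)
    (fun s hs => by
      have hs' := hsub hs
      refine liouville_energy_deriv_bound hc₁ hc₁' hL0 (hpos s hs') (hs'.2.trans_lt hs₁L)
        (hcs s hs') (hPb s hs') (sq_nonneg _)
        ((abs_sq_sub_sq_le (hBbs s hs').1 (hPB s hs')).trans ?_)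
      have e2 : C * s / L ^ 2 ≤ C := by
        rw [div_le_iff₀ (by positivity)]
        have := hs'.2
        gcongr; linarith
      have := hpos s hs'
      gcongr)
  have hinit : |(M s₀ ^ 2 + liouvillePotential γ L s₀ * P s₀ ^ 2)
        - (B₁ (ξ s₀) ^ 2 + (1 - γ / ξ s₀ ^ 2) * B (ξ s₀) ^ 2)| ≤ A₀ / L ^ 2 := by
    obtain ⟨b1, b2, b3⟩ := hbd s₀ hs₀m
    have hξ0 := hξpos s₀ hs₀m
    have hK1 : K / L ^ 2 ≤ K := div_le_self hK (by nlinarith)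
    have d1 : |M s₀ ^ 2 - B₁ (ξ s₀) ^ 2| ≤ K / L ^ 2 * (2 * b + K) :=
      (abs_sq_sub_sq_le (hBbs s₀ hs₀m).2 hM0).trans
        (mul_le_mul_of_nonneg_left (by linarith) (by positivity))
    have d2 : |P s₀ ^ 2 - B (ξ s₀) ^ 2| ≤ K / L ^ 2 * (2 * b + K) :=
      (abs_sq_sub_sq_le (hBbs s₀ hs₀m).1 hP0).trans
        (mul_le_mul_of_nonneg_left (by linarith) (by positivity))
    have d3 : P s₀ ^ 2 ≤ (b + K) ^ 2 := by
      have h1 : |P s₀| ≤ b + K := by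
        calc |P s₀| = |B (ξ s₀) + (P s₀ - B (ξ s₀))| := by congr 1; ring
          _ ≤ |B (ξ s₀)| + |P s₀ - B (ξ s₀)| := abs_add_le _ _
          _ ≤ b + K := add_le_add (hBbs s₀ hs₀m).1 (hP0.trans hK1)
      exact sq_le_sq' (abs_le.mp h1).1 (abs_le.mp h1).2
    have d4 : |1 - γ / ξ s₀ ^ 2| ≤ 1 + |γ| / (c₁ * s₀) ^ 2 := by
      refine (abs_sub _ _).trans (add_le_add (by simp) ?_)
      rw [abs_div, abs_of_pos (pow_pos hξ0 2)]
      gcongr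
    have eq2 : (M s₀ ^ 2 + liouvillePotential γ L s₀ * P s₀ ^ 2)
        - (B₁ (ξ s₀) ^ 2 + (1 - γ / ξ s₀ ^ 2) * B (ξ s₀) ^ 2)
        = (M s₀ ^ 2 - B₁ (ξ s₀) ^ 2)
          + (liouvillePotential γ L s₀ - (1 - γ / ξ s₀ ^ 2)) * P s₀ ^ 2
          + (1 - γ / ξ s₀ ^ 2) * (P s₀ ^ 2 - B (ξ s₀) ^ 2) := by ring
    rw [eq2]
    have f2 : |(liouvillePotential γ L s₀ - (1 - γ / ξ s₀ ^ 2)) * P s₀ ^ 2|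
        ≤ Ψ / L ^ 2 * (b + K) ^ 2 := by
      rw [abs_mul, abs_of_nonneg (sq_nonneg (P s₀))]; gcongr
    have f3 : |(1 - γ / ξ s₀ ^ 2) * (P s₀ ^ 2 - B (ξ s₀) ^ 2)|
        ≤ (1 + |γ| / (c₁ * s₀) ^ 2) * (K / L ^ 2 * (2 * b + K)) := by
      rw [abs_mul]; gcongr
    refine (abs_add_three _ _ _).trans ((add_le_add (add_le_add d1 f2) f3).trans (le_of_eq ?_))
    rw [hA₀]; ring
  have hend : A₁ / L ^ 3 * s₂ - A₂ / L ^ 2 * s₂⁻¹ - (A₁ / L ^ 3 * s₀ - A₂ / L ^ 2 * s₀⁻¹)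
      ≤ (A₁ + A₂ / s₀) / L ^ 2 := by
    have e1 : A₁ / L ^ 3 * s₂ ≤ A₁ / L ^ 2 := by
      have : A₁ / L ^ 2 = A₁ / L ^ 3 * L := by field_simp
      rw [this]
      have := hs₂.2
      gcongr; linarith
    have e2 : 0 ≤ A₂ / L ^ 2 * s₂⁻¹ := by positivity
    have e3 : 0 ≤ A₁ / L ^ 3 * s₀ := by positivity
    have e4 : (A₁ + A₂ / s₀) / L ^ 2 = A₁ / L ^ 2 + A₂ / L ^ 2 * s₀⁻¹ := by field_simp
    rw [e4]; linarith
  have hfin := (abs_sub_abs_le_abs_sub _ _).trans (hdiff.trans hend)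
  rw [add_div]
  linarith

end Energy

/-! ### The normalised Bessel function as a power series -/

section Bessel
open Set

theorem summable_of_le_factorial {c : ℕ → ℝ} {C : ℝ} (hc : ∀ k, |c k| ≤ C / k.factorial) (z : ℝ) :
    Summable fun k => c k * z ^ k := by
  refine Summable.of_norm_bounded ((Real.summable_pow_div_factorial |z|).mul_left C) fun k => ?_
  rw [Real.norm_eq_abs, abs_mul, abs_pow]
  calc _ ≤ C / k.factorial * |z| ^ k := by gcongr; exact hc k
    _ = _ := by ring

theorem abs_succ_mul_le_factorial {c : ℕ → ℝ} {C : ℝ} (hc : ∀ k, |c k| ≤ C / k.factorial) (k : ℕ) :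
    |((k : ℝ) + 1) * c (k + 1)| ≤ C / k.factorial := by
  rw [abs_mul, abs_of_nonneg (by positivity)]
  calc ((k : ℝ) + 1) * |c (k + 1)| ≤ ((k : ℝ) + 1) * (C / (k + 1 : ℕ).factorial) := by
        gcongr; exact hc _
    _ = _ := by rw [Nat.factorial_succ]; push_cast; field_simp

theorem hasDerivAt_tsum_of_le_factorial {c : ℕ → ℝ} {C : ℝ} (hc : ∀ k, |c k| ≤ C / k.factorial)
    (z : ℝ) : HasDerivAt (fun z => ∑' k, c k * z ^ k) (∑' k : ℕ, (((k : ℝ) + 1) * c (k + 1)) * z ^ k) z := by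
  set R := |z| + 1
  have hR : 0 < R := by positivity
  have hsum : Summable fun k : ℕ => |(k : ℝ) * c k| * R ^ (k - 1) := by
    rw [← summable_nat_add_iff 1]
    refine Summable.of_nonneg_of_le (fun k => by positivity) (fun k => ?_)
      ((Real.summable_pow_div_factorial R).mul_left C)
    have h := abs_succ_mul_le_factorial hc k
    rw [Nat.add_sub_cancel]
    push_cast
    calc _ ≤ C / k.factorial * R ^ k := by gcongr
      _ = _ := by ring
  have hz : z ∈ Metric.ball (0 : ℝ) R := by
    rw [Metric.mem_ball, dist_zero_right, Real.norm_eq_abs]; exact lt_add_one _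
  have h := hasDerivAt_tsum_of_isPreconnected (g := fun k z => c k * z ^ k)
    (g' := fun k z => c k * (k * z ^ (k - 1))) hsum Metric.isOpen_ball
    (convex_ball (0 : ℝ) R).isPreconnected
    (fun k y _ => (hasDerivAt_pow k y).const_mul (c k))
    (fun k y hy => by
      have hy' : |y| ≤ R := by
        rw [Metric.mem_ball, dist_zero_right, Real.norm_eq_abs] at hy; exact hy.le
      rw [← mul_assoc, Real.norm_eq_abs, abs_mul, abs_pow, mul_comm (c k)]
      gcongr)
    hz (summable_of_le_factorial hc z) hz
  refine h.congr_deriv ?_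
  have hs : Summable fun k : ℕ => c k * (k * z ^ (k - 1)) := by
    rw [← summable_nat_add_iff 1]
    refine (summable_of_le_factorial (abs_succ_mul_le_factorial hc) z).congr fun k => ?_
    rw [Nat.add_sub_cancel]; push_cast; ring
  rw [hs.tsum_eq_zero_add]
  simp only [Nat.cast_zero, zero_mul, mul_zero, zero_add]
  refine tsum_congr fun k => ?_
  rw [Nat.add_sub_cancel]; push_cast; ring

/-- Taylor coefficients of the normalised Bessel function. -/
noncomputable def besselCoeff (α : ℝ) (k : ℕ) : ℝ :=
  (-1 / 4) ^ k / (k.factorial * ∏ j ∈ Finset.range k, (α + 1 + j))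

theorem besselCoeff_succ {α : ℝ} (hα : -1 < α) (k : ℕ) :
    4 * ((k : ℝ) + 1) * (k + α + 1) * besselCoeff α (k + 1) = -besselCoeff α k := by
  have h1 : ∀ j : ℕ, α + 1 + j ≠ 0 := fun j => by
    have : (0 : ℝ) ≤ j := j.cast_nonneg
    linarith
  have h2 : ∏ j ∈ Finset.range k, (α + 1 + j) ≠ 0 := Finset.prod_ne_zero_iff.mpr fun j _ => h1 j
  have h3 := h1 k
  rw [besselCoeff, besselCoeff, Finset.prod_range_succ, Nat.factorial_succ, pow_succ]
  push_cast
  field_simp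
  ring

/-- Only the first ratio of coefficients, 1/(4(α+1)), can be large, when α is close to −1; this
accounts for the constant. For k ≥ 1 one has k+α+1 > 1, and the ratio is at most 1/(k+1). -/
theorem abs_besselCoeff_le {α : ℝ} (hα : -1 < α) (k : ℕ) :
    |besselCoeff α k| ≤ (1 + 1 / (α + 1)) / k.factorial := by
  have hpos : 0 < α + 1 := by linarith
  have hC : 1 ≤ 1 + 1 / (α + 1) := by have : 0 < 1 / (α + 1) := by positivity
                                      linarith
  induction k with
  | zero => simpa [besselCoeff] using hC
  | succ k ih =>
    have hk0 : (0 : ℝ) ≤ k := k.cast_nonneg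
    have hk : 0 < (k : ℝ) + α + 1 := by linarith
    have h := besselCoeff_succ hα k
    have h' : besselCoeff α (k + 1) = -besselCoeff α k / (4 * ((k : ℝ) + 1) * (k + α + 1)) := by
      field_simp; linear_combination h
    rcases Nat.eq_zero_or_pos k with rfl | hk1
    · rw [h', abs_div, abs_neg]
      simp only [besselCoeff, Nat.cast_zero, zero_add, mul_one, pow_zero, Nat.factorial_zero,
        Nat.cast_one, Finset.range_zero, Finset.prod_empty, div_one, abs_one, Nat.factorial_one]
      rw [abs_of_pos (by linarith), div_le_iff₀ (by linarith)]
      have : 1 / (α + 1) * (α + 1) = 1 := by field_simp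
      nlinarith
    · have hk2 : (1 : ℝ) ≤ k := by exact_mod_cast hk1
      rw [h', abs_div, abs_neg, abs_of_pos (show 0 < 4 * ((k : ℝ) + 1) * (k + α + 1) by positivity),
        Nat.factorial_succ]
      push_cast
      rw [div_le_div_iff₀ (by positivity) (by positivity)]
      have e1 : ((k : ℝ) + 1) * k.factorial ≤ (4 * (k + 1) * (k + α + 1)) * k.factorial := by
        have : (0 : ℝ) < k.factorial := by positivity
        gcongr
        nlinarith
      calc _ ≤ (1 + 1 / (α + 1)) / k.factorial * (((k : ℝ) + 1) * (k.factorial : ℝ)) := by gcongr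
        _ ≤ (1 + 1 / (α + 1)) / k.factorial * ((4 * (k + 1) * (k + α + 1)) * k.factorial) := by gcongr
        _ = _ := by field_simp

/-- The normalised Bessel function as a function of the squared variable. -/
noncomputable def besselSeries (α z : ℝ) : ℝ := ∑' k, besselCoeff α k * z ^ k

/-- Derivative of `besselSeries`. -/
noncomputable def besselSeriesDeriv (α z : ℝ) : ℝ :=
  ∑' k : ℕ, (((k : ℝ) + 1) * besselCoeff α (k + 1)) * z ^ k

theorem hasDerivAt_besselSeries {α : ℝ} (hα : -1 < α) (z : ℝ) :
    HasDerivAt (besselSeries α) (besselSeriesDeriv α z) z :=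
  hasDerivAt_tsum_of_le_factorial (abs_besselCoeff_le hα) z

/-- The coefficient recursion says that zF'' + (α+1)F' + F/4 = 0; this is solved for F'', whence z ≠
0. -/
theorem hasDerivAt_besselSeriesDeriv {α : ℝ} (hα : -1 < α) {z : ℝ} (hz : z ≠ 0) :
    HasDerivAt (besselSeriesDeriv α)
      (-((α + 1) * besselSeriesDeriv α z + besselSeries α z / 4) / z) z := by
  have hc := abs_besselCoeff_le hα
  have hc1 := abs_succ_mul_le_factorial hc
  have hc2 := abs_succ_mul_le_factorial hc1
  have h := hasDerivAt_tsum_of_le_factorial hc1 z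
  refine h.congr_deriv ?_
  rw [eq_div_iff hz]
  have e1 : (∑' k : ℕ, (((k : ℝ) + 1) * (((k + 1 : ℕ) : ℝ) + 1) * besselCoeff α (k + 1 + 1)) * z ^ k) * z
      = ∑' k : ℕ, ((k : ℝ) * (k + 1) * besselCoeff α (k + 1)) * z ^ k := by
    have hs : Summable fun k : ℕ => ((k : ℝ) * (k + 1) * besselCoeff α (k + 1)) * z ^ k := by
      rw [← summable_nat_add_iff 1]
      refine ((summable_of_le_factorial hc2 z).mul_right z).congr fun k => ?_
      push_cast; ring
    rw [hs.tsum_eq_zero_add, ← tsum_mul_right]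
    simp only [Nat.cast_zero, zero_mul, zero_add]
    refine tsum_congr fun k => ?_
    push_cast; ring
  have e2 : (∑' k : ℕ, (((k : ℝ) + 1) * ((((k + 1 : ℕ) : ℝ) + 1) * besselCoeff α (k + 1 + 1))) * z ^ k) * z
      = ∑' k : ℕ, ((k : ℝ) * (k + 1) * besselCoeff α (k + 1)) * z ^ k := by
    rw [← e1]; congr 1; exact tsum_congr fun k => by ring
  rw [e2, besselSeriesDeriv, besselSeries, ← tsum_mul_left, ← tsum_div_const,
    ← ((summable_of_le_factorial hc1 z).mul_left (α + 1)).tsum_add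
      ((summable_of_le_factorial hc z).div_const 4), ← tsum_neg]
  refine tsum_congr fun k => ?_
  have := besselCoeff_succ hα k
  linear_combination (z ^ k / 4) * this

theorem besselSeries_zero (α : ℝ) : besselSeries α 0 = 1 := by
  rw [besselSeries, tsum_eq_single 0]
  · simp [besselCoeff]
  · intro k hk; simp [hk]

/-- The solution `∑ (-1/4)^k s^{2k} / (k! (α+1)_k)` of `w'' + (2α+1)/s w' + w = 0`. -/
noncomputable def besselW (α s : ℝ) : ℝ := besselSeries α (s ^ 2)

/-- Derivative of `besselW`. -/
noncomputable def besselW' (α s : ℝ) : ℝ := 2 * s * besselSeriesDeriv α (s ^ 2)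

theorem hasDerivAt_besselW {α : ℝ} (hα : -1 < α) (s : ℝ) :
    HasDerivAt (besselW α) (besselW' α s) s := by
  refine ((hasDerivAt_besselSeries hα (s ^ 2)).comp s (hasDerivAt_pow 2 s)).congr_deriv ?_
  simp [besselW']; ring

theorem hasDerivAt_besselW' {α : ℝ} (hα : -1 < α) {s : ℝ} (hs : 0 < s) :
    HasDerivAt (besselW' α) (-((2 * α + 1) / s * besselW' α s) - besselW α s) s := by
  have h := ((hasDerivAt_id s).const_mul 2).fun_mul
    ((hasDerivAt_besselSeriesDeriv hα (z := s ^ 2) (by positivity)).comp s (hasDerivAt_pow 2 s))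
  refine h.congr_deriv ?_
  simp only [besselW', besselW, id, Function.comp_apply]
  field_simp
  push_cast; ring

theorem continuous_besselW {α : ℝ} (hα : -1 < α) : Continuous (besselW α) :=
  continuous_iff_continuousAt.mpr fun s => (hasDerivAt_besselW hα s).continuousAt

theorem continuous_besselSeriesDeriv {α : ℝ} (hα : -1 < α) : Continuous (besselSeriesDeriv α) :=
  continuous_iff_continuousAt.mpr fun z =>
    (hasDerivAt_tsum_of_le_factorial (abs_succ_mul_le_factorial (abs_besselCoeff_le hα)) z).continuousAt

theorem continuous_besselW' {α : ℝ} (hα : -1 < α) : Continuous (besselW' α) := by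
  have := continuous_besselSeriesDeriv hα
  unfold besselW'
  fun_prop

/-- The Liouville normal form of `w'' + (2α+1)/s w' + q w = 0`. -/
theorem hasDerivAt_rpow_mul {α s q w₂ : ℝ} {w w₁ : ℝ → ℝ} (hs : 0 < s) (hw : HasDerivAt w (w₁ s) s)
    (hw₁ : HasDerivAt w₁ w₂ s) (hw₂ : w₂ = -((2 * α + 1) / s * w₁ s) - q * w s) :
    HasDerivAt (fun t => t ^ (α + 1 / 2) * w t)
      (s ^ (α + 1 / 2) * (w₁ s + (α + 1 / 2) / s * w s)) s ∧
    HasDerivAt (fun t => t ^ (α + 1 / 2) * (w₁ t + (α + 1 / 2) / t * w t))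
      (-((q - (α ^ 2 - 1 / 4) / s ^ 2) * (s ^ (α + 1 / 2) * w s))) s := by
  have hp : HasDerivAt (fun t : ℝ => t ^ (α + 1 / 2)) ((α + 1 / 2) / s * s ^ (α + 1 / 2)) s :=
    (Real.hasDerivAt_rpow_const (Or.inl hs.ne')).congr_deriv (by
      rw [Real.rpow_sub_one hs.ne']; ring)
  constructor
  · refine (hp.fun_mul hw).congr_deriv ?_
    ring
  · have hd : HasDerivAt (fun t : ℝ => (α + 1 / 2) / t) (-((α + 1 / 2) / s ^ 2)) s := by
      refine ((hasDerivAt_const s (α + 1 / 2)).fun_div (hasDerivAt_id s) hs.ne').congr_deriv ?_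
      simp only [id]; ring
    refine (hp.fun_mul (hw₁.fun_add (hd.fun_mul hw))).congr_deriv ?_
    rw [hw₂]
    field_simp
    ring

end Bessel

/-! ### Boundedness of the Bessel function and existence of its amplitude at infinity -/

section BesselAsymptotics
open Set

/-- The Bessel function in Liouville normal form, normalised by `s^(α+1/2)` at the origin. -/
noncomputable def besselB (α s : ℝ) : ℝ := s ^ (α + 1 / 2) * besselW α s

/-- Derivative of `besselB`. -/
noncomputable def besselB' (α s : ℝ) : ℝ :=
  s ^ (α + 1 / 2) * (besselW' α s + (α + 1 / 2) / s * besselW α s)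

theorem hasDerivAt_besselB {α : ℝ} (hα : -1 < α) {s : ℝ} (hs : 0 < s) :
    HasDerivAt (besselB α) (besselB' α s) s :=
  (hasDerivAt_rpow_mul (q := 1) hs (hasDerivAt_besselW hα s) (hasDerivAt_besselW' hα hs)
    (by ring)).1

theorem hasDerivAt_besselB' {α : ℝ} (hα : -1 < α) {s : ℝ} (hs : 0 < s) :
    HasDerivAt (besselB' α) (-((1 - (α ^ 2 - 1 / 4) / s ^ 2) * besselB α s)) s :=
  (hasDerivAt_rpow_mul (q := 1) hs (hasDerivAt_besselW hα s) (hasDerivAt_besselW' hα hs)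
    (by ring)).2

/-- The energy B² + B'² changes only through the term γ/t², which is integrable at infinity:
multiplied by exp(|γ|/t) it is nonincreasing. -/
theorem exists_bound_besselB {α : ℝ} (hα : -1 < α) {s₀ : ℝ} (hs₀ : 0 < s₀) :
    ∃ b, 0 ≤ b ∧ ∀ t ≥ s₀, |besselB α t| ≤ b ∧ |besselB' α t| ≤ b := by
  set γ := α ^ 2 - 1 / 4
  set e : ℝ → ℝ := fun t => besselB α t ^ 2 + besselB' α t ^ 2 with he
  refine ⟨√(e s₀ * Real.exp (|γ| / s₀)), Real.sqrt_nonneg _, fun t ht => ?_⟩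
  have h := le_of_hasDerivAt_le ht (f := fun s => e s * Real.exp (|γ| / s)) (g := fun _ => 0)
    (g' := fun _ => 0)
    (fun s hs => by
      have hs0 : 0 < s := hs₀.trans_le hs.1
      exact (((hasDerivAt_besselB hα hs0).fun_pow 2).fun_add
        ((hasDerivAt_besselB' hα hs0).fun_pow 2)).fun_mul
        (((hasDerivAt_const s |γ|).fun_div (hasDerivAt_id s) hs0.ne').exp))
    (fun s _ => hasDerivAt_const s 0)
    (fun s hs => by
      have hs0 : 0 < s := hs₀.trans_le hs.1
      simp only [id]
      generalize besselB α s = x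
      generalize besselB' α s = y
      have h1 : ((2 : ℕ) * x ^ (2 - 1) * y + (2 : ℕ) * y ^ (2 - 1) * -((1 - γ / s ^ 2) * x))
          * Real.exp (|γ| / s) + (x ^ 2 + y ^ 2) * (Real.exp (|γ| / s) *
            ((0 * s - |γ| * 1) / s ^ 2))
          = (Real.exp (|γ| / s) / s ^ 2) * (2 * (γ * (x * y)) - |γ| * (x ^ 2 + y ^ 2)) := by
        field_simp; push_cast; ring
      rw [h1]
      refine mul_nonpos_of_nonneg_of_nonpos (by positivity) ?_
      have h2 : γ * (x * y) ≤ |γ| * (|x| * |y|) := by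
        rw [← abs_mul, ← abs_mul]; exact le_abs_self _
      have h3 : 2 * (|x| * |y|) ≤ x ^ 2 + y ^ 2 := by
        rw [← sq_abs x, ← sq_abs y]; nlinarith [sq_nonneg (|x| - |y|)]
      nlinarith [abs_nonneg γ])
  have h2 : e t ≤ e s₀ * Real.exp (|γ| / s₀) := by
    have h3 : e t ≤ e t * Real.exp (|γ| / t) := by
      refine le_mul_of_one_le_right (by positivity) (Real.one_le_exp ?_)
      have : 0 < t := hs₀.trans_le ht
      positivity
    linarith
  exact ⟨Real.abs_le_sqrt (le_trans (by simp only [he]; nlinarith [sq_nonneg (besselB' α t)]) h2),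
    Real.abs_le_sqrt (le_trans (by simp only [he]; nlinarith [sq_nonneg (besselB α t)]) h2)⟩

theorem exists_limit_of_deriv_le_div_sq {f f' : ℝ → ℝ} {s₀ D : ℝ} (hs₀ : 0 < s₀) (hD : 0 ≤ D)
    (hf : ∀ t ≥ s₀, HasDerivAt f (f' t) t) (hf' : ∀ t ≥ s₀, |f' t| ≤ D / t ^ 2) :
    ∃ ℓ, ∀ t ≥ s₀, |f t - ℓ| ≤ D / t := by
  have key : ∀ t₁ ≥ s₀, ∀ t₂ ≥ t₁, |f t₂ - f t₁| ≤ D / t₁ := by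
    intro t₁ h₁ t₂ h₂
    have h1 : 0 < t₁ := hs₀.trans_le h₁
    have := abs_sub_le_of_hasDerivAt_le h₂ (f := f) (g := fun t => -(D * t⁻¹)) (g' := fun t => D / t ^ 2)
      (fun s hs => hf s (h₁.trans hs.1))
      (fun s hs => by
        refine ((hasDerivAt_inv (h1.trans_le hs.1).ne').const_mul D).fun_neg.congr_deriv ?_
        ring)
      (fun s hs => hf' s (h₁.trans hs.1))
    have h3 : 0 ≤ D * t₂⁻¹ := mul_nonneg hD (inv_nonneg.mpr (h1.le.trans h₂))
    rw [div_eq_mul_inv]; linarith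
  have hc : CauchySeq f := by
    refine Metric.cauchySeq_iff'.mpr fun ε hε => ⟨max s₀ (D / ε + 1), fun n hn => ?_⟩
    have hN : 0 < max s₀ (D / ε + 1) := hs₀.trans_le (le_max_left _ _)
    rw [Real.dist_eq]
    refine (key _ (le_max_left _ _) n hn).trans_lt ?_
    rw [div_lt_iff₀ hN]
    calc D = ε * (D / ε) := by field_simp
      _ < ε * (D / ε + 1) := by nlinarith
      _ ≤ _ := by gcongr; exact le_max_right _ _
  obtain ⟨ℓ, hℓ⟩ := cauchySeq_tendsto_of_complete hc
  refine ⟨ℓ, fun t ht => ?_⟩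
  have h1 : Tendsto (fun u => |f t - f u|) atTop (nhds |f t - ℓ|) := (hℓ.const_sub (f t)).abs
  refine le_of_tendsto h1 ((eventually_ge_atTop t).mono fun u hu => ?_)
  rw [abs_sub_comm]; exact key t ht u hu

/-- Variation of constants: rotating (B, B') by the angle t removes the free oscillation, and the
rotated vector has derivative O(t⁻²). The limits are not yet identified. -/
theorem exists_limit_besselB {α : ℝ} (hα : -1 < α) :
    ∃ ar ai D : ℝ, ∀ t ≥ 1,
      |Real.cos t * besselB α t - Real.sin t * besselB' α t - ar| ≤ D / t ∧
      |Real.sin t * besselB α t + Real.cos t * besselB' α t - ai| ≤ D / t := by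
  obtain ⟨b, hb, hB⟩ := exists_bound_besselB hα one_pos
  set γ := α ^ 2 - 1 / 4 with hγ
  have hd : ∀ t ≥ (1 : ℝ), ∀ z : ℝ, |z| ≤ 1 → |z * (γ / t ^ 2 * besselB α t)| ≤ |γ| * b / t ^ 2 := by
    intro t ht z hz
    have ht0 : 0 < t := by linarith
    rw [abs_mul, abs_mul, abs_div, abs_of_pos (pow_pos ht0 2)]
    calc _ ≤ 1 * (|γ| / t ^ 2 * b) := by gcongr; exact (hB t ht).1
      _ = _ := by ring
  obtain ⟨ar, har⟩ := exists_limit_of_deriv_le_div_sq (D := |γ| * b)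
    (f := fun t => Real.cos t * besselB α t - Real.sin t * besselB' α t)
    (f' := fun t => -Real.sin t * (γ / t ^ 2 * besselB α t)) one_pos (by positivity)
    (fun t ht => by
      have ht0 : 0 < t := by linarith
      refine (((Real.hasDerivAt_cos t).fun_mul (hasDerivAt_besselB hα ht0)).fun_sub
        ((Real.hasDerivAt_sin t).fun_mul (hasDerivAt_besselB' hα ht0))).congr_deriv ?_
      ring)
    (fun t ht => hd t ht _ (by rw [abs_neg]; exact Real.abs_sin_le_one t))
  obtain ⟨ai, hai⟩ := exists_limit_of_deriv_le_div_sq (D := |γ| * b)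
    (f := fun t => Real.sin t * besselB α t + Real.cos t * besselB' α t)
    (f' := fun t => Real.cos t * (γ / t ^ 2 * besselB α t)) one_pos (by positivity)
    (fun t ht => by
      have ht0 : 0 < t := by linarith
      refine (((Real.hasDerivAt_sin t).fun_mul (hasDerivAt_besselB hα ht0)).fun_add
        ((Real.hasDerivAt_cos t).fun_mul (hasDerivAt_besselB' hα ht0))).congr_deriv ?_
      ring)
    (fun t ht => hd t ht _ (Real.abs_cos_le_one t))
  exact ⟨ar, ai, |γ| * b, fun t ht => ⟨har t ht, hai t ht⟩⟩

/-- Near 0 the bound comes from the power series; for t ≥ 1 from the boundedness of t^(α+1/2) w and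
its derivative. A bound valid on the whole half-line is needed for the Laplace transforms. -/
theorem exists_linear_bound_besselW {α : ℝ} (hα : -1 < α) :
    ∃ K, 0 ≤ K ∧ ∀ t > 0, |besselW α t - 1| ≤ K * t ∧ |besselW' α t| ≤ K * t := by
  obtain ⟨b, hb, hB⟩ := exists_bound_besselB hα one_pos
  obtain ⟨K₁, hK₁⟩ := isCompact_Icc.exists_bound_of_continuousOn (s := Icc (0 : ℝ) 1)
    (f := fun t => 2 * besselSeriesDeriv α (t ^ 2))
    (by have := continuous_besselSeriesDeriv hα
        fun_prop)
  have hK₁0 : 0 ≤ K₁ := (norm_nonneg _).trans (hK₁ 0 (by simp))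
  have hw1 : ∀ t, 0 ≤ t → t ≤ 1 → |besselW' α t| ≤ K₁ * t := by
    intro t ht0 ht1
    have := hK₁ t ⟨ht0, ht1⟩
    rw [Real.norm_eq_abs] at this
    have e : besselW' α t = (2 * besselSeriesDeriv α (t ^ 2)) * t := by rw [besselW']; ring
    rw [e, abs_mul, abs_of_nonneg ht0]
    gcongr
  have hw : ∀ t, 0 ≤ t → t ≤ 1 → |besselW α t - 1| ≤ K₁ * t := by
    intro t ht0 ht1
    have h := abs_sub_le_of_hasDerivAt_le ht0 (f := besselW α) (g := fun t => K₁ * t)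
      (g' := fun _ => K₁) (fun s _ => hasDerivAt_besselW hα s)
      (fun s _ => ((hasDerivAt_id s).const_mul K₁).congr_deriv (by simp))
      (fun s hs => (hw1 s hs.1 (hs.2.trans ht1)).trans
        (mul_le_of_le_one_right hK₁0 (hs.2.trans ht1)))
    simpa [besselW, besselSeries_zero] using h
  have hbig : ∀ t ≥ (1 : ℝ), ∀ x : ℝ, |t ^ (α + 1 / 2) * x| ≤ b → |x| ≤ b * t := by
    intro t ht x hx
    have ht0 : 0 < t := by linarith
    have hp : 0 < t ^ (α + 1 / 2) := Real.rpow_pos_of_pos ht0 _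
    rw [abs_mul, abs_of_pos hp] at hx
    -- The exponent α + 3/2 is positive, so one factor t compensates a possibly decaying power.
    have h1 : 1 ≤ t * t ^ (α + 1 / 2) := by
      rw [← Real.rpow_one_add' ht0.le (by linarith)]
      exact Real.one_le_rpow ht (by linarith)
    calc |x| ≤ (t * t ^ (α + 1 / 2)) * |x| := le_mul_of_one_le_left (abs_nonneg _) h1
      _ = t * (t ^ (α + 1 / 2) * |x|) := by ring
      _ ≤ t * b := by gcongr
      _ = _ := mul_comm _ _
  have hwb : ∀ t ≥ (1 : ℝ), |besselW α t| ≤ b * t := fun t ht => hbig t ht _ (hB t ht).1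
  set c := |α + 1 / 2|
  refine ⟨K₁ + 1 + b + c * b, by positivity, fun t ht => ?_⟩
  have hcb : 0 ≤ c * b := by positivity
  rcases le_total t 1 with ht1 | ht1
  · exact ⟨(hw t ht.le ht1).trans (by gcongr; linarith),
      (hw1 t ht.le ht1).trans (by gcongr; linarith)⟩
  · constructor
    · calc _ ≤ |besselW α t| + |1| := abs_sub _ _
        _ ≤ b * t + 1 * t := add_le_add (hwb t ht1) (by simpa using ht1)
        _ ≤ _ := by rw [← add_mul]; exact mul_le_mul_of_nonneg_right (by linarith) ht.le
    · have h1 := hbig t ht1 _ (hB t ht1).2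
      have h2 : |(α + 1 / 2) / t * besselW α t| ≤ c * b * t := by
        rw [abs_mul, abs_div, abs_of_pos ht]
        calc _ ≤ c / t * (b * t) := by gcongr; exact hwb t ht1
          _ = c * b * 1 := by field_simp
          _ ≤ _ := mul_le_mul_of_nonneg_left ht1 hcb
      calc |besselW' α t| = |(besselW' α t + (α + 1 / 2) / t * besselW α t)
            - (α + 1 / 2) / t * besselW α t| := by congr 1; ring
        _ ≤ b * t + c * b * t := (abs_sub _ _).trans (add_le_add h1 h2)
        _ ≤ _ := by rw [← add_mul]; exact mul_le_mul_of_nonneg_right (by linarith) ht.le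

end BesselAsymptotics

/-! ### Laplace transforms of power-bounded functions -/

section LaplaceTransform
open Set Topology

/-- A continuous function on the half-line dominated by `t^a` near `0` and by a power at `∞`. -/
def PowerBounded (a : ℝ) (f : ℝ → ℝ) : Prop :=
  ContinuousOn f (Ioi 0) ∧ ∃ b ≥ a, ∃ C, 0 ≤ C ∧ ∀ t > 0, |f t| ≤ C * (t ^ a + t ^ b)

/-- The Laplace transform. -/
noncomputable def laplace (f : ℝ → ℝ) (p : ℂ) : ℂ :=
  ∫ t in Ioi (0 : ℝ), Complex.exp (-(p * t)) * (f t : ℂ)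

theorem PowerBounded.id_mul {a : ℝ} {f : ℝ → ℝ} (hf : PowerBounded a f) :
    PowerBounded (a + 1) fun t => t * f t := by
  obtain ⟨hc, b, hb, C, hC, h⟩ := hf
  refine ⟨continuousOn_id.mul hc, b + 1, by linarith, C, hC, fun t ht => ?_⟩
  rw [abs_mul, abs_of_pos ht, Real.rpow_add_one ht.ne', Real.rpow_add_one ht.ne']
  calc t * |f t| ≤ t * (C * (t ^ a + t ^ b)) := by gcongr; exact h t ht
    _ = _ := by ring

theorem PowerBounded.exp_neg_mul_integrableOn {a : ℝ} {f : ℝ → ℝ} (ha : -1 < a)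
    (hf : PowerBounded a f) {r : ℝ} (hr : 0 < r) :
    IntegrableOn (fun t => Real.exp (-(r * t)) * |f t|) (Ioi 0) := by
  obtain ⟨hc, b, hb, C, hC, h⟩ := hf
  have hi : ∀ s : ℝ, -1 < s → IntegrableOn (fun t : ℝ => t ^ s * Real.exp (-(r * t))) (Ioi 0) := by
    intro s hs
    simpa using integrableOn_rpow_mul_exp_neg_mul_rpow hs one_pos hr
  refine Integrable.mono' (((hi a ha).add (hi b (by linarith))).const_mul C) ?_ ?_
  · refine ContinuousOn.aestronglyMeasurable ?_ measurableSet_Ioi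
    exact ContinuousOn.mul (by fun_prop) hc.abs
  · refine (ae_restrict_iff' measurableSet_Ioi).mpr (Eventually.of_forall fun t ht => ?_)
    rw [Real.norm_eq_abs, abs_of_nonneg (by positivity)]
    calc _ ≤ Real.exp (-(r * t)) * (C * (t ^ a + t ^ b)) := by gcongr; exact h t ht
      _ = _ := by simp only [Pi.add_apply]; ring

theorem norm_exp_neg_mul_mul (p : ℂ) (t x : ℝ) :
    ‖Complex.exp (-(p * t)) * (x : ℂ)‖ = Real.exp (-(p.re * t)) * |x| := by
  rw [norm_mul, Complex.norm_exp, Complex.norm_real, Real.norm_eq_abs]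
  simp

theorem PowerBounded.aestronglyMeasurable {a : ℝ} {f : ℝ → ℝ}
    (hf : PowerBounded a f) (p : ℂ) :
    AEStronglyMeasurable (fun t : ℝ => Complex.exp (-(p * t)) * (f t : ℂ))
      (volume.restrict (Ioi 0)) := by
  refine ContinuousOn.aestronglyMeasurable ?_ measurableSet_Ioi
  exact ContinuousOn.mul (by fun_prop) (Complex.continuous_ofReal.comp_continuousOn hf.1)

theorem PowerBounded.integrableOn {a : ℝ} {f : ℝ → ℝ} (ha : -1 < a)
    (hf : PowerBounded a f) {p : ℂ} (hp : 0 < p.re) :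
    IntegrableOn (fun t : ℝ => Complex.exp (-(p * t)) * (f t : ℂ)) (Ioi 0) := by
  refine Integrable.mono' (hf.exp_neg_mul_integrableOn ha hp) (hf.aestronglyMeasurable p) ?_
  exact Eventually.of_forall fun t => (norm_exp_neg_mul_mul p t (f t)).le

theorem PowerBounded.hasDerivAt_laplace {a : ℝ} {f : ℝ → ℝ} (ha : -1 < a)
    (hf : PowerBounded a f) {p : ℂ} (hp : 0 < p.re) :
    HasDerivAt (laplace f) (-laplace (fun t => t * f t) p) p := by
  have h := hasDerivAt_integral_of_dominated_loc_of_deriv_le (𝕜 := ℂ)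
    (μ := volume.restrict (Ioi (0 : ℝ))) (x₀ := p) (s := {z : ℂ | p.re / 2 < z.re})
    (F := fun p t => Complex.exp (-(p * t)) * (f t : ℂ))
    (F' := fun p t => -(Complex.exp (-(p * t)) * ((t * f t : ℝ) : ℂ)))
    (bound := fun t => Real.exp (-(p.re / 2 * t)) * |t * f t|)
    ((isOpen_lt continuous_const Complex.continuous_re).mem_nhds (by simp; linarith))
    (Eventually.of_forall fun z => hf.aestronglyMeasurable z) (hf.integrableOn ha hp)
    (hf.id_mul.aestronglyMeasurable p).neg
    ((ae_restrict_iff' measurableSet_Ioi).mpr (Eventually.of_forall fun t ht z hz => ?_))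
    (hf.id_mul.exp_neg_mul_integrableOn (by linarith) (by linarith))
    (Eventually.of_forall fun t z _ => ?_)
  · refine h.2.congr_deriv ?_
    rw [integral_neg]; rfl
  · rw [norm_neg, norm_exp_neg_mul_mul]
    have h1 : (0 : ℝ) < t := ht
    have h2 : p.re / 2 < z.re := hz
    gcongr
  · have h1 : HasDerivAt (fun z : ℂ => -(z * (t : ℂ))) (-(1 * (t : ℂ))) z :=
      ((hasDerivAt_id z).mul_const (t : ℂ)).fun_neg
    refine (h1.cexp.mul_const (f t : ℂ)).congr_deriv ?_
    push_cast; ring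

/-- Integration by parts. The boundary term at 0 vanishes because a > 0, and the one at infinity
because of the exponential. -/
theorem PowerBounded.mul_laplace {a : ℝ} {f f' : ℝ → ℝ} (ha : 0 < a)
    (hf : PowerBounded a f) (hf' : PowerBounded (a - 1) f')
    (hd : ∀ t > 0, HasDerivAt f (f' t) t) {p : ℂ} (hp : 0 < p.re) :
    p * laplace f p = laplace f' p := by
  have hnorm : ∀ t : ℝ, t > 0 → ‖Complex.exp (-(p * t)) * (f t : ℂ)‖ = Real.exp (-(p.re * t)) * |f t| :=
    fun t _ => norm_exp_neg_mul_mul p t (f t)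
  obtain ⟨hc, b, hb, C, hC, h⟩ := id hf
  have h0 : Tendsto (fun t : ℝ => Complex.exp (-(p * t)) * (f t : ℂ)) (𝓝[>] 0) (𝓝 0) := by
    have h1 : Tendsto (fun t : ℝ => C * (t ^ a + t ^ b)) (𝓝[>] 0) (𝓝 (C * (0 ^ a + 0 ^ b))) := by
      have hca := (Real.continuous_rpow_const (q := a) ha.le)
      have hcb := (Real.continuous_rpow_const (q := b) (ha.le.trans hb))
      exact ((continuous_const.mul (hca.add hcb)).tendsto 0).mono_left nhdsWithin_le_nhds
    rw [Real.zero_rpow ha.ne', Real.zero_rpow (by linarith), add_zero, mul_zero] at h1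
    refine squeeze_zero_norm' ?_ h1
    filter_upwards [self_mem_nhdsWithin] with t (ht : 0 < t)
    rw [hnorm t ht]
    refine (mul_le_of_le_one_left (abs_nonneg _) (Real.exp_le_one_iff.mpr ?_)).trans (h t ht)
    have : 0 ≤ p.re * t := by positivity
    linarith
  have htop : Tendsto (fun t : ℝ => Complex.exp (-(p * t)) * (f t : ℂ)) atTop (𝓝 0) := by
    have h1 := (((tendsto_rpow_mul_exp_neg_mul_atTop_nhds_zero a p.re hp).add
      (tendsto_rpow_mul_exp_neg_mul_atTop_nhds_zero b p.re hp)).const_mul C)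
    rw [add_zero, mul_zero] at h1
    refine squeeze_zero_norm' ?_ h1
    filter_upwards [eventually_gt_atTop 0] with t ht
    rw [hnorm t ht]
    calc _ ≤ Real.exp (-(p.re * t)) * (C * (t ^ a + t ^ b)) := by gcongr; exact h t ht
      _ = _ := by rw [neg_mul]; ring
  have hi := hf.integrableOn (by linarith) hp
  have hi' := hf'.integrableOn (by linarith) hp
  have key := integral_Ioi_deriv_mul_eq_sub (a := (0 : ℝ))
    (u := fun t : ℝ => Complex.exp (-(p * t))) (v := fun t => (f t : ℂ))
    (u' := fun t : ℝ => -p * Complex.exp (-(p * t))) (v' := fun t => (f' t : ℂ))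
    (a' := 0) (b' := 0)
    (fun t _ => by
      have h1 : HasDerivAt (fun z : ℂ => -(p * z)) (-(p * 1)) (t : ℂ) :=
        ((hasDerivAt_id (t : ℂ)).const_mul p).fun_neg
      refine (h1.comp_ofReal.cexp).congr_deriv ?_
      ring)
    (fun t ht => (hd t ht).ofReal_comp)
    (by
      have h3 := (hi.const_mul (-p)).add hi'
      refine h3.congr (Eventually.of_forall fun t => ?_)
      simp only [Pi.add_apply, Pi.mul_apply]
      ring)
    h0 htop
  rw [sub_zero] at key
  have e : ∀ t : ℝ, -p * Complex.exp (-(p * t)) * (f t : ℂ) + Complex.exp (-(p * t)) * (f' t : ℂ)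
      = -p * (Complex.exp (-(p * t)) * (f t : ℂ)) + Complex.exp (-(p * t)) * (f' t : ℂ) :=
    fun t => by ring
  simp only [e] at key
  rw [integral_add (hi.const_mul _) hi', integral_const_mul] at key
  have : -p * laplace f p + laplace f' p = 0 := key
  linear_combination -this

/-- On the right half-plane a solution of `(ln F)' = -σ (ln g)'` is a multiple of `g^(-σ)`. -/
theorem mul_cpow_eq_of_hasDerivAt {F F' g g' : ℂ → ℂ} {σ : ℂ}
    (hF : ∀ p : ℂ, 0 < p.re → HasDerivAt F (F' p) p)
    (hg : ∀ p : ℂ, 0 < p.re → HasDerivAt g (g' p) p ∧ g p ∈ Complex.slitPlane)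
    (h : ∀ p : ℂ, 0 < p.re → g p * F' p = -σ * g' p * F p) {p q : ℂ} (hp : 0 < p.re)
    (hq : 0 < q.re) : F p * g p ^ σ = F q * g q ^ σ := by
  have hd : ∀ p : ℂ, 0 < p.re → HasDerivAt (fun p => F p * g p ^ σ) 0 p := by
    intro p hp
    have hs := (hg p hp).2
    have h0 := Complex.slitPlane_ne_zero hs
    refine ((hF p hp).fun_mul ((hg p hp).1.cpow_const hs)).congr_deriv ?_
    rw [Complex.cpow_sub _ _ h0, Complex.cpow_one]
    field_simp
    linear_combination (g p ^ σ) * h p hp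
  refine IsOpen.is_const_of_deriv_eq_zero (s := {z : ℂ | 0 < z.re})
    (f := fun p => F p * g p ^ σ) (isOpen_lt continuous_const Complex.continuous_re)
    (convex_halfSpace_re_gt 0).isPreconnected
    (fun z hz => (hd z hz).differentiableAt.differentiableWithinAt)
    (fun z hz => (hd z hz).deriv) hp hq

theorem powerBounded_rpow (a : ℝ) : PowerBounded a fun t => t ^ a := by
  refine ⟨continuousOn_id.rpow_const fun t ht => Or.inl (ne_of_gt ht), a, le_rfl, 1, zero_le_one,
    fun t ht => ?_⟩
  have := Real.rpow_pos_of_pos ht a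
  rw [abs_of_pos this]; linarith

/-- The derivative and integration by parts give p G' = −σ G, so G p^σ is constant on the right
half-plane. Its value at p = 1 is Euler's integral. -/
theorem laplace_rpow {σ : ℝ} (hσ : 0 < σ) {p : ℂ} (hp : 0 < p.re) :
    laplace (fun t => t ^ (σ - 1)) p * p ^ (σ : ℂ) = Real.Gamma σ := by
  have h1 := mul_cpow_eq_of_hasDerivAt (F := laplace (fun t => t ^ (σ - 1)))
    (F' := fun p => -laplace (fun t => t * t ^ (σ - 1)) p) (g := id) (g' := fun _ => 1) (σ := σ)
    (fun p hp => (powerBounded_rpow (σ - 1)).hasDerivAt_laplace (by linarith) hp)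
    (fun p hp => ⟨hasDerivAt_id p, Or.inl hp⟩)
    (fun p hp => by
      have h2 := (powerBounded_rpow σ).mul_laplace (f' := fun t => σ * t ^ (σ - 1)) hσ
        (by
          obtain ⟨h1, b, hb, C, hC, h⟩ := powerBounded_rpow (σ - 1)
          refine ⟨continuousOn_const.mul h1, b, hb, σ * C, by positivity, fun t ht => ?_⟩
          rw [abs_mul, abs_of_pos hσ, mul_assoc]
          have := h t ht
          gcongr)
        (fun t ht => Real.hasDerivAt_rpow_const (Or.inl ht.ne')) hp
      have e1 : laplace (fun t => t * t ^ (σ - 1)) p = laplace (fun t => t ^ σ) p := by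
        refine setIntegral_congr_fun measurableSet_Ioi fun t (ht : 0 < t) => ?_
        simp only
        rw [mul_comm t, ← Real.rpow_add_one ht.ne', sub_add_cancel]
      have e2 : laplace (fun t => σ * t ^ (σ - 1)) p = σ * laplace (fun t => t ^ (σ - 1)) p := by
        rw [laplace, laplace, ← integral_const_mul]
        refine integral_congr_ae (Eventually.of_forall fun t => ?_)
        simp only; push_cast; ring
      rw [e1, id, mul_neg, h2, e2]; ring)
    hp (q := 1) (by simp)
  simp only [id, Complex.one_cpow, mul_one] at h1
  rw [h1, Real.Gamma_eq_integral hσ, laplace, ← integral_complex_ofReal]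
  refine integral_congr_ae (Eventually.of_forall fun t => ?_)
  simp

theorem rpow_le_rpow_add_rpow {a b c t : ℝ} (ht : 0 < t) (hac : a ≤ c) (hcb : c ≤ b) :
    t ^ c ≤ t ^ a + t ^ b := by
  have ha := Real.rpow_pos_of_pos ht a
  have hb := Real.rpow_pos_of_pos ht b
  rcases le_total t 1 with h | h
  · have := Real.rpow_le_rpow_of_exponent_ge ht h hac
    linarith
  · have := Real.rpow_le_rpow_of_exponent_le h hcb
    linarith

theorem PowerBounded.mono {a a' : ℝ} {f : ℝ → ℝ} (hf : PowerBounded a f) (h : a' ≤ a) :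
    PowerBounded a' f := by
  obtain ⟨hc, b, hb, C, hC, hf⟩ := hf
  refine ⟨hc, b, h.trans hb, 2 * C, by positivity, fun t ht => (hf t ht).trans ?_⟩
  have h1 := rpow_le_rpow_add_rpow ht h hb
  have h2 := Real.rpow_pos_of_pos ht a'
  calc C * (t ^ a + t ^ b) ≤ C * ((t ^ a' + t ^ b) + (t ^ a' + t ^ b)) := by gcongr; linarith
    _ = _ := by ring

theorem PowerBounded.add {a : ℝ} {f g : ℝ → ℝ} (hf : PowerBounded a f) (hg : PowerBounded a g) :
    PowerBounded a fun t => f t + g t := by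
  obtain ⟨hc, b, hb, C, hC, hf⟩ := hf
  obtain ⟨hc', b', hb', C', hC', hg⟩ := hg
  refine ⟨hc.add hc', max b b', hb.trans (le_max_left _ _), 2 * (C + C'), by positivity,
    fun t ht => (abs_add_le _ _).trans ((add_le_add (hf t ht) (hg t ht)).trans ?_)⟩
  have h1 := rpow_le_rpow_add_rpow ht hb (le_max_left b b')
  have h2 := rpow_le_rpow_add_rpow ht hb' (le_max_right b b')
  have h3 := Real.rpow_pos_of_pos ht a
  have h4 := Real.rpow_pos_of_pos ht (max b b')
  calc C * (t ^ a + t ^ b) + C' * (t ^ a + t ^ b')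
      ≤ C * (2 * (t ^ a + t ^ max b b')) + C' * (2 * (t ^ a + t ^ max b b')) := by
        refine add_le_add (mul_le_mul_of_nonneg_left ?_ hC) (mul_le_mul_of_nonneg_left ?_ hC') <;>
          linarith
    _ = _ := by ring

theorem PowerBounded.const_mul {a : ℝ} {f : ℝ → ℝ} (hf : PowerBounded a f) (c : ℝ) :
    PowerBounded a fun t => c * f t := by
  obtain ⟨hc, b, hb, C, hC, hf⟩ := hf
  refine ⟨continuousOn_const.mul hc, b, hb, |c| * C, by positivity, fun t ht => ?_⟩
  rw [abs_mul, mul_assoc]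
  exact mul_le_mul_of_nonneg_left (hf t ht) (abs_nonneg c)

theorem laplace_const_mul (c : ℝ) (f : ℝ → ℝ) (p : ℂ) :
    laplace (fun t => c * f t) p = c * laplace f p := by
  rw [laplace, laplace, ← integral_const_mul]
  refine integral_congr_ae (Eventually.of_forall fun t => ?_)
  simp only; push_cast; ring

theorem laplace_add {a : ℝ} {f g : ℝ → ℝ} (ha : -1 < a) (hf : PowerBounded a f)
    (hg : PowerBounded a g) {p : ℂ} (hp : 0 < p.re) :
    laplace (fun t => f t + g t) p = laplace f p + laplace g p := by
  rw [laplace, laplace, laplace, ← integral_add (hf.integrableOn ha hp) (hg.integrableOn ha hp)]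
  refine integral_congr_ae (Eventually.of_forall fun t => ?_)
  simp only; push_cast; ring

theorem norm_laplace_le {f : ℝ → ℝ} {s K : ℝ} (hs : 0 < s)
    (h : ∀ t > 0, |f t| ≤ K * t ^ (s - 1)) {p : ℂ} (hp : 0 < p.re) :
    ‖laplace f p‖ ≤ K * ((1 / p.re) ^ s * Real.Gamma s) := by
  rw [← Real.integral_rpow_mul_exp_neg_mul_Ioi hs hp, ← integral_const_mul]
  have hi : IntegrableOn (fun t : ℝ => t ^ (s - 1) * Real.exp (-(p.re * t))) (Ioi 0) := by
    simpa using integrableOn_rpow_mul_exp_neg_mul_rpow (s := s - 1) (by linarith) one_pos hp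
  refine norm_integral_le_of_norm_le (hi.const_mul K)
    ((ae_restrict_iff' measurableSet_Ioi).mpr (Eventually.of_forall fun t ht => ?_))
  rw [norm_exp_neg_mul_mul]
  calc _ ≤ Real.exp (-(p.re * t)) * (K * t ^ (s - 1)) := by gcongr; exact h t ht
    _ = _ := by ring

end LaplaceTransform

/-! ### Amplitude and phase of the Bessel function from the singularity of its Laplace transform -/

section BesselConstant
open Set Topology

theorem powerBounded_besselW {α : ℝ} (hα : -1 < α) :
    PowerBounded (2 * α + 1) fun t => t ^ (2 * α + 1) * besselW α t := by
  obtain ⟨K, hK, h⟩ := exists_linear_bound_besselW hα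
  refine ⟨(continuousOn_id.rpow_const fun t ht => Or.inl (ne_of_gt ht)).mul
    (continuous_besselW hα).continuousOn, 2 * α + 1 + 1, by linarith, 1 + K, by positivity,
    fun t ht => ?_⟩
  have h1 : 0 < t ^ (2 * α + 1) := Real.rpow_pos_of_pos ht _
  have h2 : |besselW α t| ≤ 1 + K * t := by
    have h3 := (h t ht).1
    have h4 := abs_add_le (besselW α t - 1) 1
    rw [sub_add_cancel, abs_one] at h4
    linarith
  rw [abs_mul, abs_of_pos h1, Real.rpow_add_one ht.ne' (2 * α + 1)]
  calc t ^ (2 * α + 1) * |besselW α t| ≤ t ^ (2 * α + 1) * (1 + K * t) := by gcongr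
    _ ≤ t ^ (2 * α + 1) * (1 + K * t + (K + t)) :=
        mul_le_mul_of_nonneg_left (by linarith) h1.le
    _ = _ := by ring

theorem powerBounded_besselW' {α : ℝ} (hα : -1 < α) :
    PowerBounded (2 * α + 2) fun t => t ^ (2 * α + 1) * besselW' α t := by
  obtain ⟨K, hK, h⟩ := exists_linear_bound_besselW hα
  refine ⟨(continuousOn_id.rpow_const fun t ht => Or.inl (ne_of_gt ht)).mul
    (continuous_besselW' hα).continuousOn, 2 * α + 2, le_rfl, K, hK, fun t ht => ?_⟩
  have h1 : 0 < t ^ (2 * α + 1) := Real.rpow_pos_of_pos ht _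
  have h2 : t ^ (2 * α + 2) = t ^ (2 * α + 1) * t := by
    rw [← Real.rpow_add_one ht.ne']; ring_nf
  rw [abs_mul, abs_of_pos h1, h2]
  calc t ^ (2 * α + 1) * |besselW' α t| ≤ t ^ (2 * α + 1) * (K * t) := by
        gcongr; exact (h t ht).2
    _ ≤ t ^ (2 * α + 1) * (K * t + K * t) := by gcongr; nlinarith
    _ = _ := by ring

/-- The Laplace transform of `t^(2α+1) w'` solves a first-order equation. -/
theorem laplace_besselW'_eq {α : ℝ} (hα : -1 < α) {p : ℂ} (hp : 0 < p.re) :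
    p * laplace (fun t => t ^ (2 * α + 1) * besselW' α t) p
      = -laplace (fun t => t ^ (2 * α + 1) * besselW α t) p ∧
    (1 + p ^ 2) * laplace (fun t => t * (t ^ (2 * α + 1) * besselW' α t)) p
      = (2 * α + 3) * p * laplace (fun t => t ^ (2 * α + 1) * besselW' α t) p := by
  have hb0 := powerBounded_besselW hα
  have hb1 := powerBounded_besselW' hα
  set f0 : ℝ → ℝ := fun t => t ^ (2 * α + 1) * besselW α t with hf0
  set f1 : ℝ → ℝ := fun t => t ^ (2 * α + 1) * besselW' α t with hf1
  have hr : ∀ t : ℝ, t > 0 → HasDerivAt (fun t : ℝ => t ^ (2 * α + 1))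
      ((2 * α + 1) / t * t ^ (2 * α + 1)) t := fun t ht => by
    refine (Real.hasDerivAt_rpow_const (p := 2 * α + 1) (Or.inl ht.ne')).congr_deriv ?_
    rw [Real.rpow_sub_one ht.ne']; ring
  have hd0 : ∀ t > 0, HasDerivAt f0 ((2 * α + 1) / t * f0 t + f1 t) t := fun t ht => by
    refine ((hr t ht).fun_mul (hasDerivAt_besselW hα t)).congr_deriv ?_
    simp only [hf0, hf1]; ring
  -- Bessel's equation in self-adjoint form: (t^(2α+1) w')' = −t^(2α+1) w.
  have hd1 : ∀ t > 0, HasDerivAt f1 (-1 * f0 t) t := fun t ht => by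
    refine ((hr t ht).fun_mul (hasDerivAt_besselW' hα ht)).congr_deriv ?_
    simp only [hf0]; ring
  have hb0' : PowerBounded (2 * α + 2) fun t => t * f0 t := by
    have := hb0.id_mul; convert this using 1; ring
  have hb1' : PowerBounded (2 * α + 3) fun t => t * f1 t := by
    have := hb1.id_mul; convert this using 1; ring
  have h1 := hb1.mul_laplace (f' := fun t => -1 * f0 t) (by linarith)
    ((hb0.const_mul (-1)).mono (by linarith)) hd1 hp
  have h2 := hb0'.mul_laplace (f' := fun t => (2 * α + 2) * f0 t + t * f1 t) (by linarith)
    (((hb0.const_mul _).mono (by linarith)).add (hb1'.mono (by linarith)))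
    (fun t ht => by
      refine ((hasDerivAt_id t).fun_mul (hd0 t ht)).congr_deriv ?_
      simp only [id]; field_simp; ring) hp
  have h3 := hb1'.mul_laplace (f' := fun t => f1 t + -1 * (t * f0 t)) (by linarith)
    ((hb1.mono (by linarith)).add ((hb0'.const_mul (-1)).mono (by linarith)))
    (fun t ht => by
      refine ((hasDerivAt_id t).fun_mul (hd1 t ht)).congr_deriv ?_
      simp only [id]; ring) hp
  rw [laplace_const_mul] at h1
  rw [laplace_add (a := 2 * α + 1) (by linarith) (hb0.const_mul _) (hb1'.mono (by linarith)) hp,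
    laplace_const_mul] at h2
  rw [laplace_add (a := 2 * α + 2) (by linarith) hb1 (hb0'.const_mul (-1)) hp,
    laplace_const_mul] at h3
  push_cast at h1 h2 h3
  refine ⟨by linear_combination h1, ?_⟩
  -- The transforms of t^(2α+1) w and of its product with t are eliminated from the three relations.
  linear_combination p * h3 - h2 - (2 * α + 2) * h1

theorem one_add_sq_mem_slitPlane {p : ℂ} (hp : 0 < p.re) : 1 + p ^ 2 ∈ Complex.slitPlane := by
  rw [Complex.mem_slitPlane_iff]
  by_cases h : p.im = 0
  · left
    simp [pow_two, Complex.mul_re, h]; positivity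
  · right
    simp only [pow_two, Complex.add_im, Complex.one_im, Complex.mul_im, zero_add]
    intro h'
    exact mul_ne_zero hp.ne' h (by linarith)

/-- The first-order equation makes V(p)(1+p²)^(α+3/2) constant, and −pV is the transform sought. The
constant is found by letting p → +∞ along the reals, where the transform is governed by t near 0:
there w = 1 + O(t), so it behaves like Γ(2α+2) p^(−2α−2). -/
theorem laplace_besselW {α : ℝ} (hα : -1 < α) {p : ℂ} (hp : 0 < p.re) :
    laplace (fun t => t ^ (2 * α + 1) * besselW α t) p * (1 + p ^ 2) ^ ((α + 3 / 2 : ℝ) : ℂ)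
      = Real.Gamma (2 * α + 2) * p := by
  set V := laplace (fun t => t ^ (2 * α + 1) * besselW' α t) with hV
  set S := laplace (fun t => t ^ (2 * α + 1) * besselW α t) with hS
  set σ : ℝ := α + 3 / 2 with hσ
  set Γ₀ := Real.Gamma (2 * α + 2) with hΓ
  have hconst : ∀ q : ℂ, 0 < q.re →
      V p * (1 + p ^ 2) ^ (σ : ℂ) = V q * (1 + q ^ 2) ^ (σ : ℂ) := fun q hq => by
    refine mul_cpow_eq_of_hasDerivAt (g := fun p => 1 + p ^ 2) (g' := fun p => 2 * p)
      (fun p hp => (powerBounded_besselW' hα).hasDerivAt_laplace (by linarith) hp)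
      (fun p hp => ⟨?_, one_add_sq_mem_slitPlane hp⟩) (fun p hp => ?_) hp hq
    · exact ((hasDerivAt_pow 2 p).const_add 1).congr_deriv (by simp)
    · have := (laplace_besselW'_eq hα hp).2
      rw [hσ]
      push_cast
      linear_combination -this
  set c := V p * (1 + p ^ 2) ^ (σ : ℂ) with hc
  obtain ⟨K, hK, hKw⟩ := exists_linear_bound_besselW hα
  have hreal : ∀ x : ℝ, 0 < x →
      ‖-c * ((x ^ 2 / (1 + x ^ 2)) ^ σ : ℝ) - Γ₀‖ ≤ K * Real.Gamma (2 * α + 3) * x⁻¹ := by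
    intro x hx
    have hxr : 0 < ((x : ℝ) : ℂ).re := by simpa using hx
    have hb := (powerBounded_rpow (2 * α + 1)).const_mul (-1)
    have h1 := norm_laplace_le (s := 2 * α + 3) (K := K) (by linarith)
      (f := fun t => t ^ (2 * α + 1) * besselW α t + -1 * t ^ (2 * α + 1)) (fun t ht => by
        have e1 : t ^ (2 * α + 1) * besselW α t + -1 * t ^ (2 * α + 1)
          = t ^ (2 * α + 1) * (besselW α t - 1) := by ring
        have h2 : t ^ (2 * α + 3 - 1) = t ^ (2 * α + 1) * t := by
          rw [← Real.rpow_add_one ht.ne']; ring_nf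
        have h3 : 0 < t ^ (2 * α + 1) := Real.rpow_pos_of_pos ht _
        rw [e1, h2, abs_mul, abs_of_pos h3]
        calc _ ≤ t ^ (2 * α + 1) * (K * t) := by gcongr; exact (hKw t ht).1
          _ = _ := by ring) hxr
    rw [laplace_add (a := 2 * α + 1) (by linarith) (powerBounded_besselW hα) hb hxr,
      laplace_const_mul] at h1
    have h4 := laplace_rpow (σ := 2 * α + 2) (by linarith) hxr
    rw [show 2 * α + 2 - 1 = 2 * α + 1 by ring, ← Complex.ofReal_cpow hx.le] at h4
    have h5 := (laplace_besselW'_eq hα hxr).1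
    have h6 := hconst x hxr
    have e7 : (1 + (x : ℂ) ^ 2) ^ (σ : ℂ) = (((1 + x ^ 2) ^ σ : ℝ) : ℂ) := by
      rw [Complex.ofReal_cpow (by positivity)]; push_cast; rfl
    rw [e7] at h6
    have hp1 : 0 < x ^ (2 * α + 2) := Real.rpow_pos_of_pos hx _
    have e8 : -c * ((x ^ 2 / (1 + x ^ 2)) ^ σ : ℝ) = S x * ((x ^ (2 * α + 2) : ℝ) : ℂ) := by
      have e9 : (x ^ 2 / (1 + x ^ 2)) ^ σ * (1 + x ^ 2) ^ σ = x * x ^ (2 * α + 2) := by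
        rw [← Real.mul_rpow (by positivity) (by positivity), div_mul_cancel₀ _ (by positivity),
          ← Real.rpow_natCast, ← Real.rpow_mul hx.le, mul_comm x, ← Real.rpow_add_one hx.ne']
        congr 1; rw [hσ]; push_cast; ring
      rw [h6]
      have e10 : ((((x ^ 2 / (1 + x ^ 2)) ^ σ : ℝ) : ℂ)) * (((1 + x ^ 2) ^ σ : ℝ) : ℂ)
          = x * ((x ^ (2 * α + 2) : ℝ) : ℂ) := by rw [← Complex.ofReal_mul, e9]; push_cast; ring
      linear_combination -V x * e10 - ((x ^ (2 * α + 2) : ℝ) : ℂ) * h5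
    have e11 : S x * ((x ^ (2 * α + 2) : ℝ) : ℂ) - Γ₀
        = (S x + ((-1 : ℝ) : ℂ) * laplace (fun t => t ^ (2 * α + 1)) x) * ((x ^ (2 * α + 2) : ℝ) : ℂ) := by
      push_cast at h4 ⊢
      linear_combination h4
    rw [e8, e11, norm_mul, Complex.norm_real, Real.norm_eq_abs, abs_of_pos hp1]
    rw [Complex.ofReal_re] at h1
    have e12 : (1 / x) ^ (2 * α + 3) * x ^ (2 * α + 2) = x⁻¹ := by
      rw [one_div, Real.inv_rpow hx.le, ← Real.rpow_neg hx.le, ← Real.rpow_add hx,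
        show -(2 * α + 3) + (2 * α + 2) = -1 by ring, Real.rpow_neg_one]
    calc _ ≤ K * ((1 / x) ^ (2 * α + 3) * Real.Gamma (2 * α + 3)) * x ^ (2 * α + 2) := by gcongr
      _ = K * Real.Gamma (2 * α + 3) * ((1 / x) ^ (2 * α + 3) * x ^ (2 * α + 2)) := by ring
      _ = _ := by rw [e12]
  have hlim : Tendsto (fun x : ℝ => (x ^ 2 / (1 + x ^ 2)) ^ σ) atTop (𝓝 1) := by
    have h1 : Tendsto (fun x : ℝ => x ^ 2 / (1 + x ^ 2)) atTop (𝓝 1) := by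
      have h2 : Tendsto (fun x : ℝ => 1 - (1 + x ^ 2)⁻¹) atTop (𝓝 (1 - 0)) :=
        tendsto_const_nhds.sub (tendsto_inv_atTop_zero.comp
          (tendsto_atTop_add_const_left _ _ (tendsto_pow_atTop two_ne_zero)))
      rw [sub_zero] at h2
      refine h2.congr fun x => ?_
      have : 1 + x ^ 2 ≠ 0 := by positivity
      field_simp; ring
    simpa using h1.rpow_const (p := σ) (Or.inl one_ne_zero)
  have hcΓ : -c = Γ₀ := by
    have h1 : Tendsto (fun x : ℝ => -c * (((x ^ 2 / (1 + x ^ 2)) ^ σ : ℝ) : ℂ) - Γ₀) atTop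
        (𝓝 (-c * ((1 : ℝ) : ℂ) - Γ₀)) :=
      (((Complex.continuous_ofReal.tendsto 1).comp hlim).const_mul (-c)).sub_const _
    have h2 : Tendsto (fun x : ℝ => -c * (((x ^ 2 / (1 + x ^ 2)) ^ σ : ℝ) : ℂ) - Γ₀) atTop (𝓝 0) := by
      refine squeeze_zero_norm' ((eventually_gt_atTop 0).mono fun x hx => hreal x hx) ?_
      simpa using tendsto_inv_atTop_zero.const_mul (K * Real.Gamma (2 * α + 3))
    have h3 := tendsto_nhds_unique h1 h2
    simpa [sub_eq_zero] using h3
  have h := (laplace_besselW'_eq hα hp).1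
  rw [← hcΓ, hc]
  linear_combination (1 + p ^ 2) ^ (σ : ℂ) * h

/-- For t ≥ 1 the error is t^(α+1/2)·O(1/t), and for t ≤ 1 every term is separately O(t^α). The
exponent α is half a power below that of the main term and still above −1, so the transform of the
error is less singular than that of the oscillating part. -/
theorem exists_besselB_sub_cos_sin_bound {α : ℝ} (hα : -1 < α) {ar ai D : ℝ}
    (h : ∀ t ≥ (1 : ℝ), |Real.cos t * besselB α t - Real.sin t * besselB' α t - ar| ≤ D / t ∧
      |Real.sin t * besselB α t + Real.cos t * besselB' α t - ai| ≤ D / t) :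
    ∃ K, ∀ t > 0, |t ^ (2 * α + 1) * besselW α t +
      -1 * (ar * (t ^ (α + 1 / 2) * Real.cos t) + ai * (t ^ (α + 1 / 2) * Real.sin t))|
        ≤ K * t ^ α := by
  obtain ⟨K, hK, hw⟩ := exists_linear_bound_besselW hα
  have hD : 0 ≤ D := by simpa using (abs_nonneg _).trans (h 1 le_rfl).1
  refine ⟨2 * D + (1 + K + |ar| + |ai|), fun t ht => ?_⟩
  have hp : 0 < t ^ α := Real.rpow_pos_of_pos ht _
  have hp2 : 0 < t ^ (α + 1 / 2) := Real.rpow_pos_of_pos ht _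
  have e2 : t ^ (2 * α + 1) = t ^ (α + 1 / 2) * t ^ (α + 1 / 2) := by
    rw [← Real.rpow_add ht]; ring_nf
  rcases le_total 1 t with h1 | h1
  · have e1 : t ^ (2 * α + 1) * besselW α t +
        -1 * (ar * (t ^ (α + 1 / 2) * Real.cos t) + ai * (t ^ (α + 1 / 2) * Real.sin t))
        = t ^ (α + 1 / 2) *
          (Real.cos t * (Real.cos t * besselB α t - Real.sin t * besselB' α t - ar)
            + Real.sin t * (Real.sin t * besselB α t + Real.cos t * besselB' α t - ai)) := by
      have h3 := Real.sin_sq_add_cos_sq t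
      rw [e2, besselB]
      linear_combination -(t ^ (α + 1 / 2) * t ^ (α + 1 / 2) * besselW α t) * h3
    rw [e1, abs_mul, abs_of_pos hp2]
    have h4 : |Real.cos t * (Real.cos t * besselB α t - Real.sin t * besselB' α t - ar)
            + Real.sin t * (Real.sin t * besselB α t + Real.cos t * besselB' α t - ai)|
          ≤ 1 * (D / t) + 1 * (D / t) := by
      refine (abs_add_le _ _).trans (add_le_add ?_ ?_)
      · rw [abs_mul]
        exact mul_le_mul (Real.abs_cos_le_one t) (h t h1).1 (abs_nonneg _) zero_le_one
      · rw [abs_mul]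
        exact mul_le_mul (Real.abs_sin_le_one t) (h t h1).2 (abs_nonneg _) zero_le_one
    have h5 : t ^ (α + 1 / 2) / t ≤ t ^ α := by
      rw [← Real.rpow_sub_one ht.ne']
      exact Real.rpow_le_rpow_of_exponent_le h1 (by linarith)
    calc _ ≤ t ^ (α + 1 / 2) * (1 * (D / t) + 1 * (D / t)) :=
          mul_le_mul_of_nonneg_left h4 hp2.le
      _ = 2 * D * (t ^ (α + 1 / 2) / t) := by ring
      _ ≤ 2 * D * t ^ α := mul_le_mul_of_nonneg_left h5 (by positivity)
      _ ≤ _ := mul_le_mul_of_nonneg_right (by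
          have := abs_nonneg ar
          have := abs_nonneg ai
          linarith) hp.le
  · have h3 : t ^ (2 * α + 1) ≤ t ^ α :=
      Real.rpow_le_rpow_of_exponent_ge ht h1 (by linarith)
    have h4 : t ^ (α + 1 / 2) ≤ t ^ α :=
      Real.rpow_le_rpow_of_exponent_ge ht h1 (by linarith)
    have h2 : |besselW α t| ≤ 1 + K := by
      have h3 := (hw t ht).1
      have h4 := abs_add_le (besselW α t - 1) 1
      rw [sub_add_cancel, abs_one] at h4
      have : K * t ≤ K := mul_le_of_le_one_right hK h1
      linarith
    have h5 : |ar * (t ^ (α + 1 / 2) * Real.cos t)| ≤ |ar| * t ^ α := by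
      rw [abs_mul, abs_mul, abs_of_pos hp2]
      exact mul_le_mul_of_nonneg_left ((mul_le_of_le_one_right hp2.le
        (Real.abs_cos_le_one t)).trans h4) (abs_nonneg _)
    have h6 : |ai * (t ^ (α + 1 / 2) * Real.sin t)| ≤ |ai| * t ^ α := by
      rw [abs_mul, abs_mul, abs_of_pos hp2]
      exact mul_le_mul_of_nonneg_left ((mul_le_of_le_one_right hp2.le
        (Real.abs_sin_le_one t)).trans h4) (abs_nonneg _)
    have h7 : |t ^ (2 * α + 1) * besselW α t| ≤ t ^ α * (1 + K) := by
      rw [abs_mul, abs_of_pos (Real.rpow_pos_of_pos ht _)]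
      exact mul_le_mul h3 h2 (abs_nonneg _) hp.le
    refine (abs_add_le _ _).trans ?_
    rw [neg_one_mul, abs_neg]
    have h8 := abs_add_le (ar * (t ^ (α + 1 / 2) * Real.cos t)) (ai * (t ^ (α + 1 / 2) * Real.sin t))
    have h9 : 0 ≤ D * t ^ α := by positivity
    nlinarith

theorem laplace_mul_cos_sin {σ : ℝ} (hσ : 0 < σ) {p : ℂ} (hp : 0 < p.re) :
    PowerBounded (σ - 1) (fun t => t ^ (σ - 1) * Real.cos t) ∧
    PowerBounded (σ - 1) (fun t => t ^ (σ - 1) * Real.sin t) ∧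
    2 * laplace (fun t => t ^ (σ - 1) * Real.cos t) p
      = laplace (fun t => t ^ (σ - 1)) (p - Complex.I)
        + laplace (fun t => t ^ (σ - 1)) (p + Complex.I) ∧
    2 * Complex.I * laplace (fun t => t ^ (σ - 1) * Real.sin t) p
      = laplace (fun t => t ^ (σ - 1)) (p - Complex.I)
        - laplace (fun t => t ^ (σ - 1)) (p + Complex.I) := by
  have hb := powerBounded_rpow (σ - 1)
  have hpb : ∀ g : ℝ → ℝ, Continuous g → (∀ t, |g t| ≤ 1) →
      PowerBounded (σ - 1) fun t => t ^ (σ - 1) * g t := by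
    intro g hg hg1
    obtain ⟨hc, b, hb, C, hC, hf⟩ := hb
    refine ⟨hc.mul hg.continuousOn, b, hb, C, hC, fun t ht => ?_⟩
    rw [abs_mul]
    exact (mul_le_of_le_one_right (abs_nonneg _) (hg1 t)).trans (hf t ht)
  have hi1 := hb.integrableOn (a := σ - 1) (by linarith) (p := p - Complex.I) (by simpa using hp)
  have hi2 := hb.integrableOn (a := σ - 1) (by linarith) (p := p + Complex.I) (by simpa using hp)
  refine ⟨hpb _ Real.continuous_cos Real.abs_cos_le_one,
    hpb _ Real.continuous_sin Real.abs_sin_le_one, ?_, ?_⟩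
  · rw [laplace, laplace, laplace, ← integral_add hi1 hi2, ← integral_const_mul]
    refine integral_congr_ae (Eventually.of_forall fun t => ?_)
    simp only
    push_cast
    rw [Complex.cos, show -((p - Complex.I) * (t : ℂ)) = -(p * t) + t * Complex.I by ring,
      show -((p + Complex.I) * (t : ℂ)) = -(p * t) + -t * Complex.I by ring, Complex.exp_add,
      Complex.exp_add]
    ring
  · rw [laplace, laplace, laplace, ← integral_sub hi1 hi2, ← integral_const_mul]
    refine integral_congr_ae (Eventually.of_forall fun t => ?_)
    simp only
    push_cast
    rw [Complex.sin, show -((p - Complex.I) * (t : ℂ)) = -(p * t) + t * Complex.I by ring,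
      show -((p + Complex.I) * (t : ℂ)) = -(p * t) + -t * Complex.I by ring, Complex.exp_add,
      Complex.exp_add]
    linear_combination (Complex.exp (-(p * t)) * (t ^ (σ - 1) : ℝ) * (Complex.exp (-t * Complex.I)
      - Complex.exp (t * Complex.I))) * Complex.I_sq

/-- Let p = ε − i with ε → 0⁺ and multiply the explicit transform by (1+p²)^σ, σ = α+3/2. The
resonant exponential has a singularity ε^(−σ) with coefficient ar + i ai and survives. The conjugate
term tends to 0 like ε^σ, and the error term like ε^(σ−α−1) = ε^(1/2). -/
theorem bessel_amplitude_mul_Gamma {α : ℝ} (hα : -1 < α) {ar ai D : ℝ}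
    (h : ∀ t ≥ (1 : ℝ), |Real.cos t * besselB α t - Real.sin t * besselB' α t - ar| ≤ D / t ∧
      |Real.sin t * besselB α t + Real.cos t * besselB' α t - ai| ≤ D / t) :
    (ar + ai * Complex.I) * Real.Gamma (α + 3 / 2) * (-2 * Complex.I) ^ ((α + 3 / 2 : ℝ) : ℂ)
      = 2 * Real.Gamma (2 * α + 2) * -Complex.I := by
  obtain ⟨K, hK⟩ := exists_besselB_sub_cos_sin_bound hα h
  have hσ0 : 0 < α + 3 / 2 := by linarith
  set σ : ℝ := α + 3 / 2 with hσ
  have hs : α + 1 / 2 = σ - 1 := by rw [hσ]; ring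
  rw [hs] at hK
  set G := laplace (fun t => t ^ (σ - 1)) with hG
  set R := laplace (fun t => t ^ (2 * α + 1) * besselW α t +
      -1 * (ar * (t ^ (σ - 1) * Real.cos t) + ai * (t ^ (σ - 1) * Real.sin t))) with hR
  -- At p = ε − i one has 1 + p² = ε(ε − 2i), and the shifts p ± i are ε and ε − 2i.
  have hε : ∀ ε : ℝ, 0 < ε →
      (ar + ai * Complex.I) * Real.Gamma σ * ((ε : ℂ) - 2 * Complex.I) ^ (σ : ℂ)
        + (ar - ai * Complex.I) * Real.Gamma σ * ((ε ^ σ : ℝ) : ℂ)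
        + 2 * ((ε ^ σ : ℝ) : ℂ) * R (ε - Complex.I) * ((ε : ℂ) - 2 * Complex.I) ^ (σ : ℂ)
        = 2 * Real.Gamma (2 * α + 2) * (ε - Complex.I) := by
    intro ε hε
    have hp : 0 < ((ε : ℂ) - Complex.I).re := by simpa using hε
    obtain ⟨hbc, hbs, hc, hs'⟩ := laplace_mul_cos_sin hσ0 hp
    have h1 := laplace_besselW hα hp
    have h2 := laplace_rpow hσ0 (p := (ε : ℂ)) (by simpa using hε)
    have h3 := laplace_rpow hσ0 (p := (ε : ℂ) - 2 * Complex.I) (by simpa using hε)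
    have h4 : R (ε - Complex.I) = laplace (fun t => t ^ (2 * α + 1) * besselW α t) (ε - Complex.I)
        - (ar * laplace (fun t => t ^ (σ - 1) * Real.cos t) (ε - Complex.I)
          + ai * laplace (fun t => t ^ (σ - 1) * Real.sin t) (ε - Complex.I)) := by
      have hm : -1 < min (2 * α + 1) (σ - 1) := lt_min (by linarith) (by linarith)
      have hbc' := (hbc.const_mul ar).mono (min_le_right (2 * α + 1) (σ - 1))
      have hbs' := (hbs.const_mul ai).mono (min_le_right (2 * α + 1) (σ - 1))
      rw [hR, laplace_add hm ((powerBounded_besselW hα).mono (min_le_left _ _))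
        ((hbc'.add hbs').const_mul (-1)) hp, laplace_const_mul, laplace_add hm hbc' hbs' hp,
        laplace_const_mul, laplace_const_mul]
      push_cast; ring
    have e1 : (1 + ((ε : ℂ) - Complex.I) ^ 2) ^ (σ : ℂ)
        = ((ε ^ σ : ℝ) : ℂ) * ((ε : ℂ) - 2 * Complex.I) ^ (σ : ℂ) := by
      have hz : (ε : ℂ) - 2 * Complex.I ≠ 0 := fun h0 => by
        have := congrArg Complex.re h0
        simp at this
        exact hε.ne' this
      have hε' : (ε : ℂ) ≠ 0 := by exact_mod_cast hε.ne'
      rw [show 1 + ((ε : ℂ) - Complex.I) ^ 2 = ε * (ε - 2 * Complex.I) by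
          linear_combination Complex.I_sq,
        Complex.ofReal_cpow hε.le, Complex.cpow_def_of_ne_zero (mul_ne_zero hε' hz),
        Complex.cpow_def_of_ne_zero hz, Complex.cpow_def_of_ne_zero hε',
        Complex.log_ofReal_mul hε hz, Complex.ofReal_log hε.le, ← Complex.exp_add, add_mul]
    rw [show (ε : ℂ) - Complex.I - Complex.I = ε - 2 * Complex.I by ring,
      sub_add_cancel] at hc hs'
    rw [e1] at h1
    rw [← Complex.ofReal_cpow hε.le] at h2
    set Z := ((ε : ℂ) - 2 * Complex.I) ^ (σ : ℂ)
    have hI := Complex.I_sq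
    have hs2 : 2 * laplace (fun t => t ^ (σ - 1) * Real.sin t) (ε - Complex.I)
        = -Complex.I * (G (ε - 2 * Complex.I) - G ε) := by
      linear_combination (-Complex.I) * hs' + 2 * laplace (fun t => t ^ (σ - 1) * Real.sin t) (ε - Complex.I) * hI
    rw [h4]
    linear_combination 2 * h1 - ((ε ^ σ : ℝ) : ℂ) * Z * ar * hc - ((ε ^ σ : ℝ) : ℂ) * Z * ai * hs2
      - ((ε ^ σ : ℝ) : ℂ) * (ar - ai * Complex.I) * h3 - Z * (ar + ai * Complex.I) * h2
  have hcast : Tendsto (fun ε : ℝ => (ε : ℂ)) (𝓝[>] 0) (𝓝 0) :=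
    (Complex.continuous_ofReal.tendsto 0).mono_left nhdsWithin_le_nhds
  have hZ : Tendsto (fun ε : ℝ => ((ε : ℂ) - 2 * Complex.I) ^ (σ : ℂ)) (𝓝[>] 0)
      (𝓝 ((-2 * Complex.I) ^ (σ : ℂ))) := by
    have h1 : Tendsto (fun ε : ℝ => (ε : ℂ) - 2 * Complex.I) (𝓝[>] 0) (𝓝 (-2 * Complex.I)) := by
      have := hcast.sub_const (2 * Complex.I)
      rwa [show (0 : ℂ) - 2 * Complex.I = -2 * Complex.I by ring] at this
    have h2 : -2 * Complex.I ∈ Complex.slitPlane := Or.inr (by simp)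
    exact (continuousAt_cpow_const h2).tendsto.comp h1
  have hE0 : ∀ s : ℝ, 0 < s → Tendsto (fun ε : ℝ => ε ^ s) (𝓝[>] 0) (𝓝 0) := fun s hs => by
    have := ((Real.continuous_rpow_const hs.le).tendsto 0).mono_left
      (nhdsWithin_le_nhds (s := Ioi (0 : ℝ)))
    rwa [Real.zero_rpow hs.ne'] at this
  have hE : Tendsto (fun ε : ℝ => ((ε ^ σ : ℝ) : ℂ)) (𝓝[>] 0) (𝓝 0) :=
    (Complex.continuous_ofReal.tendsto 0).comp (hE0 σ hσ0)
  have hER : Tendsto (fun ε : ℝ => ((ε ^ σ : ℝ) : ℂ) * R (ε - Complex.I)) (𝓝[>] 0) (𝓝 0) := by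
    have h1 := (hE0 (1 / 2) (by norm_num)).const_mul (K * Real.Gamma (α + 1))
    rw [mul_zero] at h1
    refine squeeze_zero_norm' ?_ h1
    filter_upwards [self_mem_nhdsWithin] with ε (hε : 0 < ε)
    have h2 := norm_laplace_le (s := α + 1) (p := (ε : ℂ) - Complex.I) (by linarith)
      (fun t ht => by rw [add_sub_cancel_right]; exact hK t ht) (by simpa using hε)
    rw [show ((ε : ℂ) - Complex.I).re = ε by simp] at h2
    have hp := Real.rpow_pos_of_pos hε σ
    rw [norm_mul, Complex.norm_real, Real.norm_eq_abs, abs_of_pos hp]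
    have e1 : ε ^ σ * (1 / ε) ^ (α + 1) = ε ^ (1 / 2 : ℝ) := by
      rw [one_div, Real.inv_rpow hε.le, ← Real.rpow_neg hε.le, ← Real.rpow_add hε]
      congr 1; rw [hσ]; ring
    calc _ ≤ ε ^ σ * (K * ((1 / ε) ^ (α + 1) * Real.Gamma (α + 1))) :=
          mul_le_mul_of_nonneg_left h2 hp.le
      _ = K * Real.Gamma (α + 1) * (ε ^ σ * (1 / ε) ^ (α + 1)) := by ring
      _ = _ := by rw [e1]
  have hL := ((hZ.const_mul ((ar + ai * Complex.I) * Real.Gamma σ)).add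
    (hE.const_mul ((ar - ai * Complex.I) * Real.Gamma σ))).add ((hER.mul hZ).const_mul 2)
  have hRt := (hcast.sub_const Complex.I).const_mul (2 * (Real.Gamma (2 * α + 2) : ℂ))
  rw [mul_zero, add_zero, zero_mul, mul_zero, add_zero] at hL
  rw [zero_sub] at hRt
  refine tendsto_nhds_unique (hL.congr' ?_) hRt
  filter_upwards [self_mem_nhdsWithin] with ε (h0 : 0 < ε)
  rw [← hε ε h0]; ring

/-- The amplitude and phase of the Bessel function at infinity. -/
theorem exists_besselB_asymptotics {α : ℝ} (hα : -1 < α) :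
    ∃ D, ∀ t ≥ (1 : ℝ),
      |Real.cos t * besselB α t - Real.sin t * besselB' α t
        - 2 ^ (α + 1 / 2) * Real.Gamma (α + 1) / √Real.pi * Real.cos (α * Real.pi / 2 + Real.pi / 4)|
          ≤ D / t ∧
      |Real.sin t * besselB α t + Real.cos t * besselB' α t
        - 2 ^ (α + 1 / 2) * Real.Gamma (α + 1) / √Real.pi * Real.sin (α * Real.pi / 2 + Real.pi / 4)|
          ≤ D / t := by
  obtain ⟨ar, ai, D, h⟩ := exists_limit_besselB hα
  have h1 := bessel_amplitude_mul_Gamma hα h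
  set κ : ℝ := 2 ^ (α + 1 / 2) * Real.Gamma (α + 1) / √Real.pi with hκ
  set φ : ℝ := α * Real.pi / 2 + Real.pi / 4 with hφ
  have hg1 : 0 < Real.Gamma (α + 1) := Real.Gamma_pos_of_pos (by linarith)
  have hg2 : 0 < Real.Gamma (α + 3 / 2) := Real.Gamma_pos_of_pos (by linarith)
  have hdup := Real.Gamma_mul_Gamma_add_half (α + 1)
  rw [show α + 1 + 1 / 2 = α + 3 / 2 by ring, show 2 * (α + 1) = 2 * α + 2 by ring] at hdup
  have hpi : 0 < √Real.pi := Real.sqrt_pos.mpr Real.pi_pos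
  -- Legendre's duplication formula.
  have hκΓ : κ * Real.Gamma (α + 3 / 2) * 2 ^ (α + 3 / 2) = 2 * Real.Gamma (2 * α + 2) := by
    have e1 : (2 : ℝ) ^ (α + 1 / 2) * 2 ^ (α + 3 / 2) * 2 ^ (1 - (2 * α + 2)) = 2 := by
      rw [← Real.rpow_add two_pos, ← Real.rpow_add two_pos]
      convert Real.rpow_one (2 : ℝ) using 2
      ring
    rw [hκ]
    calc _ = 2 ^ (α + 1 / 2) * 2 ^ (α + 3 / 2) * (Real.Gamma (α + 1) * Real.Gamma (α + 3 / 2))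
          / √Real.pi := by ring
      _ = 2 ^ (α + 1 / 2) * 2 ^ (α + 3 / 2) * 2 ^ (1 - (2 * α + 2)) * Real.Gamma (2 * α + 2) := by
          rw [hdup]; field_simp
      _ = _ := by rw [e1]
  -- With the principal branch −2i has argument −π/2, which is the source of the phase απ/2 + π/4.
  have hI : (-2 * Complex.I) ^ ((α + 3 / 2 : ℝ) : ℂ)
      = ((2 ^ (α + 3 / 2) : ℝ) : ℂ) * Complex.exp (-(φ + Real.pi / 2 : ℝ) * Complex.I) := by
    have hlog : Complex.log (-2 * Complex.I) = Real.log 2 + -(Real.pi / 2) * Complex.I := by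
      rw [show -2 * Complex.I = ((2 : ℝ) : ℂ) * (-Complex.I) by push_cast; ring,
        Complex.log_ofReal_mul two_pos (neg_ne_zero.mpr Complex.I_ne_zero), Complex.log_neg_I]
    rw [Complex.cpow_def_of_ne_zero (by simp), hlog, Real.rpow_def_of_pos two_pos,
      Complex.ofReal_exp, ← Complex.exp_add, hφ]
    congr 1; push_cast; ring
  have hA : (ar : ℂ) + ai * Complex.I = κ * Complex.exp (φ * Complex.I) := by
    have hne : (Real.Gamma (α + 3 / 2) : ℂ) * ((2 ^ (α + 3 / 2) : ℝ) : ℂ) ≠ 0 := by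
      have : 0 < Real.Gamma (α + 3 / 2) * 2 ^ (α + 3 / 2) :=
        mul_pos hg2 (Real.rpow_pos_of_pos two_pos _)
      exact_mod_cast this.ne'
    have hexp : Complex.exp (-(φ + Real.pi / 2 : ℝ) * Complex.I)
        * Complex.exp (φ * Complex.I) = -Complex.I := by
      rw [← Complex.exp_add, show -((φ + Real.pi / 2 : ℝ) : ℂ) * Complex.I + φ * Complex.I
        = -(Real.pi / 2 * Complex.I) by push_cast; ring, Complex.exp_neg,
        Complex.exp_pi_div_two_mul_I, Complex.inv_I]
    rw [hI] at h1
    have hκΓ' : (κ : ℂ) * Real.Gamma (α + 3 / 2) * ((2 ^ (α + 3 / 2) : ℝ) : ℂ)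
        = 2 * Real.Gamma (2 * α + 2) := by exact_mod_cast hκΓ
    refine mul_right_cancel₀ (mul_ne_zero hne
      (Complex.exp_ne_zero (-(φ + Real.pi / 2 : ℝ) * Complex.I))) ?_
    linear_combination h1 - 2 * Real.Gamma (2 * α + 2) * hexp
      - Complex.exp (-(φ + Real.pi / 2 : ℝ) * Complex.I) * Complex.exp (φ * Complex.I) * hκΓ'
  have hre := congrArg Complex.re hA
  have him := congrArg Complex.im hA
  rw [Complex.exp_mul_I, ← Complex.ofReal_cos, ← Complex.ofReal_sin] at hre him
  simp [-Complex.ofReal_cos, -Complex.ofReal_sin] at hre him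
  refine ⟨D, fun t ht => ?_⟩
  rw [← hre, ← him]
  exact h t ht

end BesselConstant

/-! ### Regular solutions near the origin -/

section Layer
open Set Topology

/-- `w` is the solution of `w'' + (2α+1)/s w' + (1 - s²/L²) w = 0` that is regular at `0`, with
`w 0 = 1`, and `w' = s v`. -/
def IsRegularSolution (α L : ℝ) (w v : ℝ → ℝ) : Prop :=
  w 0 = 1 ∧ Continuous v ∧ (∀ s, HasDerivAt w (s * v s) s) ∧
    ∀ s > 0, HasDerivAt (fun s => s * v s)
      (-((2 * α + 1) / s * (s * v s)) - (1 - (s / L) ^ 2) * w s) s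

/-- Derivatives are required only in the interior because t^(2α+2), to which this is applied, need
not be differentiable at 0. -/
theorem abs_sub_le_of_continuousOn {a b : ℝ} (hab : a ≤ b) {f g f' g' : ℝ → ℝ}
    (hfc : ContinuousOn f (Icc a b)) (hgc : ContinuousOn g (Icc a b))
    (hf : ∀ s ∈ Ioo a b, HasDerivAt f (f' s) s) (hg : ∀ s ∈ Ioo a b, HasDerivAt g (g' s) s)
    (h : ∀ s ∈ Ioo a b, |f' s| ≤ g' s) : |f b - f a| ≤ g b - g a := by
  have hl := left_mem_Icc.mpr hab
  have hr := right_mem_Icc.mpr hab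
  rw [abs_le']
  constructor
  · have := (monotoneOn_of_hasDerivWithinAt_nonneg (convex_Icc a b) (f := fun s => g s - f s)
      (f' := fun s => g' s - f' s) (hgc.sub hfc)
      (fun t ht => by
        rw [interior_Icc] at ht ⊢; exact ((hg t ht).sub (hf t ht)).hasDerivWithinAt)
      (fun t ht => by
        rw [interior_Icc] at ht; exact sub_nonneg.mpr (abs_le'.mp (h t ht)).1)) hl hr hab
    simp only at this; linarith
  · have := (monotoneOn_of_hasDerivWithinAt_nonneg (convex_Icc a b) (f := fun s => g s + f s)
      (f' := fun s => g' s + f' s) (hgc.add hfc)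
      (fun t ht => by
        rw [interior_Icc] at ht ⊢; exact ((hg t ht).add (hf t ht)).hasDerivWithinAt)
      (fun t ht => by
        rw [interior_Icc] at ht
        have := (abs_le'.mp (h t ht)).2
        linarith)) hl hr hab
    simp only at this; linarith

/-- Near the origin regular solutions are close to the Bessel solution. -/
theorem exists_bound_regular_sub_besselW {α s₀ : ℝ} (hα : -1 < α) (hs₀ : 0 < s₀) (hs₀1 : s₀ ≤ 1)
    (hs₀α : s₀ ^ 2 ≤ α + 1) :
    ∃ K, 0 ≤ K ∧ ∀ (L : ℝ) (w v : ℝ → ℝ), 1 ≤ L → IsRegularSolution α L w v →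
      |w s₀ - besselW α s₀| ≤ K / L ^ 2 ∧ |s₀ * v s₀ - besselW' α s₀| ≤ K / L ^ 2 := by
  obtain ⟨b, hb⟩ := isCompact_Icc.exists_bound_of_continuousOn (s := Icc (0 : ℝ) 1)
    (continuous_besselW hα).continuousOn
  have hb0 : 0 ≤ b := (norm_nonneg _).trans (hb 0 (by simp))
  have hα1 : 0 < 2 * α + 2 := by linarith
  have hα2 : α + 1 ≠ 0 := by linarith
  refine ⟨b + 2 * b / (2 * α + 2), by positivity, ?_⟩
  rintro L w v hL ⟨hw0, hv, hw, hw1⟩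
  have hL0 : 0 < L := by linarith
  obtain ⟨x, hx, hxmax⟩ := isCompact_Icc.exists_isMaxOn (s := Icc 0 s₀) ⟨0, by simp [hs₀.le]⟩
    (f := fun s => |w s - besselW α s|) (by
      have h1 : Continuous w := continuous_iff_continuousAt.mpr fun s => (hw s).continuousAt
      have h2 := continuous_besselW hα
      fun_prop)
  -- A is the maximum of the difference on [0, s₀]. It is bounded by a quarter of A + b/L², and
  -- thereby absorbed.
  set A := |w x - besselW α x| with hA
  have hA0 : 0 ≤ A := abs_nonneg _
  set E := A + b / L ^ 2 with hE
  have hE0 : 0 ≤ E := by positivity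
  set vd : ℝ → ℝ := fun s => v s - 2 * besselSeriesDeriv α (s ^ 2) with hvd
  have hvdc : Continuous vd := by
    have := continuous_besselSeriesDeriv hα
    fun_prop
  have hD : ∀ s, s * v s - besselW' α s = s * vd s := fun s => by
    simp only [hvd, besselW']; ring
  have hv_bound : ∀ s, 0 < s → s ≤ s₀ → |vd s| ≤ E / (2 * α + 2) := by
    intro s hs hss
    have hpc : Continuous fun t : ℝ => t ^ (2 * α + 2) := Real.continuous_rpow_const hα1.le
    -- The integrating factor t^(2α+1) removes the first-order term, so the derivative involves only
    -- the difference of the solutions and the perturbation (t/L)² times the Bessel solution.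
    have h1 := abs_sub_le_of_continuousOn hs.le (f := fun t => t ^ (2 * α + 2) * vd t)
      (g := fun t => E / (2 * α + 2) * t ^ (2 * α + 2)) (g' := fun t => E * t ^ (2 * α + 1))
      (f' := fun t => -(t ^ (2 * α + 1) *
        ((1 - (t / L) ^ 2) * (w t - besselW α t) - (t / L) ^ 2 * besselW α t)))
      (hpc.mul hvdc).continuousOn (continuous_const.mul hpc).continuousOn
      (fun t ht => by
        have ht0 : 0 < t := ht.1
        have hr : HasDerivAt (fun t : ℝ => t ^ (2 * α + 1)) ((2 * α + 1) / t * t ^ (2 * α + 1)) t := by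
          refine (Real.hasDerivAt_rpow_const (p := 2 * α + 1) (Or.inl ht0.ne')).congr_deriv ?_
          rw [Real.rpow_sub_one ht0.ne']; ring
        have h2 := (hr.fun_mul ((hw1 t ht0).fun_sub (hasDerivAt_besselW' hα ht0))).congr_of_eventuallyEq
          (f₁ := fun t => t ^ (2 * α + 2) * vd t) (by
            filter_upwards [lt_mem_nhds ht0] with u hu
            have : u ^ (2 * α + 2) = u ^ (2 * α + 1) * u := by
              rw [← Real.rpow_add_one hu.ne']; ring_nf
            rw [hD u, this]; ring)
        refine h2.congr_deriv ?_
        generalize t ^ (2 * α + 1) = z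
        ring)
      (fun t ht => by
        have ht0 : 0 < t := ht.1
        refine ((Real.hasDerivAt_rpow_const (p := 2 * α + 2) (Or.inl ht0.ne')).const_mul _).congr_deriv ?_
        rw [show 2 * α + 2 - 1 = 2 * α + 1 by ring]
        field_simp)
      (fun t ht => by
        have ht0 : 0 < t := ht.1
        have hts : t ≤ s₀ := ht.2.le.trans hss
        have hp : 0 < t ^ (2 * α + 1) := Real.rpow_pos_of_pos ht0 _
        have htL : (t / L) ^ 2 ≤ 1 / L ^ 2 := by
          rw [div_pow]; gcongr; exact pow_le_one₀ ht0.le (hts.trans hs₀1)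
        have hL1 : 1 / L ^ 2 ≤ 1 := by rw [div_le_one (by positivity)]; exact one_le_pow₀ hL
        have htL0 : 0 ≤ (t / L) ^ 2 := by positivity
        have e1 : |w t - besselW α t| ≤ A := hxmax ⟨ht0.le, hts⟩
        have e2 : |besselW α t| ≤ b := hb t ⟨ht0.le, hts.trans hs₀1⟩
        have e3 : |(1 - (t / L) ^ 2) * (w t - besselW α t)| ≤ A := by
          rw [abs_mul, abs_of_nonneg (by linarith)]
          exact (mul_le_of_le_one_left (abs_nonneg _) (by linarith)).trans e1
        have e4 : |(t / L) ^ 2 * besselW α t| ≤ b / L ^ 2 := by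
          rw [abs_mul, abs_of_nonneg htL0]
          calc _ ≤ 1 / L ^ 2 * b := mul_le_mul htL e2 (abs_nonneg _) (by positivity)
            _ = _ := by ring
        rw [abs_neg, abs_mul, abs_of_pos hp, mul_comm E]
        exact mul_le_mul_of_nonneg_left ((abs_sub _ _).trans (add_le_add e3 e4)) hp.le)
    have hp : 0 < s ^ (2 * α + 2) := Real.rpow_pos_of_pos hs _
    simp only [Real.zero_rpow hα1.ne', zero_mul, mul_zero, sub_zero] at h1
    rw [abs_mul, abs_of_pos hp, mul_comm] at h1
    exact le_of_mul_le_mul_right h1 hp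
  have hd_bound : A ≤ E / 4 := by
    have hx0 : 0 ≤ x := hx.1
    have h1 := abs_sub_le_of_continuousOn hx0 (f := fun s => w s - besselW α s)
      (g := fun s => E / (2 * α + 2) * (s ^ 2 / 2)) (f' := fun s => s * vd s)
      (g' := fun s => E / (2 * α + 2) * s)
      (fun s _ => ((hw s).sub (hasDerivAt_besselW hα s)).continuousAt.continuousWithinAt)
      (by fun_prop)
      (fun s _ => ((hw s).fun_sub (hasDerivAt_besselW hα s)).congr_deriv (hD s))
      (fun s _ => ((((hasDerivAt_pow 2 s).div_const 2)).const_mul _).congr_deriv (by simp))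
      (fun s hs => by
        rw [abs_mul, abs_of_pos hs.1, mul_comm]
        exact mul_le_mul_of_nonneg_right (hv_bound s hs.1 (hs.2.le.trans hx.2)) hs.1.le)
    have h0 : besselW α 0 = 1 := by simp [besselW, besselSeries_zero]
    simp only [hw0, h0, sub_self, sub_zero] at h1
    -- The restriction on s₀ is chosen so that the integrated bound is exactly E/4.
    have hx2 : x ^ 2 ≤ α + 1 := (pow_le_pow_left₀ hx0 hx.2 2).trans hs₀α
    calc A ≤ E / (2 * α + 2) * (x ^ 2 / 2) := by simpa using h1
      _ ≤ E / (2 * α + 2) * ((α + 1) / 2) := by gcongr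
      _ = _ := by field_simp; norm_num
  have hE2 : E ≤ 2 * b / L ^ 2 := by
    have : 0 ≤ b / L ^ 2 := by positivity
    rw [mul_div_assoc]; linarith
  have hAb : A ≤ b / L ^ 2 := by
    have : 0 ≤ b / L ^ 2 := by positivity
    linarith
  constructor
  · refine (hxmax (right_mem_Icc.mpr hs₀.le)).trans (hAb.trans ?_)
    gcongr
    have : 0 ≤ 2 * b / (2 * α + 2) := by positivity
    linarith
  · rw [hD, abs_mul, abs_of_pos hs₀]
    calc s₀ * |vd s₀| ≤ 1 * (E / (2 * α + 2)) :=
          mul_le_mul hs₀1 (hv_bound s₀ hs₀ le_rfl) (abs_nonneg _) zero_le_one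
      _ ≤ 1 * (2 * b / L ^ 2 / (2 * α + 2)) := by gcongr
      _ = 2 * b / (2 * α + 2) / L ^ 2 := by ring
      _ ≤ _ := by gcongr; linarith

end Layer

/-! ### The Liouville–Green transformation and the Bessel function at infinity -/

section Universal
open Set Topology

/-- The Liouville–Green variables attached to `u'' = -(c² - γ/s²) u`, with `c² = 1 - (s/L)²`. -/
theorem hasDerivAt_liouvilleGreen {γ L s : ℝ} {u u₁ : ℝ → ℝ} (hL : 0 < L) (hs : 0 < s) (hsL : s < L)
    (hu : HasDerivAt u (u₁ s) s)
    (hu₁ : HasDerivAt u₁ (-((1 - (s / L) ^ 2 - γ / s ^ 2) * u s)) s) :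
    HasDerivAt (fun t => √√(1 - (t / L) ^ 2) * u t)
      (√(1 - (s / L) ^ 2) * (u₁ s / √√(1 - (s / L) ^ 2)
        - (s / L) / (2 * L * √√(1 - (s / L) ^ 2) ^ 5) * u s)) s ∧
    HasDerivAt (fun t => u₁ t / √√(1 - (t / L) ^ 2)
        - (t / L) / (2 * L * √√(1 - (t / L) ^ 2) ^ 5) * u t)
      (-(√(1 - (s / L) ^ 2) * liouvillePotential γ L s * (√√(1 - (s / L) ^ 2) * u s))) s := by
  have hy0 : 0 < s / L := div_pos hs hL
  have hy1 : s / L < 1 := (div_lt_one hL).mpr hsL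
  have hc2 : 0 < 1 - (s / L) ^ 2 := by nlinarith
  have hc : 0 < √(1 - (s / L) ^ 2) := Real.sqrt_pos.mpr hc2
  have hr : 0 < √√(1 - (s / L) ^ 2) := Real.sqrt_pos.mpr hc
  have hy : |s / L| < 1 := by rwa [abs_of_pos hy0]
  have hdy : HasDerivAt (fun t : ℝ => t / L) (1 / L) s := (hasDerivAt_id s).div_const L
  have hdc : HasDerivAt (fun t => √(1 - (t / L) ^ 2)) (-(s / L) / √(1 - (s / L) ^ 2) * (1 / L)) s :=
    HasDerivAt.comp (h₂ := fun t : ℝ => √(1 - t ^ 2)) s (hasDerivAt_sqrt_one_sub_sq hy) hdy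
  have hdr := hdc.sqrt hc.ne'
  have hcr : √(1 - (s / L) ^ 2) = √√(1 - (s / L) ^ 2) ^ 2 := (Real.sq_sqrt hc.le).symm
  have hr4 : √√(1 - (s / L) ^ 2) ^ 4 = 1 - (s / L) ^ 2 := by
    rw [show (4 : ℕ) = 2 * 2 by norm_num, pow_mul, Real.sq_sqrt hc.le, Real.sq_sqrt hc2.le]
  have hdr' : HasDerivAt (fun t => √√(1 - (t / L) ^ 2))
      (-(s / L) / (2 * L * √√(1 - (s / L) ^ 2) ^ 3)) s := by
    refine hdr.congr_deriv ?_
    rw [hcr, Real.sqrt_sq hr.le]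
    field_simp
  have hd5 := (hdy.fun_div ((hdr'.fun_pow 5).const_mul (2 * L))
    (mul_ne_zero (by positivity) (pow_ne_zero 5 hr.ne')))
  obtain ⟨y, hyd⟩ : ∃ y, y = s / L := ⟨_, rfl⟩
  have hsy : s = L * y := by rw [hyd]; field_simp
  have hy' : y ^ 2 = 1 - √√(1 - (s / L) ^ 2) ^ 4 := by rw [hr4, hyd]; ring
  have hq : liouvillePotential γ L s
      = 1 - γ / (s ^ 2 * √√(1 - (s / L) ^ 2) ^ 4)
        + (2 + 3 * (s / L) ^ 2) / (4 * L ^ 2 * √√(1 - (s / L) ^ 2) ^ 12) := by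
    rw [liouvillePotential, show √√(1 - (s / L) ^ 2) ^ 12 = (√√(1 - (s / L) ^ 2) ^ 4) ^ 3 by ring, hr4]
  constructor
  · refine (hdr'.fun_mul hu).congr_deriv ?_
    rw [hcr, Real.sqrt_sq hr.le]
    field_simp
    ring
  · refine ((hu₁.fun_div hdr' hr.ne').fun_sub (hd5.fun_mul hu)).congr_deriv ?_
    rw [hq, hcr, Real.sqrt_sq hr.le, ← hyd]
    rw [show √√(1 - y ^ 2) = √√(1 - (s / L) ^ 2) by rw [hyd]]
    generalize √√(1 - (s / L) ^ 2) = r at hr hy' ⊢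
    have hyp : 0 < y := hyd ▸ hy0
    have hs0 := hs.ne'
    generalize u s = us
    generalize u₁ s = u1s
    have e1 : 1 - y ^ 2 = r ^ 4 := by rw [hy']; ring
    rw [e1]
    have hr0 := hr.ne'
    field_simp
    push_cast
    linear_combination 8 * s ^ 2 * us * r ^ 4 * e1

/-- The modulus of the normalised Bessel function at infinity. -/
noncomputable def besselAmplitude (α : ℝ) : ℝ := 2 ^ (α + 1 / 2) * Real.Gamma (α + 1) / √Real.pi

/-- The argument of the normalised Bessel function at infinity. -/
noncomputable def besselArg (α : ℝ) : ℝ := α * Real.pi / 2 + Real.pi / 4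

theorem exists_besselB_sub_cos_bound {α : ℝ} (hα : -1 < α) :
    ∃ D, 0 ≤ D ∧ ∀ t ≥ (1 : ℝ),
      |besselB α t - besselAmplitude α * Real.cos (besselArg α - t)| ≤ D / t ∧
      |besselB' α t - besselAmplitude α * Real.sin (besselArg α - t)| ≤ D / t := by
  obtain ⟨D, h⟩ := exists_besselB_asymptotics hα
  have hD : 0 ≤ D := by simpa using (abs_nonneg _).trans (h 1 le_rfl).1
  refine ⟨2 * D, by positivity, fun t ht => ?_⟩
  obtain ⟨h1, h2⟩ := h t ht
  change |_ - besselAmplitude α * Real.cos (besselArg α)| ≤ _ at h1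
  change |_ - besselAmplitude α * Real.sin (besselArg α)| ≤ _ at h2
  have hcs := Real.sin_sq_add_cos_sq t
  rw [Real.cos_sub, Real.sin_sub]
  set F := Real.cos t * besselB α t - Real.sin t * besselB' α t
    - besselAmplitude α * Real.cos (besselArg α) with hF
  set G := Real.sin t * besselB α t + Real.cos t * besselB' α t
    - besselAmplitude α * Real.sin (besselArg α) with hG
  have key : ∀ a b : ℝ, |a| ≤ 1 → |b| ≤ 1 → |a * F + b * G| ≤ 2 * D / t := fun a b ha hb => by
    refine (abs_add_le _ _).trans ?_
    rw [abs_mul, abs_mul]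
    calc _ ≤ 1 * (D / t) + 1 * (D / t) := add_le_add
          (mul_le_mul ha h1 (abs_nonneg _) zero_le_one) (mul_le_mul hb h2 (abs_nonneg _) zero_le_one)
      _ = _ := by ring
  constructor
  · have e : besselB α t - besselAmplitude α * (Real.cos (besselArg α) * Real.cos t
        + Real.sin (besselArg α) * Real.sin t) = Real.cos t * F + Real.sin t * G := by
      rw [hF, hG]; linear_combination -besselB α t * hcs
    rw [e]
    exact key _ _ (Real.abs_cos_le_one t) (Real.abs_sin_le_one t)
  · have e : besselB' α t - besselAmplitude α * (Real.sin (besselArg α) * Real.cos t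
        - Real.cos (besselArg α) * Real.sin t) = -Real.sin t * F + Real.cos t * G := by
      rw [hF, hG]; linear_combination -besselB' α t * hcs
    rw [e]
    exact key _ _ (by rw [abs_neg]; exact Real.abs_sin_le_one t) (Real.abs_cos_le_one t)

/-- The energy has derivative 2γ t⁻³ B², so it converges at the rate t⁻², one order faster than the
function itself approaches its cosine. The cosine asymptotics serve only to identify the limit. -/
theorem exists_besselB_energy_bound {α : ℝ} (hα : -1 < α) :
    ∃ D, 0 ≤ D ∧ ∀ t ≥ (1 : ℝ), |(besselB' α t ^ 2 + (1 - (α ^ 2 - 1 / 4) / t ^ 2) * besselB α t ^ 2)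
      - besselAmplitude α ^ 2| ≤ D / t ^ 2 := by
  obtain ⟨b, hb, hB⟩ := exists_bound_besselB hα one_pos
  obtain ⟨D, hD, hasym⟩ := exists_besselB_sub_cos_bound hα
  set γ := α ^ 2 - 1 / 4 with hγ
  set e : ℝ → ℝ := fun t => besselB' α t ^ 2 + (1 - γ / t ^ 2) * besselB α t ^ 2 with he
  refine ⟨|γ| * b ^ 2, by positivity, fun t ht => ?_⟩
  have ht0 : 0 < t := by linarith
  have hstep : ∀ T ≥ t, |e T - e t| ≤ |γ| * b ^ 2 / t ^ 2 := by
    intro T hT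
    have h1 := abs_sub_le_of_hasDerivAt_le hT (f := e) (f' := fun s => 2 * γ / s ^ 3 * besselB α s ^ 2)
      (g := fun s => -(|γ| * b ^ 2 * (s ^ 2)⁻¹)) (g' := fun s => 2 * |γ| * b ^ 2 / s ^ 3)
      (fun s hs => by
        have hs0 : 0 < s := ht0.trans_le hs.1
        refine (((hasDerivAt_besselB' hα hs0).fun_pow 2).fun_add
          ((((hasDerivAt_const s γ).fun_div (hasDerivAt_pow 2 s) (by positivity)).const_sub 1).fun_mul
            ((hasDerivAt_besselB hα hs0).fun_pow 2))).congr_deriv ?_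
        generalize besselB α s = x
        generalize besselB' α s = y
        field_simp
        push_cast
        ring)
      (fun s hs => by
        have hs0 : 0 < s := ht0.trans_le hs.1
        refine (((hasDerivAt_pow 2 s).fun_inv (by positivity)).const_mul _).fun_neg.congr_deriv ?_
        field_simp
        push_cast
        ring)
      (fun s hs => by
        have hs0 : 0 < s := ht0.trans_le hs.1
        have hs1 : |besselB α s| ≤ b := (hB s (ht.le.trans hs.1)).1
        rw [abs_mul, abs_div, abs_mul, abs_of_pos (pow_pos hs0 3), abs_two, abs_pow]
        calc _ ≤ 2 * |γ| / s ^ 3 * b ^ 2 := by gcongr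
          _ = _ := by ring)
    have h2 : 0 ≤ |γ| * b ^ 2 * (T ^ 2)⁻¹ := by positivity
    rw [div_eq_mul_inv]
    linarith
  have hlim : Tendsto e atTop (𝓝 (besselAmplitude α ^ 2)) := by
    set κ := besselAmplitude α with hκ
    set φ := besselArg α with hφ
    have h0 : ∀ c : ℝ, Tendsto (fun T : ℝ => c / T) atTop (𝓝 0) := fun c => by
      simpa [div_eq_mul_inv] using tendsto_inv_atTop_zero.const_mul c
    have h02 : Tendsto (fun T : ℝ => (D / T) * (b + |κ|) + (D / T) * (b + |κ|)
        + |γ| * b ^ 2 / T) atTop (𝓝 0) := by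
      simpa using (((h0 D).mul_const (b + |κ|)).add ((h0 D).mul_const (b + |κ|))).add (h0 (|γ| * b ^ 2))
    rw [tendsto_iff_norm_sub_tendsto_zero]
    refine squeeze_zero' (Eventually.of_forall fun _ => norm_nonneg _) ?_ h02
    filter_upwards [eventually_ge_atTop 1] with T hT
    have hT0 : 0 < T := by linarith
    obtain ⟨h1, h2⟩ := hasym T hT
    obtain ⟨h3, h4⟩ := hB T hT
    set x := besselB α T with hx
    set z := besselB' α T with hz
    have hcs := Real.sin_sq_add_cos_sq (φ - T)
    have hc : |κ * Real.cos (φ - T)| ≤ |κ| := by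
      rw [abs_mul]; exact mul_le_of_le_one_right (abs_nonneg _) (Real.abs_cos_le_one _)
    have hs : |κ * Real.sin (φ - T)| ≤ |κ| := by
      rw [abs_mul]; exact mul_le_of_le_one_right (abs_nonneg _) (Real.abs_sin_le_one _)
    have e1 : e T - κ ^ 2 = (x - κ * Real.cos (φ - T)) * (x + κ * Real.cos (φ - T))
        + (z - κ * Real.sin (φ - T)) * (z + κ * Real.sin (φ - T)) - γ / T ^ 2 * x ^ 2 := by
      simp only [he, ← hx, ← hz]; linear_combination κ ^ 2 * hcs
    rw [Real.norm_eq_abs, e1]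
    refine (abs_sub _ _).trans (add_le_add ((abs_add_le _ _).trans (add_le_add ?_ ?_)) ?_)
    · rw [abs_mul]
      exact mul_le_mul h1 ((abs_add_le _ _).trans (add_le_add h3 hc)) (abs_nonneg _) (by positivity)
    · rw [abs_mul]
      exact mul_le_mul h2 ((abs_add_le _ _).trans (add_le_add h4 hs)) (abs_nonneg _) (by positivity)
    · rw [abs_mul, abs_div, abs_of_pos (pow_pos hT0 2), abs_pow]
      calc _ ≤ |γ| / T * b ^ 2 := by
            gcongr
            nlinarith
        _ = _ := by ring
  have h5 : Tendsto (fun T => |e T - e t|) atTop (𝓝 |besselAmplitude α ^ 2 - e t|) :=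
    (hlim.sub_const _).abs
  rw [abs_sub_comm]
  exact le_of_tendsto h5 ((eventually_ge_atTop t).mono fun T hT => hstep T hT)

end Universal

/-! ### Uniform bulk asymptotics of regular solutions -/

section BulkAsymptotics
open Set Topology

/-- The Liouville–Green amplitude variable of a regular solution. -/
noncomputable def bulkP (α L : ℝ) (w : ℝ → ℝ) (s : ℝ) : ℝ :=
  √√(1 - (s / L) ^ 2) * (s ^ (α + 1 / 2) * w s)

/-- The Liouville–Green momentum variable of a regular solution. -/
noncomputable def bulkM (α L : ℝ) (w v : ℝ → ℝ) (s : ℝ) : ℝ :=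
  s ^ (α + 1 / 2) * (s * v s + (α + 1 / 2) / s * w s) / √√(1 - (s / L) ^ 2)
    - (s / L) / (2 * L * √√(1 - (s / L) ^ 2) ^ 5) * (s ^ (α + 1 / 2) * w s)

theorem IsRegularSolution.hasDerivAt_bulk {α L s : ℝ} {w v : ℝ → ℝ} (h : IsRegularSolution α L w v)
    (hL : 0 < L) (hs : 0 < s) (hsL : s < L) :
    HasDerivAt (bulkP α L w) (√(1 - (s / L) ^ 2) * bulkM α L w v s) s ∧
    HasDerivAt (bulkM α L w v)
      (-(√(1 - (s / L) ^ 2) * liouvillePotential (α ^ 2 - 1 / 4) L s * bulkP α L w s)) s := by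
  obtain ⟨h1, h2⟩ := hasDerivAt_rpow_mul hs (h.2.2.1 s) (h.2.2.2 s hs) rfl
  exact hasDerivAt_liouvilleGreen (u := fun t => t ^ (α + 1 / 2) * w t)
    (u₁ := fun t => t ^ (α + 1 / 2) * (t * v t + (α + 1 / 2) / t * w t)) hL hs hsL h1 h2

/-- The comparison data agree up to `O(L⁻²)` at a fixed point. -/
theorem exists_bound_bulk_initial {α s₀ c₁ : ℝ} (hα : -1 < α) (hs₀ : 0 < s₀) (hs₀1 : s₀ ≤ 1)
    (hs₀α : s₀ ^ 2 ≤ α + 1) (hc₁ : 0 < c₁) (hc₁1 : c₁ ≤ 1) :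
    ∃ K, 0 ≤ K ∧ ∀ (L : ℝ) (w v : ℝ → ℝ), 1 ≤ L → s₀ < L → c₁ ≤ √(1 - (s₀ / L) ^ 2) →
      IsRegularSolution α L w v →
      |bulkP α L w s₀ - besselB α (liouvillePhase L s₀)| ≤ K / L ^ 2 ∧
      |bulkM α L w v s₀ - besselB' α (liouvillePhase L s₀)| ≤ K / L ^ 2 := by
  obtain ⟨K, hK, hlayer⟩ := exists_bound_regular_sub_besselW hα hs₀ hs₀1 hs₀α
  obtain ⟨b, hb, hB⟩ := exists_bound_besselB hα (mul_pos hc₁ hs₀)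
  set γ := α ^ 2 - 1 / 4 with hγ
  set z := s₀ ^ (α + 1 / 2) with hz
  have hz0 : 0 < z := Real.rpow_pos_of_pos hs₀ _
  set K₁ := z * (K + |α + 1 / 2| / s₀ * K) with hK₁
  set b₁ := (1 + |γ| / (c₁ * s₀) ^ 2) * b with hb₁
  refine ⟨(z * K + b + b) + (K₁ / c₁ + b / c₁ + (b + z * K) / (2 * c₁ ^ 5) + b₁),
    by positivity, ?_⟩
  intro L w v hL hsL hc hreg
  have hL0 : 0 < L := by linarith
  obtain ⟨hw, hv⟩ := hlayer L w v hL hreg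
  obtain ⟨hξ1, hξ2, -⟩ := liouville_bounds γ hc₁ hL0 hs₀ hsL hc
  set ξ := liouvillePhase L s₀ with hξ
  have hL2 : (s₀ / L) ^ 2 ≤ 1 / L ^ 2 := by
    rw [div_pow]; gcongr; exact pow_le_one₀ hs₀.le hs₀1
  -- Since g(y) = y + O(y³), at a fixed point s₀ the phase differs from s₀ only by O(L⁻²).
  have hξ3 : s₀ - ξ ≤ 1 / L ^ 2 := by
    have hy0 : 0 ≤ s₀ / L := by positivity
    have hy1 : s₀ / L < 1 := (div_lt_one hL0).mpr hsL
    obtain ⟨-, h2, -⟩ := bulkPhase_le_and_ge hy0 hy1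
    have h3 : (s₀ / L) ^ 5 ≤ (s₀ / L) ^ 3 := pow_le_pow_of_le_one hy0 hy1.le (by norm_num)
    have h4 : 0 ≤ (s₀ / L) ^ 3 := by positivity
    have e1 : s₀ - ξ = L * (s₀ / L - bulkPhase (s₀ / L)) := by
      rw [hξ, liouvillePhase]; field_simp
    have e2 : s₀ ^ 3 ≤ 1 := pow_le_one₀ hs₀.le hs₀1
    rw [e1]
    calc _ ≤ L * (s₀ / L) ^ 3 := by gcongr; linarith
      _ = s₀ ^ 3 / L ^ 2 := by field_simp
      _ ≤ _ := by gcongr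
  set r := √√(1 - (s₀ / L) ^ 2) with hr
  have hy2 : 0 ≤ (s₀ / L) ^ 2 := by positivity
  have hy21 : (s₀ / L) ^ 2 < 1 :=
    (sq_lt_one_iff₀ (by positivity)).mpr ((div_lt_one hL0).mpr hsL)
  have hc_le : √(1 - (s₀ / L) ^ 2) ≤ 1 := by
    exact Real.sqrt_le_iff.mpr ⟨zero_le_one, by linarith⟩
  have hr1 : r ≤ 1 := Real.sqrt_le_iff.mpr ⟨zero_le_one, by linarith⟩
  have hr0 : 0 ≤ r := Real.sqrt_nonneg _
  have hr2 : r ^ 2 = √(1 - (s₀ / L) ^ 2) := Real.sq_sqrt (Real.sqrt_nonneg _)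
  have hr4 : r ^ 4 = 1 - (s₀ / L) ^ 2 := by
    rw [show (4 : ℕ) = 2 * 2 by norm_num, pow_mul, hr2, Real.sq_sqrt (by linarith)]
  have hrc : c₁ ≤ r := by nlinarith
  have hrpos : 0 < r := hc₁.trans_le hrc
  -- For 0 ≤ r ≤ 1 one has 1 − r ≤ 1 − r⁴ = (s₀/L)².
  have hr1' : 1 - r ≤ 1 / L ^ 2 := by
    have : r ^ 4 ≤ r := pow_le_of_le_one hr0 hr1 (by norm_num)
    linarith
  have hBs := hB s₀ (mul_le_of_le_one_left hs₀.le hc₁1)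
  have hu : |z * w s₀ - besselB α s₀| ≤ z * K / L ^ 2 := by
    have e : z * w s₀ - besselB α s₀ = z * (w s₀ - besselW α s₀) := by rw [besselB]; ring
    rw [e, abs_mul, abs_of_pos hz0, mul_div_assoc]
    gcongr
  have hu1 : |z * (s₀ * v s₀ + (α + 1 / 2) / s₀ * w s₀) - besselB' α s₀| ≤ K₁ / L ^ 2 := by
    have e : z * (s₀ * v s₀ + (α + 1 / 2) / s₀ * w s₀) - besselB' α s₀
        = z * ((s₀ * v s₀ - besselW' α s₀) + (α + 1 / 2) / s₀ * (w s₀ - besselW α s₀)) := by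
      rw [besselB']; ring
    rw [e, abs_mul, abs_of_pos hz0, hK₁, mul_div_assoc]
    refine mul_le_mul_of_nonneg_left ((abs_add_le _ _).trans ?_) hz0.le
    rw [abs_mul, abs_div, abs_of_pos hs₀, add_div, mul_div_assoc]
    gcongr
  have hBξ : |besselB α s₀ - besselB α ξ| ≤ b / L ^ 2 := by
    have h1 := abs_sub_le_of_hasDerivAt_le hξ2 (f := besselB α) (g := fun t => b * t)
      (g' := fun _ => b)
      (fun s hs => hasDerivAt_besselB hα ((mul_pos hc₁ hs₀).trans_le (hξ1.trans hs.1)))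
      (fun s _ => ((hasDerivAt_id s).const_mul b).congr_deriv (by simp))
      (fun s hs => (hB s (hξ1.trans hs.1)).2)
    refine h1.trans ?_
    calc b * s₀ - b * ξ = b * (s₀ - ξ) := by ring
      _ ≤ b * (1 / L ^ 2) := by gcongr
      _ = _ := by ring
  have hBξ' : |besselB' α s₀ - besselB' α ξ| ≤ b₁ / L ^ 2 := by
    have hcs := mul_pos hc₁ hs₀
    have h1 := abs_sub_le_of_hasDerivAt_le hξ2 (f := besselB' α) (g := fun t => b₁ * t)
      (g' := fun _ => b₁)
      (fun s hs => hasDerivAt_besselB' hα (hcs.trans_le (hξ1.trans hs.1)))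
      (fun s _ => ((hasDerivAt_id s).const_mul b₁).congr_deriv (by simp))
      (fun s hs => by
        have hs1 := hξ1.trans hs.1
        rw [abs_neg, abs_mul]
        refine mul_le_mul ((abs_sub _ _).trans ?_) (hB s hs1).1 (abs_nonneg _) (by positivity)
        rw [abs_one, abs_div, abs_of_nonneg (sq_nonneg s)]
        gcongr)
    refine h1.trans ?_
    calc b₁ * s₀ - b₁ * ξ = b₁ * (s₀ - ξ) := by ring
      _ ≤ b₁ * (1 / L ^ 2) := by gcongr
      _ = _ := by ring
  have hA1 : 0 ≤ z * K + b + b := by positivity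
  have hA2 : 0 ≤ K₁ / c₁ + b / c₁ + (b + z * K) / (2 * c₁ ^ 5) + b₁ := by positivity
  constructor
  · have e : bulkP α L w s₀ - besselB α ξ = r * (z * w s₀ - besselB α s₀)
        + -((1 - r) * besselB α s₀) + (besselB α s₀ - besselB α ξ) := by
      rw [bulkP]; ring
    have t1 : |r * (z * w s₀ - besselB α s₀)| ≤ z * K / L ^ 2 := by
      rw [abs_mul, abs_of_nonneg hr0]
      exact (mul_le_of_le_one_left (abs_nonneg _) hr1).trans hu
    have t2 : |-((1 - r) * besselB α s₀)| ≤ b / L ^ 2 := by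
      rw [abs_neg, abs_mul, abs_of_nonneg (by linarith)]
      calc _ ≤ 1 / L ^ 2 * b := mul_le_mul hr1' hBs.1 (abs_nonneg _) (by positivity)
        _ = _ := by ring
    rw [e]
    calc _ ≤ z * K / L ^ 2 + b / L ^ 2 + b / L ^ 2 :=
          (abs_add_le _ _).trans (add_le_add ((abs_add_le _ _).trans (add_le_add t1 t2)) hBξ)
      _ = (z * K + b + b) / L ^ 2 := by ring
      _ ≤ _ := div_le_div_of_nonneg_right (by linarith) (by positivity)
  · have e : bulkM α L w v s₀ - besselB' α ξ
        = (z * (s₀ * v s₀ + (α + 1 / 2) / s₀ * w s₀) - besselB' α s₀) / r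
        + (1 - r) / r * besselB' α s₀ + -((s₀ / L) / (2 * L * r ^ 5) * (z * w s₀))
        + (besselB' α s₀ - besselB' α ξ) := by
      rw [bulkM, ← hr, ← hz]; field_simp; ring
    have t1 : |(z * (s₀ * v s₀ + (α + 1 / 2) / s₀ * w s₀) - besselB' α s₀) / r|
        ≤ K₁ / c₁ / L ^ 2 := by
      rw [abs_div, abs_of_pos hrpos]
      calc _ ≤ K₁ / L ^ 2 / c₁ := div_le_div₀ (by positivity) hu1 hc₁ hrc
        _ = _ := by ring
    have t2 : |(1 - r) / r * besselB' α s₀| ≤ b / c₁ / L ^ 2 := by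
      rw [abs_mul, abs_of_nonneg (div_nonneg (by linarith) hr0)]
      calc _ ≤ 1 / L ^ 2 / c₁ * b := mul_le_mul (div_le_div₀ (by positivity) hr1' hc₁ hrc) hBs.2
            (abs_nonneg _) (by positivity)
        _ = _ := by ring
    have t3 : |-((s₀ / L) / (2 * L * r ^ 5) * (z * w s₀))| ≤ (b + z * K) / (2 * c₁ ^ 5) / L ^ 2 := by
      have h1 : |z * w s₀| ≤ b + z * K := by
        have h2 := abs_add_le (z * w s₀ - besselB α s₀) (besselB α s₀)
        rw [sub_add_cancel] at h2
        have h3 : z * K / L ^ 2 ≤ z * K := div_le_self (by positivity) (one_le_pow₀ hL)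
        linarith [hBs.1]
      rw [abs_neg, abs_mul, abs_of_nonneg (by positivity)]
      have h4 : s₀ / L / (2 * L * r ^ 5) ≤ 1 / L / (2 * L * c₁ ^ 5) := by gcongr
      calc _ ≤ 1 / L / (2 * L * c₁ ^ 5) * (b + z * K) := mul_le_mul h4 h1 (abs_nonneg _) (by positivity)
        _ = _ := by field_simp
    rw [e]
    calc _ ≤ K₁ / c₁ / L ^ 2 + b / c₁ / L ^ 2 + (b + z * K) / (2 * c₁ ^ 5) / L ^ 2 + b₁ / L ^ 2 :=
          (abs_add_le _ _).trans (add_le_add ((abs_add_le _ _).trans (add_le_add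
            ((abs_add_le _ _).trans (add_le_add t1 t2)) t3)) hBξ')
      _ = (K₁ / c₁ + b / c₁ + (b + z * K) / (2 * c₁ ^ 5) + b₁) / L ^ 2 := by ring
      _ ≤ _ := div_le_div_of_nonneg_right (by linarith) (by positivity)

/-- Bulk asymptotics of regular solutions, uniformly in the bulk. -/
theorem exists_bound_bulk {α y₀ y₁ : ℝ} (hα : -1 < α) (hy₀ : 0 < y₀) (hy₁ : y₁ < 1) :
    ∃ C L₀, 0 ≤ C ∧ 1 ≤ L₀ ∧ ∀ (L : ℝ) (w v : ℝ → ℝ), L₀ ≤ L → IsRegularSolution α L w v →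
      ∀ y ∈ Icc y₀ y₁,
      |bulkP α L w (L * y) - besselAmplitude α * Real.cos (besselArg α - L * bulkPhase y)| ≤ C / L ∧
      |bulkM α L w v (L * y) - besselAmplitude α * Real.sin (besselArg α - L * bulkPhase y)| ≤ C / L ∧
      |bulkM α L w v (L * y) ^ 2 + bulkP α L w (L * y) ^ 2 - besselAmplitude α ^ 2| ≤ C / L ^ 2 := by
  by_cases hy₀₁ : y₀ ≤ y₁
  swap
  · exact ⟨0, 1, le_rfl, le_rfl, fun L w v _ _ y hy => absurd (hy.1.trans hy.2) hy₀₁⟩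
  have hy₁0 : 0 < y₁ := hy₀.trans_le hy₀₁
  have hα1 : 0 < α + 1 := by linarith
  obtain ⟨s₀, hs₀, hs₀1, hs₀α⟩ : ∃ s₀ : ℝ, 0 < s₀ ∧ s₀ ≤ 1 ∧ s₀ ^ 2 ≤ α + 1 := by
    have h0 : 0 < min 1 √(α + 1) := lt_min one_pos (Real.sqrt_pos.mpr hα1)
    refine ⟨min 1 √(α + 1), h0, min_le_left _ _, ?_⟩
    calc _ ≤ √(α + 1) ^ 2 := pow_le_pow_left₀ h0.le (min_le_right _ _) 2
      _ = _ := Real.sq_sqrt hα1.le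
  have hy12 : 0 < 1 - y₁ ^ 2 := by nlinarith
  set c₁ := √(1 - y₁ ^ 2) with hc₁d
  have hc₁ : 0 < c₁ := Real.sqrt_pos.mpr hy12
  have hc₁1 : c₁ ≤ 1 := Real.sqrt_le_iff.mpr ⟨zero_le_one, by nlinarith⟩
  obtain ⟨b, hb, hB⟩ := exists_bound_besselB hα (mul_pos hc₁ hs₀)
  obtain ⟨K, hK, hinit⟩ := exists_bound_bulk_initial hα hs₀ hs₀1 hs₀α hc₁ hc₁1
  set γ := α ^ 2 - 1 / 4 with hγ
  obtain ⟨C, hC, hcomp⟩ := liouville_comparison (γ := γ) hc₁ hs₀ hb hK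
  obtain ⟨C', hC', henergy⟩ := liouville_energy_comparison (γ := γ) hc₁ hc₁1 hs₀ hb hK hC
  obtain ⟨D, hD, hasym⟩ := exists_besselB_sub_cos_bound hα
  obtain ⟨D', hD', hBen⟩ := exists_besselB_energy_bound hα
  set Ψ := 2 * |γ| / c₁ ^ 4 + 5 / (4 * c₁ ^ 6) with hΨ
  have hΨ0 : 0 ≤ Ψ := by positivity
  set m := c₁ * y₀ with hm
  have hm0 : 0 < m := by positivity
  set C₁ := C + D / m with hC₁
  set C₂ := C' + D' / m ^ 2 + (Ψ + |γ| / m ^ 2) * (b + C) ^ 2 with hC₂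
  have hC₁0 : 0 ≤ C₁ := by positivity
  have hC₂0 : 0 ≤ C₂ := by positivity
  -- The threshold puts s₀ below the bulk window and makes ξ ≥ L m ≥ 1, the range in which the
  -- Bessel asymptotics hold.
  refine ⟨C₁ + C₂, max 1 (max (s₀ / y₀) (1 / m)), by positivity, le_max_left _ _, ?_⟩
  intro L w v hLL hreg y hy
  have hL : 1 ≤ L := (le_max_left _ _).trans hLL
  have hL0 : 0 < L := by linarith
  have hLs : s₀ ≤ L * y₀ := by
    rw [← div_le_iff₀ hy₀]; exact ((le_max_left _ _).trans (le_max_right _ _)).trans hLL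
  have hLm : 1 ≤ L * m := by
    rw [← div_le_iff₀ hm0]; exact ((le_max_right _ _).trans (le_max_right _ _)).trans hLL
  have hy0 : 0 < y := hy₀.trans_le hy.1
  have hy1 : y < 1 := hy.2.trans_lt hy₁
  have hs₀s : s₀ ≤ L * y := hLs.trans (mul_le_mul_of_nonneg_left hy.1 hL0.le)
  have hsL : L * y < L := mul_lt_of_lt_one_right hL0 hy1
  have hdiv : L * y / L = y := by field_simp
  have hcy : c₁ ≤ √(1 - (L * y / L) ^ 2) := by
    rw [hdiv]; exact Real.sqrt_le_sqrt (sub_le_sub_left (pow_le_pow_left₀ hy0.le hy.2 2) 1)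
  have hcs₀ : c₁ ≤ √(1 - (s₀ / L) ^ 2) := hcy.trans <| Real.sqrt_le_sqrt <|
    sub_le_sub_left (pow_le_pow_left₀ (by positivity) (div_le_div_of_nonneg_right hs₀s hL0.le) 2) 1
  obtain ⟨hP0, hM0⟩ := hinit L w v hL (hs₀s.trans_lt hsL) hcs₀ hreg
  have hPd : ∀ s ∈ Icc s₀ (L * y), HasDerivAt (bulkP α L w) (√(1 - (s / L) ^ 2) * bulkM α L w v s) s :=
    fun s hs => (hreg.hasDerivAt_bulk hL0 (hs₀.trans_le hs.1) (hs.2.trans_lt hsL)).1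
  have hMd : ∀ s ∈ Icc s₀ (L * y), HasDerivAt (bulkM α L w v)
      (-(√(1 - (s / L) ^ 2) * liouvillePotential γ L s * bulkP α L w s)) s :=
    fun s hs => (hreg.hasDerivAt_bulk hL0 (hs₀.trans_le hs.1) (hs.2.trans_lt hsL)).2
  have hBd := fun (t : ℝ) (ht : t > 0) => hasDerivAt_besselB hα ht
  have hBd' := fun (t : ℝ) (ht : t > 0) => hasDerivAt_besselB' hα ht
  have h1 := hcomp L (L * y) hL hs₀s hsL hcy _ _ _ _ hPd hMd hBd hBd' hB hP0 hM0
  have h2 := henergy L (L * y) hL hs₀s hsL hcy _ _ _ _ hPd hMd hBd hBd' hB hP0 hM0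
    (fun s hs => (h1 s hs).1) (L * y) (right_mem_Icc.mpr hs₀s)
  obtain ⟨h3, h4⟩ := h1 (L * y) (right_mem_Icc.mpr hs₀s)
  obtain ⟨hξ1, hξ2, hξ3⟩ := liouville_bounds γ hc₁ hL0 (hs₀.trans_le hs₀s) hsL hcy
  have hξe : liouvillePhase L (L * y) = L * bulkPhase y := by rw [liouvillePhase, hdiv]
  rw [hξe] at h2 h3 h4 hξ1 hξ2 hξ3
  set ξ := L * bulkPhase y with hξ
  set P := bulkP α L w (L * y) with hP
  set M := bulkM α L w v (L * y) with hM
  have hξm : L * m ≤ ξ := by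
    refine le_trans ?_ hξ1
    rw [hm]
    calc L * (c₁ * y₀) = c₁ * (L * y₀) := by ring
      _ ≤ _ := by gcongr; exact hy.1
  have hξ1' : 1 ≤ ξ := hLm.trans hξm
  have hξ0 : 0 < ξ := by linarith
  have hCs : C * (L * y) / L ^ 2 ≤ C / L := by
    calc C * (L * y) / L ^ 2 = C / L * y := by field_simp
      _ ≤ C / L * 1 := by gcongr
      _ = _ := mul_one _
  have hDξ : D / ξ ≤ D / m / L := by
    calc D / ξ ≤ D / (L * m) := by gcongr
      _ = _ := by field_simp
  have hfin : C / L + D / m / L ≤ (C₁ + C₂) / L := by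
    rw [← add_div]; exact div_le_div_of_nonneg_right (by linarith) hL0.le
  obtain ⟨ha1, ha2⟩ := hasym ξ hξ1'
  refine ⟨?_, ?_, ?_⟩
  · refine (abs_sub_le P (besselB α ξ) _).trans ((add_le_add (h3.trans hCs) (ha1.trans hDξ)).trans hfin)
  · refine (abs_sub_le M (besselB' α ξ) _).trans ((add_le_add (h4.trans hCs) (ha2.trans hDξ)).trans hfin)
  · have he := hBen ξ hξ1'
    set q := liouvillePotential γ L (L * y) with hq
    set eB := besselB' α ξ ^ 2 + (1 - γ / ξ ^ 2) * besselB α ξ ^ 2 with heB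
    -- The energy comparison concerns M² + qP². In the bulk q − 1 = O(L⁻²), because γ/ξ² is itself
    -- O(L⁻²) there, so q may be replaced by 1.
    have e1 : M ^ 2 + P ^ 2 - besselAmplitude α ^ 2 = (M ^ 2 + q * P ^ 2 - eB)
        + (eB - besselAmplitude α ^ 2) + (-((q - (1 - γ / ξ ^ 2)) + -(γ / ξ ^ 2)) * P ^ 2) := by ring
    have hP1 : |P| ≤ b + C := by
      have h5 := abs_add_le (P - besselB α ξ) (besselB α ξ)
      rw [sub_add_cancel] at h5
      have h6 := (hB ξ ((mul_le_mul_of_nonneg_left hs₀s hc₁.le).trans hξ1)).1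
      have h7 : C / L ≤ C := div_le_self hC hL
      linarith
    have hξ2' : ∀ x : ℝ, 0 ≤ x → x / ξ ^ 2 ≤ x / m ^ 2 / L ^ 2 := fun x hx => by
      calc x / ξ ^ 2 ≤ x / (L * m) ^ 2 := by gcongr
        _ = _ := by field_simp
    have t3 : |-((q - (1 - γ / ξ ^ 2)) + -(γ / ξ ^ 2)) * P ^ 2|
        ≤ (Ψ + |γ| / m ^ 2) * (b + C) ^ 2 / L ^ 2 := by
      rw [abs_mul, abs_neg, abs_pow]
      have h8 : |q - (1 - γ / ξ ^ 2) + -(γ / ξ ^ 2)| ≤ Ψ / L ^ 2 + |γ| / m ^ 2 / L ^ 2 := by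
        refine (abs_add_le _ _).trans (add_le_add hξ3 ?_)
        rw [abs_neg, abs_div, abs_of_pos (pow_pos hξ0 2)]
        exact hξ2' _ (abs_nonneg _)
      calc _ ≤ (Ψ / L ^ 2 + |γ| / m ^ 2 / L ^ 2) * (b + C) ^ 2 := by gcongr
        _ = _ := by ring
    rw [e1]
    calc _ ≤ C' / L ^ 2 + D' / m ^ 2 / L ^ 2 + (Ψ + |γ| / m ^ 2) * (b + C) ^ 2 / L ^ 2 :=
          (abs_add_le _ _).trans (add_le_add ((abs_add_le _ _).trans (add_le_add h2
            (he.trans (hξ2' D' hD')))) t3)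
      _ = C₂ / L ^ 2 := by rw [hC₂]; ring
      _ ≤ _ := by gcongr; linarith

end BulkAsymptotics

/-! ### The quadratic form of the density -/

section QuadraticForm
open Set Topology

/-- The quadratic form in a regular solution and its derivative that gives the one-point density. -/
noncomputable def densityForm (α a b L : ℝ) (w v : ℝ → ℝ) (s : ℝ) : ℝ :=
  (s ^ (α + 1 / 2)) ^ 2 * ((s * v s + (α + 1 / 2) / s * w s) ^ 2
    - a * w s * (s * v s + (α + 1 / 2) / s * w s) / s
    - a * (α ^ 2 - 1 / 4) / s ^ 2 * w s ^ 2 + (1 - (s / L) ^ 2 - b / L) * w s ^ 2)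

theorem abs_mul_sub_mul_le {x y a b B ε : ℝ} (hB : 0 ≤ B) (hx : |x - a| ≤ ε) (hy : |y - b| ≤ ε)
    (ha : |a| ≤ B) (hε : ε ≤ 1) (hb : |b| ≤ B) : |x * y - a * b| ≤ (2 * B + 1) * ε := by
  have hε0 : 0 ≤ ε := (abs_nonneg _).trans hx
  have e : x * y - a * b = (x - a) * (y - b) + (x - a) * b + a * (y - b) := by ring
  rw [e]
  have h1 : |(x - a) * (y - b)| ≤ ε * 1 := by
    rw [abs_mul]; exact mul_le_mul hx (hy.trans hε) (abs_nonneg _) hε0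
  have h2 : |(x - a) * b| ≤ ε * B := by
    rw [abs_mul]; exact mul_le_mul hx hb (abs_nonneg _) hε0
  have h3 : |a * (y - b)| ≤ B * ε := by
    rw [abs_mul]; exact mul_le_mul ha hy (abs_nonneg _) hB
  have h4 := (abs_add_le ((x - a) * (y - b) + (x - a) * b) (a * (y - b))).trans
    (add_le_add_left (abs_add_le _ _) _)
  linarith

/-- In the Liouville–Green variables only √(1−y²)(M²+P²) comes without a factor 1/L, and that is the
combination known up to O(L⁻²). For the rest the O(1/L) approximations of P and M are enough. -/
theorem densityForm_eq {α a b L y : ℝ} (hL : 0 < L) (hy0 : 0 < y) (hy1 : y < 1) (w v : ℝ → ℝ) :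
    densityForm α a b L w v (L * y)
      = √(1 - y ^ 2) * (bulkM α L w v (L * y) ^ 2 + bulkP α L w (L * y) ^ 2)
        + (bulkM α L w v (L * y) * bulkP α L w (L * y) * (y / √(1 - y ^ 2) ^ 2 - a / y)
          - b * (bulkP α L w (L * y) * bulkP α L w (L * y)) / √(1 - y ^ 2)) / L
        + (bulkP α L w (L * y) * bulkP α L w (L * y)) * (y ^ 2 / (4 * √(1 - y ^ 2) ^ 5)
          - a / (2 * √(1 - y ^ 2) ^ 3) - a * (α ^ 2 - 1 / 4) / (y ^ 2 * √(1 - y ^ 2))) / L ^ 2 := by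
  have hdiv : L * y / L = y := by field_simp
  have hc2 : 0 < 1 - y ^ 2 := by nlinarith
  have hc : 0 < √(1 - y ^ 2) := Real.sqrt_pos.mpr hc2
  have hr : 0 < √√(1 - y ^ 2) := Real.sqrt_pos.mpr hc
  have hcr : √(1 - y ^ 2) = √√(1 - y ^ 2) ^ 2 := (Real.sq_sqrt hc.le).symm
  have hr4 : 1 - y ^ 2 = √√(1 - y ^ 2) ^ 4 := by
    rw [show (4 : ℕ) = 2 * 2 by norm_num, pow_mul, Real.sq_sqrt hc.le, Real.sq_sqrt hc2.le]
  rw [densityForm, bulkM, bulkP, hdiv]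
  generalize (L * y) ^ (α + 1 / 2) = z
  generalize w (L * y) = w₀
  generalize L * y * v (L * y) = t
  generalize h1 : t + (α + 1 / 2) / (L * y) * w₀ = u₁
  have hr4' : 1 - y ^ 2 - b / L = √√(1 - y ^ 2) ^ 4 - b / L := by rw [← hr4]
  rw [hr4', hcr, Real.sqrt_sq hr.le]
  generalize √√(1 - y ^ 2) = r at hr
  field_simp
  ring

/-- The bound is uniform on compact subintervals, since it will be used at a point that moves with
N. The parameters are (a, b) = (1, 2) for the LUE and (0, 1) for the GUE. -/
theorem exists_bound_densityForm {α y₀ y₁ : ℝ} (a b : ℝ) (hα : -1 < α) (hy₀ : 0 < y₀) (hy₁ : y₁ < 1) :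
    ∃ C L₀, 0 ≤ C ∧ 1 ≤ L₀ ∧ ∀ (L : ℝ) (w v : ℝ → ℝ), L₀ ≤ L → IsRegularSolution α L w v →
      ∀ y ∈ Icc y₀ y₁, |densityForm α a b L w v (L * y) - besselAmplitude α ^ 2 *
        (√(1 - y ^ 2) + (Real.sin (besselArg α - L * bulkPhase y) *
            Real.cos (besselArg α - L * bulkPhase y) * (y / √(1 - y ^ 2) ^ 2 - a / y)
          - b * Real.cos (besselArg α - L * bulkPhase y) ^ 2 / √(1 - y ^ 2)) / L)| ≤ C / L ^ 2 := by
  by_cases hy₀₁ : y₀ ≤ y₁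
  swap
  · exact ⟨0, 1, le_rfl, le_rfl, fun L w v _ _ y hy => absurd (hy.1.trans hy.2) hy₀₁⟩
  obtain ⟨C, L₀, hC, hL₀, h⟩ := exists_bound_bulk hα hy₀ hy₁
  set c₁ := √(1 - y₁ ^ 2) with hc₁d
  have hc₁ : 0 < c₁ := Real.sqrt_pos.mpr (by nlinarith [hy₀.trans_le hy₀₁])
  set κ := besselAmplitude α with hκ
  set γ := α ^ 2 - 1 / 4 with hγ
  set A := 1 / c₁ ^ 2 + |a| / y₀ with hA
  set R := 1 / (4 * c₁ ^ 5) + |a| / (2 * c₁ ^ 3) + |a * γ| / (y₀ ^ 2 * c₁) with hR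
  set B := (2 * |κ| + 1) * C with hB
  refine ⟨C + (B * A + |b| * B / c₁) + (|κ| + 1) ^ 2 * R, max L₀ C, by positivity,
    hL₀.trans (le_max_left _ _), ?_⟩
  intro L w v hLL hreg y hy
  have hL : 1 ≤ L := hL₀.trans ((le_max_left _ _).trans hLL)
  have hL0 : 0 < L := by linarith
  have hCL : C / L ≤ 1 := by rw [div_le_one hL0]; exact (le_max_right _ _).trans hLL
  have hy0 : 0 < y := hy₀.trans_le hy.1
  have hy1 : y < 1 := hy.2.trans_lt hy₁
  obtain ⟨hP, hM, hE⟩ := h L w v ((le_max_left _ _).trans hLL) hreg y hy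
  rw [densityForm_eq hL0 hy0 hy1]
  set P := bulkP α L w (L * y)
  set M := bulkM α L w v (L * y)
  set ψ := besselArg α - L * bulkPhase y
  set c := √(1 - y ^ 2) with hcd
  have hc : c₁ ≤ c := Real.sqrt_le_sqrt (sub_le_sub_left (pow_le_pow_left₀ hy0.le hy.2 2) 1)
  have hc0 : 0 < c := hc₁.trans_le hc
  have hc1 : c ≤ 1 := Real.sqrt_le_iff.mpr ⟨zero_le_one, by nlinarith⟩
  have hkc : |κ * Real.cos ψ| ≤ |κ| := by
    rw [abs_mul]; exact mul_le_of_le_one_right (abs_nonneg _) (Real.abs_cos_le_one _)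
  have hks : |κ * Real.sin ψ| ≤ |κ| := by
    rw [abs_mul]; exact mul_le_of_le_one_right (abs_nonneg _) (Real.abs_sin_le_one _)
  have hMP : |M * P - κ * Real.sin ψ * (κ * Real.cos ψ)| ≤ B / L := by
    have := abs_mul_sub_mul_le (abs_nonneg κ) hM hP hks hCL hkc
    rwa [← mul_div_assoc] at this
  have hPP : |P * P - κ * Real.cos ψ * (κ * Real.cos ψ)| ≤ B / L := by
    have := abs_mul_sub_mul_le (abs_nonneg κ) hP hP hkc hCL hkc
    rwa [← mul_div_assoc] at this
  have hPb : |P * P| ≤ (|κ| + 1) ^ 2 := by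
    have h1 : |P| ≤ |κ| + 1 := by
      have h2 := abs_add_le (P - κ * Real.cos ψ) (κ * Real.cos ψ)
      rw [sub_add_cancel] at h2
      linarith
    rw [abs_mul, pow_two]; gcongr
  have hA' : |y / c ^ 2 - a / y| ≤ A := by
    refine (abs_sub _ _).trans ?_
    rw [abs_div, abs_div, abs_of_pos hy0, abs_of_pos (pow_pos hc0 2), hA]
    have := hy.1
    gcongr
  have hR' : |y ^ 2 / (4 * c ^ 5) - a / (2 * c ^ 3) - a * γ / (y ^ 2 * c)| ≤ R := by
    refine ((abs_sub _ _).trans (add_le_add_left (abs_sub _ _) _)).trans ?_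
    rw [abs_div, abs_div, abs_div, abs_of_pos (pow_pos hy0 2), abs_of_pos (by positivity : 0 < 4 * c ^ 5),
      abs_of_pos (by positivity : 0 < 2 * c ^ 3), abs_of_pos (by positivity : 0 < y ^ 2 * c), hR]
    have hy2 : y ^ 2 ≤ 1 := pow_le_one₀ hy0.le hy1.le
    have := hy.1
    gcongr
  have e : c * (M ^ 2 + P ^ 2) + (M * P * (y / c ^ 2 - a / y) - b * (P * P) / c) / L
      + P * P * (y ^ 2 / (4 * c ^ 5) - a / (2 * c ^ 3) - a * γ / (y ^ 2 * c)) / L ^ 2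
      - κ ^ 2 * (c + (Real.sin ψ * Real.cos ψ * (y / c ^ 2 - a / y) - b * Real.cos ψ ^ 2 / c) / L)
      = c * (M ^ 2 + P ^ 2 - κ ^ 2)
        + ((M * P - κ * Real.sin ψ * (κ * Real.cos ψ)) * (y / c ^ 2 - a / y)
          - b * (P * P - κ * Real.cos ψ * (κ * Real.cos ψ)) / c) / L
        + P * P * (y ^ 2 / (4 * c ^ 5) - a / (2 * c ^ 3) - a * γ / (y ^ 2 * c)) / L ^ 2 := by ring
  rw [e]
  have t1 : |c * (M ^ 2 + P ^ 2 - κ ^ 2)| ≤ C / L ^ 2 := by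
    rw [abs_mul, abs_of_pos hc0]
    exact (mul_le_of_le_one_left (abs_nonneg _) hc1).trans hE
  have t2 : |((M * P - κ * Real.sin ψ * (κ * Real.cos ψ)) * (y / c ^ 2 - a / y)
          - b * (P * P - κ * Real.cos ψ * (κ * Real.cos ψ)) / c) / L| ≤ (B * A + |b| * B / c₁) / L ^ 2 := by
    rw [abs_div, abs_of_pos hL0]
    have h1 : |(M * P - κ * Real.sin ψ * (κ * Real.cos ψ)) * (y / c ^ 2 - a / y)| ≤ B / L * A := by
      rw [abs_mul]; exact mul_le_mul hMP hA' (abs_nonneg _) (by positivity)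
    have h2 : |b * (P * P - κ * Real.cos ψ * (κ * Real.cos ψ)) / c| ≤ |b| * (B / L) / c₁ := by
      rw [abs_div, abs_mul, abs_of_pos hc0]; gcongr
    calc _ ≤ (B / L * A + |b| * (B / L) / c₁) / L :=
          div_le_div_of_nonneg_right ((abs_sub _ _).trans (add_le_add h1 h2)) hL0.le
      _ = _ := by field_simp
  have t3 : |P * P * (y ^ 2 / (4 * c ^ 5) - a / (2 * c ^ 3) - a * γ / (y ^ 2 * c)) / L ^ 2|
      ≤ (|κ| + 1) ^ 2 * R / L ^ 2 := by
    rw [abs_div, abs_mul, abs_of_pos (pow_pos hL0 2)]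
    gcongr
  calc _ ≤ C / L ^ 2 + (B * A + |b| * B / c₁) / L ^ 2 + (|κ| + 1) ^ 2 * R / L ^ 2 :=
        (abs_add_le _ _).trans (add_le_add ((abs_add_le _ _).trans (add_le_add t1 t2)) t3)
    _ = _ := by ring

/-- Putting y = sin τ merges the oscillating terms into a single sine, shifted by 2τ, and leaves
−1/c as the non-oscillating part of the correction. -/
theorem laguerre_phase_identity {y c ψ τ : ℝ} (hy : Real.sin τ = y) (hc : Real.cos τ = c)
    (hy0 : 0 < y) (hc0 : 0 < c) :
    Real.sin ψ * Real.cos ψ * (y / c ^ 2 - 1 / y) - 2 * Real.cos ψ ^ 2 / c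
      = -(1 / c) - Real.sin (2 * ψ + 2 * τ) / (2 * y * c ^ 2) := by
  rw [Real.sin_add, Real.sin_two_mul, Real.sin_two_mul, Real.cos_two_mul, Real.cos_two_mul, hy, hc]
  have h := Real.sin_sq_add_cos_sq τ
  rw [hy, hc] at h
  field_simp
  linear_combination Real.sin ψ * Real.cos ψ * h

/-- As for Laguerre, with the shift τ and the non-oscillating part −1/(2c). -/
theorem hermite_phase_identity {y c ψ τ : ℝ} (hy : Real.sin τ = y) (hc : Real.cos τ = c)
    (hc0 : 0 < c) :
    Real.sin ψ * Real.cos ψ * (y / c ^ 2 - 0 / y) - 1 * Real.cos ψ ^ 2 / c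
      = -(1 / (2 * c)) - Real.cos (2 * ψ + τ) / (2 * c ^ 2) := by
  rw [Real.cos_add, Real.sin_two_mul, Real.cos_two_mul, hy, hc, zero_div, sub_zero]
  field_simp
  ring

end QuadraticForm

/-! ### The normalising gamma quotient -/

section GammaRatio
open Set Topology

/-- The ratio `Γ(n+α+1) / (n! (n+(α+1)/2)^α)`. -/
noncomputable def gammaRatio (α : ℝ) (n : ℕ) : ℝ :=
  Real.Gamma (n + α + 1) / (n.factorial * ((n : ℝ) + (α + 1) / 2) ^ α)

theorem gammaRatio_pos {α : ℝ} (hα : -1 < α) (n : ℕ) : 0 < gammaRatio α n := by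
  have hn : (0 : ℝ) ≤ n := n.cast_nonneg
  have h1 : 0 < Real.Gamma (n + α + 1) := Real.Gamma_pos_of_pos (by linarith)
  have h2 : 0 < ((n : ℝ) + (α + 1) / 2) ^ α := Real.rpow_pos_of_pos (by linarith) _
  unfold gammaRatio
  positivity

/-- The left side is odd in x, so the quadratic terms of the two logarithms cancel. -/
theorem abs_log_one_add_sub_log_one_sub_sub_le {x : ℝ} (hx : |x| ≤ 1 / 2) :
    |Real.log (1 + x) - Real.log (1 - x) - 2 * x| ≤ 4 * |x| ^ 3 := by
  have h1 := Real.abs_log_sub_add_sum_range_le (x := x) (by linarith) 2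
  have h2 := Real.abs_log_sub_add_sum_range_le (x := -x) (by rw [abs_neg]; linarith) 2
  simp only [Finset.sum_range_succ, Finset.sum_range_zero, abs_neg, sub_neg_eq_add] at h1 h2
  have h3 : |x| ^ (2 + 1) / (1 - |x|) ≤ 2 * |x| ^ 3 := by
    rw [div_le_iff₀ (by linarith)]
    norm_num
    nlinarith [mul_nonneg (pow_nonneg (abs_nonneg x) 3) (sub_nonneg.mpr hx)]
  have h4 := abs_sub (0 + (-x) ^ (0 + 1) / ((0 : ℕ) + 1) + (-x) ^ (1 + 1) / ((1 : ℕ) + 1) + Real.log (1 + x))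
    (0 + x ^ (0 + 1) / ((0 : ℕ) + 1) + x ^ (1 + 1) / ((1 : ℕ) + 1) + Real.log (1 - x))
  have e : Real.log (1 + x) - Real.log (1 - x) - 2 * x
    = (0 + (-x) ^ (0 + 1) / ((0 : ℕ) + 1) + (-x) ^ (1 + 1) / ((1 : ℕ) + 1) + Real.log (1 + x))
    - (0 + x ^ (0 + 1) / ((0 : ℕ) + 1) + x ^ (1 + 1) / ((1 : ℕ) + 1) + Real.log (1 - x)) := by
    push_cast; ring
  rw [e]
  refine h4.trans ((add_le_add (h2.trans h3) (h1.trans h3)).trans ?_)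
  linarith

/-- Euler's limit formula for Γ(α+1), where shifts of n by a constant do not affect the limit. The
rate is obtained separately, from increments, which by themselves cannot identify the limit. -/
theorem tendsto_gammaRatio {α : ℝ} (hα : -1 < α) : Tendsto (gammaRatio α) atTop (𝓝 1) := by
  have hs : 0 < α + 1 := by linarith
  have hΓ := Real.Gamma_pos_of_pos hs
  have h1 := Real.GammaSeq_tendsto_Gamma (α + 1)
  have hrec : ∀ n : ℕ, Real.Gamma (n + α + 1) = (∏ j ∈ Finset.range n, (α + 1 + j)) * Real.Gamma (α + 1) := by
    intro n
    induction n with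
    | zero => simp
    | succ n ih =>
      have hn : (0 : ℝ) ≤ n := n.cast_nonneg
      rw [Finset.prod_range_succ, show ((n + 1 : ℕ) : ℝ) + α + 1 = (n + α + 1) + 1 by push_cast; ring,
        Real.Gamma_add_one (by linarith), ih]
      ring
  have h2 : Tendsto (fun n : ℕ => ((n : ℝ) / (n + (α + 1)))) atTop (𝓝 1) :=
    tendsto_natCast_div_add_atTop (α + 1)
  have h3 : Tendsto (fun n : ℕ => ((n : ℝ) / (n + (α + 1) / 2)) ^ α) atTop (𝓝 1) := by
    simpa using (tendsto_natCast_div_add_atTop ((α + 1) / 2)).rpow_const (p := α) (Or.inl one_ne_zero)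
  have h4 := (((h1.inv₀ hΓ.ne').const_mul (Real.Gamma (α + 1))).mul h2).mul h3
  rw [mul_inv_cancel₀ hΓ.ne', one_mul, one_mul] at h4
  refine h4.congr' ?_
  filter_upwards [eventually_gt_atTop 0] with n hn
  have hn0 : (0 : ℝ) < n := by exact_mod_cast hn
  have hfac : (0 : ℝ) < n.factorial := by exact_mod_cast n.factorial_pos
  have hprod : 0 < ∏ j ∈ Finset.range n, (α + 1 + (j : ℝ)) := Finset.prod_pos fun j _ => by
    have : (0 : ℝ) ≤ j := j.cast_nonneg
    linarith
  have hp1 : 0 < (n : ℝ) ^ α := Real.rpow_pos_of_pos hn0 _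
  have hm : 0 < (n : ℝ) + (α + 1) / 2 := by linarith
  have hp2 := Real.rpow_pos_of_pos hm α
  have hn1 : 0 < (n : ℝ) + (α + 1) := by linarith
  have hn2 : 0 < (α + 1) + (n : ℝ) := by linarith
  rw [Real.GammaSeq, gammaRatio, hrec, Finset.prod_range_succ, Real.div_rpow hn0.le hm.le,
    Real.rpow_add_one hn0.ne']
  field_simp
  ring

/-- With m = n+1+α/2 the increment of the logarithm is log((m+α/2)/(m−α/2)) − α
log((m+1/2)/(m−1/2)). Both logarithms are symmetric about m thanks to the centre (α+1)/2, the terms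
α/m cancel and O(n⁻³) remains. Summing from n to infinity, where the logarithm tends to 0, gives
O(n⁻²), with no 1/n term. -/
theorem gammaRatio_sub_one_isBigO {α : ℝ} (hα : -1 < α) :
    (fun n : ℕ => gammaRatio α n - 1) =O[atTop] fun n : ℕ => 1 / (n : ℝ) ^ 2 := by
  set K := 4 * (|α| ^ 3 + |α|) with hK
  have hK0 : 0 ≤ K := by positivity
  set a : ℕ → ℝ := fun n => Real.log (gammaRatio α n) with ha
  -- The bound K/(n+1)³ is relaxed to a telescoping difference so that it can be summed at once.
  have hstep : ∀ n : ℕ, 2 * |α| ≤ n → 1 ≤ n → |a (n + 1) - a n| ≤ K / (n : ℝ) ^ 2 - K / ((n : ℝ) + 1) ^ 2 := by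
    intro n hn hn1
    have hn0 : (1 : ℝ) ≤ n := by exact_mod_cast hn1
    obtain ⟨m, hm⟩ : ∃ m : ℝ, m = n + 1 + α / 2 := ⟨_, rfl⟩
    have hmn : ((n : ℝ) + 1) / 2 ≤ m := by linarith
    have hm0 : 0 < m := by linarith
    have hx : |α / (2 * m)| ≤ |α| / (n + 1) := by
      rw [abs_div, abs_of_pos (by positivity : 0 < 2 * m)]; gcongr; linarith
    have hx' : |1 / (2 * m)| ≤ 1 / (n + 1) := by
      rw [abs_div, abs_one, abs_of_pos (by positivity : 0 < 2 * m)]; gcongr; linarith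
    have hx2 : |α| / ((n : ℝ) + 1) ≤ 1 / 2 := by rw [div_le_iff₀ (by positivity)]; linarith
    have hx2' : 1 / ((n : ℝ) + 1) ≤ 1 / 2 := by rw [div_le_iff₀ (by positivity)]; linarith
    have h1 := abs_log_one_add_sub_log_one_sub_sub_le (hx.trans hx2)
    have h2 := abs_log_one_add_sub_log_one_sub_sub_le (hx'.trans hx2')
    have hlog : ∀ z : ℝ, 0 < n → -m < z → z < m → Real.log (1 + z / m) - Real.log (1 - z / m)
        = Real.log (m + z) - Real.log (m - z) := by
      intro z _ hz1 hz2
      have e1 : 1 + z / m = (m + z) / m := by field_simp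
      have e2 : 1 - z / m = (m - z) / m := by field_simp
      rw [e1, e2, Real.log_div (by linarith) hm0.ne', Real.log_div (by linarith) hm0.ne']
      ring
    have hg : ∀ k : ℕ, 1 ≤ (k : ℝ) → a k = Real.log (Real.Gamma (k + α + 1)) - Real.log k.factorial
        - α * Real.log (k + (α + 1) / 2) := by
      intro k hk
      have h1 : 0 < Real.Gamma (k + α + 1) := Real.Gamma_pos_of_pos (by linarith)
      have h3 : 0 < (k : ℝ) + (α + 1) / 2 := by linarith
      have h2 : 0 < ((k : ℝ) + (α + 1) / 2) ^ α := Real.rpow_pos_of_pos h3 _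
      have h4 : (0 : ℝ) < k.factorial := by exact_mod_cast k.factorial_pos
      simp only [ha, gammaRatio]
      rw [Real.log_div h1.ne' (by positivity), Real.log_mul h4.ne' h2.ne', Real.log_rpow h3]
      ring
    have hd : a (n + 1) - a n = (Real.log (m + α / 2) - Real.log (m - α / 2))
        - α * (Real.log (m + 1 / 2) - Real.log (m - 1 / 2)) := by
      rw [hg n hn0, hg (n + 1) (by push_cast; linarith), Nat.factorial_succ, Nat.cast_mul,
        Real.log_mul (by positivity) (by exact_mod_cast n.factorial_ne_zero),
        show ((n + 1 : ℕ) : ℝ) + α + 1 = (n + α + 1) + 1 by push_cast; ring,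
        Real.Gamma_add_one (by linarith),
        Real.log_mul (by linarith) (Real.Gamma_pos_of_pos (by linarith)).ne', hm]
      push_cast
      rw [show (n : ℝ) + 1 + α / 2 + α / 2 = n + α + 1 by ring,
        show (n : ℝ) + 1 + α / 2 - α / 2 = n + 1 by ring,
        show (n : ℝ) + 1 + α / 2 + 1 / 2 = n + 1 + (α + 1) / 2 by ring,
        show (n : ℝ) + 1 + α / 2 - 1 / 2 = n + (α + 1) / 2 by ring]
      ring
    have hα2 : |α| < 2 * m := by linarith
    have hα3 := abs_lt.mp hα2
    rw [← hlog (α / 2) (by linarith) (by linarith) (by linarith),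
      ← hlog (1 / 2) (by linarith) (by linarith) (by linarith),
      show α / 2 / m = α / (2 * m) by field_simp, show 1 / 2 / m = 1 / (2 * m) by field_simp] at hd
    have e1 : a (n + 1) - a n
        = (Real.log (1 + α / (2 * m)) - Real.log (1 - α / (2 * m)) - 2 * (α / (2 * m)))
        - α * (Real.log (1 + 1 / (2 * m)) - Real.log (1 - 1 / (2 * m)) - 2 * (1 / (2 * m))) := by
      rw [hd]; field_simp; ring
    have h5 : |a (n + 1) - a n| ≤ K / ((n : ℝ) + 1) ^ 3 := by
      rw [e1]
      refine (abs_sub _ _).trans ?_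
      rw [abs_mul α]
      calc _ ≤ 4 * (|α| / (n + 1)) ^ 3 + |α| * (4 * (1 / (n + 1)) ^ 3) :=
            add_le_add (h1.trans (by gcongr)) (mul_le_mul_of_nonneg_left (h2.trans (by gcongr))
              (abs_nonneg _))
        _ = _ := by rw [hK]; field_simp
    refine h5.trans ?_
    have e2 : K / (n : ℝ) ^ 2 - K / ((n : ℝ) + 1) ^ 2 - K / ((n : ℝ) + 1) ^ 3
        = K * ((n : ℝ) ^ 2 + 3 * n + 1) / ((n : ℝ) ^ 2 * ((n : ℝ) + 1) ^ 3) := by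
      field_simp; ring
    have : 0 ≤ K * ((n : ℝ) ^ 2 + 3 * n + 1) / ((n : ℝ) ^ 2 * ((n : ℝ) + 1) ^ 3) := by positivity
    linarith
  have hlim : Tendsto a atTop (𝓝 0) := by
    have := (tendsto_gammaRatio hα).log one_ne_zero
    rwa [Real.log_one] at this
  have hK2 : Tendsto (fun n : ℕ => K / (n : ℝ) ^ 2) atTop (𝓝 0) :=
    tendsto_const_nhds.div_atTop ((tendsto_pow_atTop two_ne_zero).comp tendsto_natCast_atTop_atTop)
  obtain ⟨n₀, hn₀⟩ := exists_nat_ge (2 * |α| + 1)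
  have hbound : ∀ n ≥ n₀, |a n| ≤ K / (n : ℝ) ^ 2 := by
    intro n hn
    have hge : ∀ k ≥ n, 2 * |α| ≤ (k : ℝ) ∧ 1 ≤ k := fun k hk => by
      have h1 : (n₀ : ℝ) ≤ k := by exact_mod_cast hn.trans hk
      have h2 := abs_nonneg α
      exact ⟨by linarith, by exact_mod_cast (by linarith : (1 : ℝ) ≤ k)⟩
    have hmono : ∀ k ≥ n, |a k - a n| ≤ K / (n : ℝ) ^ 2 - K / (k : ℝ) ^ 2 := by
      intro k hk
      induction k, hk using Nat.le_induction with
      | base => simp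
      | succ k hk ih =>
        have h1 := hstep k (hge k hk).1 (hge k hk).2
        have h2 := abs_sub_le (a (k + 1)) (a k) (a n)
        push_cast
        linarith
    have h1 : Tendsto (fun k => |a k - a n|) atTop (𝓝 |0 - a n|) := (hlim.sub_const _).abs
    rw [zero_sub, abs_neg] at h1
    refine le_of_tendsto h1 ((eventually_ge_atTop n).mono fun k hk => (hmono k hk).trans ?_)
    have : 0 ≤ K / (k : ℝ) ^ 2 := by positivity
    linarith
  refine IsBigO.of_bound (2 * K) ?_
  have hK1 := hK2.eventually (ge_mem_nhds one_pos)
  filter_upwards [eventually_ge_atTop n₀, hK1] with n hn hn1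
  have h1 := hbound n hn
  have h2 := Real.abs_exp_sub_one_le (h1.trans hn1)
  rw [ha, Real.exp_log (gammaRatio_pos hα n)] at h2
  rw [Real.norm_eq_abs, Real.norm_eq_abs, abs_of_nonneg (by positivity : (0 : ℝ) ≤ 1 / (n : ℝ) ^ 2)]
  calc _ ≤ 2 * |a n| := h2
    _ ≤ 2 * (K / (n : ℝ) ^ 2) := by gcongr
    _ = _ := by ring

end GammaRatio

/-! ### Laguerre functions as regular solutions, and the LUE density -/

section Instances
open Set Topology Polynomial

/-- The Laguerre function `e^{-s²/(2L)} ℓ_n(s²/L) / ℓ_n(0)`, with `L = 4n+2α+2`. -/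
noncomputable def laguerreW (α : ℝ) (n : ℕ) (L s : ℝ) : ℝ :=
  Real.exp (-(s ^ 2 / L) / 2) * (laguerreMonic α n).eval (s ^ 2 / L) / (laguerreMonic α n).eval 0

/-- The derivative of `laguerreW` divided by `s`. -/
noncomputable def laguerreV (α : ℝ) (n : ℕ) (L s : ℝ) : ℝ :=
  2 / L * Real.exp (-(s ^ 2 / L) / 2) * ((derivative (laguerreMonic α n)).eval (s ^ 2 / L)
    - (laguerreMonic α n).eval (s ^ 2 / L) / 2) / (laguerreMonic α n).eval 0

theorem laguerreMonic_eval_zero_ne_zero {α : ℝ} (hα : -1 < α) (n : ℕ) :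
    (laguerreMonic α n).eval 0 ≠ 0 := by
  have hn : (0 : ℝ) ≤ n := n.cast_nonneg
  rw [laguerreMonic_eval_zero hα]
  have h1 : Real.Gamma (n + α + 1) ≠ 0 := (Real.Gamma_pos_of_pos (by linarith)).ne'
  have h2 : Real.Gamma (α + 1) ≠ 0 := (Real.Gamma_pos_of_pos (by linarith)).ne'
  positivity

/-- With x = s²/L, the factor e^(−x/2) turns Laguerre's equation into w'' + (2α+1)w'/s +
((4n+2α+2)/L − s²/L²) w = 0. The choice of L makes the constant coefficient equal to 1. -/
theorem isRegularSolution_laguerre {α : ℝ} (hα : -1 < α) (n : ℕ) :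
    IsRegularSolution α (4 * n + 2 * α + 2) (laguerreW α n (4 * n + 2 * α + 2))
      (laguerreV α n (4 * n + 2 * α + 2)) := by
  have hn : (0 : ℝ) ≤ n := n.cast_nonneg
  have h0 := laguerreMonic_eval_zero_ne_zero hα n
  obtain ⟨L, hL⟩ : ∃ L : ℝ, L = 4 * n + 2 * α + 2 := ⟨_, rfl⟩
  rw [← hL]
  have hL0 : 0 < L := by linarith
  have hx : ∀ s : ℝ, HasDerivAt (fun s : ℝ => s ^ 2 / L) (2 * s / L) s := fun s =>
    ((hasDerivAt_pow 2 s).div_const L).congr_deriv (by simp)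
  have he : ∀ s : ℝ, HasDerivAt (fun s : ℝ => Real.exp (-(s ^ 2 / L) / 2))
      (Real.exp (-(s ^ 2 / L) / 2) * (-(2 * s / L) / 2)) s := fun s =>
    ((hx s).fun_neg.div_const 2).exp
  have hp : ∀ (p : ℝ[X]) (s : ℝ), HasDerivAt (fun s : ℝ => p.eval (s ^ 2 / L))
      ((derivative p).eval (s ^ 2 / L) * (2 * s / L)) s := fun p s =>
    HasDerivAt.comp (h₂ := fun t => p.eval t) s (p.hasDerivAt _) (hx s)
  refine ⟨?_, ?_, fun s => ?_, fun s hs => ?_⟩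
  · simp [laguerreW, h0]
  · have : Continuous fun s : ℝ => s ^ 2 / L := by fun_prop
    have h1 := (laguerreMonic α n).continuous.comp this
    have h2 := (derivative (laguerreMonic α n)).continuous.comp this
    simp only [Function.comp_def] at h1 h2
    unfold laguerreV
    fun_prop
  · refine (((he s).fun_mul (hp (laguerreMonic α n) s)).div_const _).congr_deriv ?_
    rw [laguerreV]
    ring
  · have hv := (((he s).const_mul (2 / L)).fun_mul ((hp (derivative (laguerreMonic α n)) s).fun_sub
      ((hp (laguerreMonic α n) s).div_const 2))).div_const ((laguerreMonic α n).eval 0)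
    have hode := laguerreMonic_ode α n (s ^ 2 / L)
    refine ((hasDerivAt_id s).fun_mul hv).congr_deriv ?_
    simp only [laguerreV, laguerreW, id]
    generalize (derivative (derivative (laguerreMonic α n))).eval (s ^ 2 / L) = p₂ at hode ⊢
    generalize (derivative (laguerreMonic α n)).eval (s ^ 2 / L) = p₁ at hode ⊢
    generalize (laguerreMonic α n).eval (s ^ 2 / L) = p₀ at hode ⊢
    generalize (laguerreMonic α n).eval 0 = a at h0 ⊢
    generalize Real.exp (-(s ^ 2 / L) / 2) = e
    have hn' : (n : ℝ) = (L - 2 * α - 2) / 4 := by linarith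
    rw [hn'] at hode
    field_simp at hode ⊢
    linear_combination e * hode

theorem mul_eval_derivative_laguerreMonic {α : ℝ} (hα : -1 < α) (n : ℕ) {L s : ℝ} (hL : 0 < L) :
    s ^ 2 / L * (derivative (laguerreMonic α n)).eval (s ^ 2 / L)
      = (laguerreMonic α n).eval 0 * Real.exp (s ^ 2 / L / 2)
        * (s * (s * laguerreV α n L s) + s ^ 2 / L * laguerreW α n L s) / 2 ∧
    (laguerreMonic α n).eval (s ^ 2 / L)
      = (laguerreMonic α n).eval 0 * Real.exp (s ^ 2 / L / 2) * laguerreW α n L s := by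
  have h0 := laguerreMonic_eval_zero_ne_zero hα n
  have he : Real.exp (s ^ 2 / L / 2) * Real.exp (-(s ^ 2 / L) / 2) = 1 := by
    rw [← Real.exp_add]; simp; ring
  rw [laguerreV, laguerreW]
  generalize (derivative (laguerreMonic α n)).eval (s ^ 2 / L) = p₁
  generalize (laguerreMonic α n).eval (s ^ 2 / L) = p₀
  generalize (laguerreMonic α n).eval 0 = a at h0 ⊢
  generalize Real.exp (s ^ 2 / L / 2) = e at he ⊢
  generalize Real.exp (-(s ^ 2 / L) / 2) = e' at he ⊢
  constructor
  · field_simp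
    linear_combination (-2 * s ^ 2 * p₁) * he
  · field_simp
    linear_combination -p₀ * he

theorem sq_rpow_add_half {s α : ℝ} (hs : 0 < s) : (s ^ (α + 1 / 2)) ^ 2 = s ^ α * s ^ α * s := by
  rw [← Real.rpow_add hs, ← Real.rpow_add_one hs.ne', ← Real.rpow_natCast, ← Real.rpow_mul hs.le]
  congr 1; push_cast; ring

/-- The LUE density in terms of the quadratic form of a regular solution. -/
theorem lueDensity_eq_densityForm {α : ℝ} (hα : -1 < α) {N : ℕ} (hN : 0 < N) {x : ℝ} (hx : 0 < x)
    {L y : ℝ} (hL : L = 4 * N + 2 * α + 2) (hy : 0 < y) (hyx : L * y ^ 2 = 4 * N * x) :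
    besselAmplitude α ^ 2 * lueDensity α N x = 2 / (Real.pi * y) * gammaRatio α N *
      densityForm α 1 2 L (laguerreW α N L) (laguerreV α N L) (L * y) := by
  have hN0 : (0 : ℝ) < N := by exact_mod_cast hN
  have hL0 : 0 < L := by linarith
  have hs : 0 < L * y := by positivity
  have hxs : 4 * N * x = (L * y) ^ 2 / L := by rw [← hyx]; field_simp
  obtain ⟨h1, h2⟩ := mul_eval_derivative_laguerreMonic hα N (s := L * y) hL0
  have hk := laguerre_kernel hα N (4 * N * x)
  have hX : 0 < 4 * N * x := by positivity
  rw [lueDensity_eq_sum hα hN hx]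
  have h0 := laguerreMonic_eval_zero hα N
  have hh := laguerreNorm_pos hα N
  have hsum : (4 * N * x) ^ α * Real.exp (-(4 * N * x)) *
      ∑ k ∈ Finset.range N, (laguerreMonic α k).eval (4 * N * x) ^ 2 / laguerreNorm α k
      = (4 * N * x) ^ α * (laguerreMonic α N).eval 0 ^ 2 / (laguerreNorm α N) *
        ((L * y) ^ 2 * densityForm α 1 2 L (laguerreW α N L) (laguerreV α N L) (L * y)
          / ((L * y) ^ (α + 1 / 2)) ^ 2) / (4 * (4 * N * x)) := by
    have hz : 0 < (L * y) ^ (α + 1 / 2) := Real.rpow_pos_of_pos hs _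
    have hk' : ∑ k ∈ Finset.range N, (laguerreMonic α k).eval (4 * N * x) ^ 2 / laguerreNorm α k
      = (((4 * N * x) * (derivative (laguerreMonic α N)).eval (4 * N * x)) ^ 2
        - ((4 * N * x) - α) * (laguerreMonic α N).eval (4 * N * x) *
          ((4 * N * x) * (derivative (laguerreMonic α N)).eval (4 * N * x))
        + N * (4 * N * x) * (laguerreMonic α N).eval (4 * N * x) ^ 2) / laguerreNorm α N / (4 * N * x) := by
      rw [← hk]; field_simp
    have hexp : Real.exp (-((L * y) ^ 2 / L)) * Real.exp ((L * y) ^ 2 / L / 2) ^ 2 = 1 := by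
      rw [← Real.exp_nat_mul, ← Real.exp_add]; simp; ring
    rw [hk', hxs, h1, h2, densityForm]
    generalize (L * y) ^ (α + 1 / 2) = z at hz ⊢
    generalize laguerreW α N L (L * y) = w
    generalize laguerreV α N L (L * y) = v
    generalize Real.exp ((L * y) ^ 2 / L / 2) = e at hexp ⊢
    generalize Real.exp (-((L * y) ^ 2 / L)) = e' at hexp ⊢
    generalize ((L * y) ^ 2 / L) ^ α = xa
    generalize (laguerreMonic α N).eval 0 = a
    generalize laguerreNorm α N = h at hh ⊢
    have hN' : (N : ℝ) = (L - 2 * α - 2) / 4 := by linarith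
    rw [hN']
    field_simp
    linear_combination (xa * a ^ 2 * L * y ^ 2 * 4 *
      ((L * v + w) * (L * y ^ 2 * (L * v + w) - w * 2 * (L * y ^ 2 - α)) * 4
        + w ^ 2 * 2 ^ 2 * (L - 2 * α - 2))) * hexp
  -- Since N + (α+1)/2 = L/4, the power in `gammaRatio` cancels all the powers with exponent α
  -- exactly.
  have hkey : (2 ^ (α + 1 / 2)) ^ 2 * (4 * N * x) ^ α * L * y * ((N : ℝ) + (α + 1) / 2) ^ α
      = 2 * ((L * y) ^ (α + 1 / 2)) ^ 2 := by
    rw [sq_rpow_add_half two_pos, sq_rpow_add_half hs, ← hyx,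
      show (N : ℝ) + (α + 1) / 2 = L / 4 by linarith, Real.mul_rpow hL0.le (by positivity),
      Real.div_rpow hL0.le (by norm_num), Real.mul_rpow hL0.le hy.le, pow_two y,
      Real.mul_rpow hy.le hy.le, show (4 : ℝ) = 2 * 2 by norm_num, Real.mul_rpow two_pos.le two_pos.le]
    have : (0 : ℝ) < 2 ^ α := Real.rpow_pos_of_pos two_pos _
    field_simp
  have hΓ : 0 < Real.Gamma (α + 1) := Real.Gamma_pos_of_pos (by linarith)
  have hΓN : 0 < Real.Gamma (N + α + 1) := Real.Gamma_pos_of_pos (by linarith)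
  have hz : 0 < (L * y) ^ (α + 1 / 2) := Real.rpow_pos_of_pos hs _
  have hM : 0 < ((N : ℝ) + (α + 1) / 2) ^ α := Real.rpow_pos_of_pos (by linarith) _
  have hfac : (0 : ℝ) < N.factorial := by exact_mod_cast N.factorial_pos
  have hpi := Real.pi_pos
  have hsign : ((-1 : ℝ) ^ N) ^ 2 = 1 := by rw [← pow_mul, mul_comm, pow_mul]; simp
  rw [hsum, h0, besselAmplitude, gammaRatio, laguerreNorm]
  generalize densityForm α 1 2 L (laguerreW α N L) (laguerreV α N L) (L * y) = D
  rw [show (2 ^ (α + 1 / 2) * Real.Gamma (α + 1) / √Real.pi) ^ 2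
    = (2 ^ (α + 1 / 2)) ^ 2 * Real.Gamma (α + 1) ^ 2 / Real.pi by
      rw [div_pow, mul_pow, Real.sq_sqrt hpi.le],
    show ((-1) ^ N * (Real.Gamma (N + α + 1) / Real.Gamma (α + 1))) ^ 2
      = Real.Gamma (N + α + 1) ^ 2 / Real.Gamma (α + 1) ^ 2 by
      rw [mul_pow, hsign, one_mul, div_pow]]
  have hx' : 4 * N * x = L * y ^ 2 := hyx.symm
  generalize (4 * N * x) ^ α = xa at hkey ⊢
  rw [hx']
  generalize ((2 : ℝ) ^ (α + 1 / 2)) ^ 2 = t at hkey ⊢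
  generalize (L * y) ^ (α + 1 / 2) = z at hkey hz ⊢
  generalize ((N : ℝ) + (α + 1) / 2) ^ α = m at hkey hM ⊢
  field_simp
  linear_combination D * hkey

end Instances

/-! ### Hermite polynomials as Laguerre polynomials, and the GUE density -/

section HermiteInstance
open Set Topology Polynomial

/-- This relation and the next move between the parameters α and α + 1. With α = −1/2 they are the
passages from even to odd and from odd to even Hermite degree. -/
theorem laguerreMonic_add_one (α : ℝ) (n : ℕ) :
    laguerreMonic (α + 1) n = laguerreMonic α n - derivative (laguerreMonic α n) := by
  induction n with
  | zero => simp [laguerreMonic]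
  | succ n ih =>
    obtain ⟨hode, hd⟩ := laguerreMonic_ode_and_derivative α n
    rw [hd, laguerreMonic, ih, laguerreMonic]
    simp only [derivative_sub, C_add, C_1] at hode ⊢
    linear_combination hode

theorem laguerreMonic_succ_eq (α : ℝ) (n : ℕ) :
    laguerreMonic α (n + 1) = (X - C (α + 1)) * laguerreMonic (α + 1) n
      - X * derivative (laguerreMonic (α + 1) n) := by
  have hode := (laguerreMonic_ode_and_derivative α n).1
  rw [laguerreMonic_add_one, laguerreMonic]
  simp only [derivative_sub, C_add, C_1] at hode ⊢
  linear_combination -hode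

/-- Hermite polynomials are Laguerre polynomials with parameter `∓1/2` in `x²`. -/
theorem hermiteMonic_eq_laguerreMonic_comp (m : ℕ) :
    hermiteMonic (2 * m) = (laguerreMonic (-1 / 2) m).comp (X ^ 2) ∧
    hermiteMonic (2 * m + 1) = X * (laguerreMonic (1 / 2) m).comp (X ^ 2) := by
  have hC : (C (1 / 2 : ℝ) : ℝ[X]) * C ((2 : ℕ) : ℝ) = 1 := by
    rw [← C_mul]; norm_num
  have hodd : ∀ m, hermiteMonic (2 * m) = (laguerreMonic (-1 / 2) m).comp (X ^ 2) →
      hermiteMonic (2 * m + 1) = X * (laguerreMonic (1 / 2) m).comp (X ^ 2) := by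
    intro m h
    have h1 := laguerreMonic_add_one (-1 / 2) m
    rw [show (-1 / 2 + 1 : ℝ) = 1 / 2 by norm_num] at h1
    rw [hermiteMonic, h, h1]
    simp only [derivative_comp, sub_comp, derivative_X_pow, show 2 - 1 = 1 from rfl, pow_one]
    linear_combination (-X * (derivative (laguerreMonic (-1 / 2) m)).comp (X ^ 2)) * hC
  induction m with
  | zero => exact ⟨by simp [hermiteMonic, laguerreMonic], hodd 0 (by simp [hermiteMonic, laguerreMonic])⟩
  | succ m ih =>
    have h : hermiteMonic (2 * (m + 1)) = (laguerreMonic (-1 / 2) (m + 1)).comp (X ^ 2) := by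
      rw [show 2 * (m + 1) = (2 * m + 1) + 1 by ring, hermiteMonic, ih.2, laguerreMonic_succ_eq,
        show (-1 / 2 + 1 : ℝ) = 1 / 2 by norm_num]
      simp only [derivative_mul, derivative_comp, sub_comp, mul_comp, X_comp, C_comp,
        derivative_X_pow, derivative_X, show 2 - 1 = 1 from rfl, pow_one]
      linear_combination (-X ^ 2 * (derivative (laguerreMonic (1 / 2) m)).comp (X ^ 2)) * hC
    exact ⟨h, hodd _ h⟩

theorem hermiteNorm_two_mul (m : ℕ) :
    hermiteNorm (2 * m) = m.factorial * Real.Gamma (m + 1 / 2) ∧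
    hermiteNorm (2 * m + 1) = m.factorial * Real.Gamma (m + 3 / 2) := by
  have h : hermiteNorm (2 * m) = m.factorial * Real.Gamma (m + 1 / 2) := by
    induction m with
    | zero =>
      have := Real.Gamma_one_half_eq
      simp [hermiteNorm, ← this]
    | succ m ih =>
      rw [show 2 * (m + 1) = 2 * m + 1 + 1 by ring, hermiteNorm_succ, hermiteNorm_succ, ih,
        Nat.factorial_succ, show ((m + 1 : ℕ) : ℝ) + 1 / 2 = (m + 1 / 2) + 1 by push_cast; ring,
        Real.Gamma_add_one (by positivity)]
      push_cast; ring
  refine ⟨h, ?_⟩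
  rw [hermiteNorm_succ, h, show (m : ℝ) + 3 / 2 = (m + 1 / 2) + 1 by ring,
    Real.Gamma_add_one (by positivity)]
  push_cast; ring

theorem besselAmplitude_neg_half : besselAmplitude (-1 / 2) = 1 := by
  rw [besselAmplitude, show (-1 / 2 + 1 / 2 : ℝ) = 0 by norm_num, show (-1 / 2 + 1 : ℝ) = 1 / 2 by norm_num,
    Real.Gamma_one_half_eq, Real.rpow_zero, one_mul, div_self]
  exact (Real.sqrt_pos.mpr Real.pi_pos).ne'

theorem Gamma_three_halves : Real.Gamma (3 / 2) = √Real.pi / 2 := by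
  rw [show (3 / 2 : ℝ) = 1 / 2 + 1 by norm_num, Real.Gamma_add_one (by norm_num),
    Real.Gamma_one_half_eq]
  ring

theorem besselAmplitude_half : besselAmplitude (1 / 2) = 1 := by
  have := (Real.sqrt_pos.mpr Real.pi_pos).ne'
  rw [besselAmplitude, show (1 / 2 + 1 / 2 : ℝ) = 1 by norm_num, show (1 / 2 + 1 : ℝ) = 3 / 2 by norm_num,
    Gamma_three_halves, Real.rpow_one]
  field_simp

theorem sq_laguerreMonic_eval_zero_div_hermiteNorm (m : ℕ) {L : ℝ} :
    (L = 4 * m + 1 → (laguerreMonic (-1 / 2) m).eval 0 ^ 2 / hermiteNorm (2 * m)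
      = 2 / (Real.pi * √L) * gammaRatio (-1 / 2) m) ∧
    (L = 4 * m + 3 → (laguerreMonic (1 / 2) m).eval 0 ^ 2 / hermiteNorm (2 * m + 1)
      = 2 * √L / Real.pi * gammaRatio (1 / 2) m) := by
  have hm : (0 : ℝ) ≤ m := m.cast_nonneg
  have hpi := Real.pi_pos
  have hspi : √Real.pi ^ 2 = Real.pi := Real.sq_sqrt hpi.le
  have hspi0 : 0 < √Real.pi := Real.sqrt_pos.mpr hpi
  have hfac : (0 : ℝ) < m.factorial := by exact_mod_cast m.factorial_pos
  have hsign : ((-1 : ℝ) ^ m) ^ 2 = 1 := by rw [← pow_mul, mul_comm, pow_mul]; simp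
  have h4 : √(4 : ℝ) = 2 := by rw [show (4 : ℝ) = 2 ^ 2 by norm_num]; exact Real.sqrt_sq two_pos.le
  constructor
  · intro hL
    have hL0 : 0 < √L := Real.sqrt_pos.mpr (by linarith)
    have hΓ : 0 < Real.Gamma (m + 1 / 2) := Real.Gamma_pos_of_pos (by linarith)
    have hr : ((m : ℝ) + (-1 / 2 + 1) / 2) ^ (-1 / 2 : ℝ) = 2 / √L := by
      rw [show (m : ℝ) + (-1 / 2 + 1) / 2 = L / 4 by linarith, show (-1 / 2 : ℝ) = -(1 / 2) by norm_num,
        Real.rpow_neg (by linarith), ← Real.sqrt_eq_rpow, Real.sqrt_div (by linarith), h4, inv_div]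
    rw [laguerreMonic_eval_zero (by norm_num), (hermiteNorm_two_mul m).1, gammaRatio, hr, mul_pow, hsign,
      show (m : ℝ) + -1 / 2 + 1 = m + 1 / 2 by ring, show (-1 / 2 + 1 : ℝ) = 1 / 2 by norm_num,
      Real.Gamma_one_half_eq, div_pow, hspi]
    field_simp
  · intro hL
    have hL0 : 0 < √L := Real.sqrt_pos.mpr (by linarith)
    have hΓ : 0 < Real.Gamma (m + 3 / 2) := Real.Gamma_pos_of_pos (by linarith)
    have hr : ((m : ℝ) + (1 / 2 + 1) / 2) ^ (1 / 2 : ℝ) = √L / 2 := by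
      rw [show (m : ℝ) + (1 / 2 + 1) / 2 = L / 4 by linarith,
        ← Real.sqrt_eq_rpow, Real.sqrt_div (by linarith), h4]
    rw [laguerreMonic_eval_zero (by norm_num), (hermiteNorm_two_mul m).2, gammaRatio, hr, mul_pow, hsign,
      show (m : ℝ) + 1 / 2 + 1 = m + 3 / 2 by ring, show (1 / 2 + 1 : ℝ) = 3 / 2 by norm_num,
      Gamma_three_halves, div_pow, div_pow, hspi]
    field_simp

/-- Differentiating in t = √x instead of x gives the Hermite kernel a factor 2t against the Laguerre
derivative; cancelling t requires t > 0, so the origin is left to `gueDensity_zero`. -/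
theorem gueDensity_even_eq {m : ℕ} (hm : 0 < m) {x t L : ℝ} (hL : L = 4 * m + 1)
    (ht : t = √(2 * (2 * m : ℕ)) * x) (ht0 : 0 < t) :
    gueDensity (2 * m) x = √(2 * (2 * m : ℕ)) / (2 * m : ℕ) * (√L / Real.pi) * gammaRatio (-1 / 2) m *
      densityForm (-1 / 2) 0 1 L (laguerreW (-1 / 2) m L) (laguerreV (-1 / 2) m L) (√L * t) := by
  have hm0 : (0 : ℝ) < m := by exact_mod_cast hm
  have hL0 : 0 < L := by linarith
  have hsL : 0 < √L := Real.sqrt_pos.mpr hL0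
  have hsL2 : √L ^ 2 = L := Real.sq_sqrt hL0.le
  have hsx : (√L * t) ^ 2 / L = t ^ 2 := by rw [mul_pow, hsL2]; field_simp
  obtain ⟨h1, h2⟩ := mul_eval_derivative_laguerreMonic (α := -1 / 2) (by norm_num) m (s := √L * t) hL0
  rw [hsx] at h1 h2
  have h3 := (sq_laguerreMonic_eval_zero_div_hermiteNorm m).1 hL
  have hh := hermiteNorm_pos (2 * m)
  rw [gueDensity_eq_sum (by omega), hermite_kernel, ← ht, (hermiteMonic_eq_laguerreMonic_comp m).1]
  simp only [derivative_comp, derivative_X_pow, eval_mul, eval_comp, eval_pow, eval_X, eval_C]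
  have hexp : Real.exp (-t ^ 2) * Real.exp (t ^ 2 / 2) ^ 2 = 1 := by
    rw [← Real.exp_nat_mul, ← Real.exp_add]; simp; ring
  rw [densityForm, show (-1 / 2 + 1 / 2 : ℝ) = 0 by norm_num, Real.rpow_zero]
  have e1 : (√L * t / L) ^ 2 = t ^ 2 / L := by rw [← hsx]; ring
  rw [e1]
  set A := (laguerreMonic (-1 / 2) m).eval 0
  generalize laguerreW (-1 / 2) m L (√L * t) = w at h1 h2 ⊢
  generalize laguerreV (-1 / 2) m L (√L * t) = v at h1 h2 ⊢
  generalize Real.exp (t ^ 2 / 2) = e at hexp h1 h2 ⊢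
  generalize Real.exp (-t ^ 2) = e' at hexp ⊢
  generalize (laguerreMonic (-1 / 2) m).eval (t ^ 2) = p₀ at h2 ⊢
  generalize (derivative (laguerreMonic (-1 / 2) m)).eval (t ^ 2) = p₁ at h1 ⊢
  have hp1 : 2 * t * p₁ = A * e * (√L * (√L * t * v) + t * w) := by
    have : t * (2 * t * p₁) = t * (A * e * (√L * (√L * t * v) + t * w)) := by linear_combination 2 * h1
    exact mul_left_cancel₀ ht0.ne' this
  have hsum : e' * (((((2 : ℕ) : ℝ) * t ^ (2 - 1) * p₁) ^ 2 / 2 - t * p₀ * (((2 : ℕ) : ℝ) * t ^ (2 - 1) * p₁)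
      + (2 * m : ℕ) * p₀ ^ 2) / hermiteNorm (2 * m)) = A ^ 2 / hermiteNorm (2 * m) *
        (L / 2 * ((√L * t * v) ^ 2 + (1 - t ^ 2 / L - 1 / L) * w ^ 2)) := by
    have hm' : (m : ℝ) = (L - 1) / 4 := by linarith
    have e2 : ((2 : ℕ) : ℝ) * t ^ (2 - 1) * p₁ = A * e * (√L * (√L * t * v) + t * w) := by
      rw [← hp1]; norm_num
    rw [e2, h2]
    push_cast
    rw [hm']
    generalize √L = r at hsL hsL2 ⊢
    rw [← hsL2]
    field_simp
    linear_combination (4 * A ^ 2 * (r ^ 2 * (r * t * v) ^ 2 + (r ^ 2 - 1 - t ^ 2) * w ^ 2)) * hexp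
  rw [hsum, h3]
  field_simp
  rw [hsL2]
  ring

theorem gueDensity_odd_eq (m : ℕ) {x t L : ℝ} (hL : L = 4 * m + 3)
    (ht : t = √(2 * (2 * m + 1 : ℕ)) * x) (ht0 : 0 < t) :
    gueDensity (2 * m + 1) x = √(2 * (2 * m + 1 : ℕ)) / (2 * m + 1 : ℕ) * (√L / Real.pi)
      * gammaRatio (1 / 2) m *
      densityForm (1 / 2) 0 1 L (laguerreW (1 / 2) m L) (laguerreV (1 / 2) m L) (√L * t) := by
  have hm0 : (0 : ℝ) ≤ m := m.cast_nonneg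
  have hL0 : 0 < L := by linarith
  have hsL : 0 < √L := Real.sqrt_pos.mpr hL0
  have hsL2 : √L ^ 2 = L := Real.sq_sqrt hL0.le
  have hsx : (√L * t) ^ 2 / L = t ^ 2 := by rw [mul_pow, hsL2]; field_simp
  obtain ⟨h1, h2⟩ := mul_eval_derivative_laguerreMonic (α := 1 / 2) (by norm_num) m (s := √L * t) hL0
  rw [hsx] at h1 h2
  have h3 := (sq_laguerreMonic_eval_zero_div_hermiteNorm m).2 hL
  have hh := hermiteNorm_pos (2 * m + 1)
  rw [gueDensity_eq_sum (by omega), hermite_kernel, ← ht, (hermiteMonic_eq_laguerreMonic_comp m).2]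
  simp only [derivative_mul, derivative_X, derivative_comp, derivative_X_pow, eval_add, eval_mul,
    eval_comp, eval_pow, eval_X, eval_C, eval_one]
  have hexp : Real.exp (-t ^ 2) * Real.exp (t ^ 2 / 2) ^ 2 = 1 := by
    rw [← Real.exp_nat_mul, ← Real.exp_add]; simp; ring
  rw [densityForm, show (1 / 2 + 1 / 2 : ℝ) = 1 by norm_num, Real.rpow_one]
  have e1 : (√L * t / L) ^ 2 = t ^ 2 / L := by rw [← hsx]; ring
  rw [e1]
  set A := (laguerreMonic (1 / 2) m).eval 0
  generalize laguerreW (1 / 2) m L (√L * t) = w at h1 h2 ⊢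
  generalize laguerreV (1 / 2) m L (√L * t) = v at h1 h2 ⊢
  generalize Real.exp (t ^ 2 / 2) = e at hexp h1 h2 ⊢
  generalize Real.exp (-t ^ 2) = e' at hexp ⊢
  generalize (laguerreMonic (1 / 2) m).eval (t ^ 2) = p₀ at h2 ⊢
  generalize (derivative (laguerreMonic (1 / 2) m)).eval (t ^ 2) = p₁ at h1 ⊢
  have hsum : e' * (((1 * p₀ + t * (((2 : ℕ) : ℝ) * t ^ (2 - 1) * p₁)) ^ 2 / 2
      - t * (t * p₀) * (1 * p₀ + t * (((2 : ℕ) : ℝ) * t ^ (2 - 1) * p₁))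
      + (2 * m + 1 : ℕ) * (t * p₀) ^ 2) / hermiteNorm (2 * m + 1)) = A ^ 2 / hermiteNorm (2 * m + 1) *
        (1 / 2 * ((√L * t) ^ 2 * ((√L * t * v + 1 / (√L * t) * w) ^ 2
          + (1 - t ^ 2 / L - 1 / L) * w ^ 2))) := by
    have hm' : (m : ℝ) = (L - 3) / 4 := by linarith
    have e2 : 1 * p₀ + t * (((2 : ℕ) : ℝ) * t ^ (2 - 1) * p₁)
        = A * e * (w + √L * t * (√L * t * v) + t ^ 2 * w) := by
      norm_num
      rw [h2]
      linear_combination 2 * h1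
    rw [e2, h2]
    push_cast
    rw [hm']
    generalize √L = r at hsL hsL2 ⊢
    rw [← hsL2]
    field_simp
    linear_combination (4 * A ^ 2 * ((w + r * t * (r * t * v)) ^ 2 + (r ^ 2 - 1 - t ^ 2) * t ^ 2 * w ^ 2)) * hexp
  rw [hsum, h3]
  field_simp
  ring

/-- At the origin only one term of the Hermite kernel survives: the value in even degree, the
derivative in odd degree. -/
theorem gueDensity_zero (m : ℕ) :
    (0 < m → gueDensity (2 * m) 0
      = √(2 * (2 * m : ℕ)) * (2 / (Real.pi * √(4 * m + 1)) * gammaRatio (-1 / 2) m)) ∧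
    gueDensity (2 * m + 1) 0 = √(2 * (2 * m + 1 : ℕ)) / (2 * m + 1 : ℕ) *
      (√(4 * m + 3) / Real.pi * gammaRatio (1 / 2) m) := by
  constructor
  · intro hm
    have hm0 : (0 : ℝ) < m := by exact_mod_cast hm
    rw [gueDensity_eq_sum (by omega), hermite_kernel, mul_zero, (hermiteMonic_eq_laguerreMonic_comp m).1]
    have h3 := (sq_laguerreMonic_eval_zero_div_hermiteNorm m).1 rfl
    rw [← h3]
    simp [derivative_comp]
    field_simp
  · rw [gueDensity_eq_sum (by omega), hermite_kernel, mul_zero, (hermiteMonic_eq_laguerreMonic_comp m).2]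
    have h3 := (sq_laguerreMonic_eval_zero_div_hermiteNorm m).2 rfl
    have h4 : √(4 * (m : ℝ) + 3) / Real.pi * gammaRatio (1 / 2) m
      = (laguerreMonic (1 / 2) m).eval 0 ^ 2 / hermiteNorm (2 * m + 1) / 2 := by rw [h3]; ring
    rw [h4]
    simp [derivative_comp]
    left; ring

end HermiteInstance

/-! ### Expansions in the shift δ = d/N of the scaled point -/

section Expansions
open Set Topology

/-- The mean value inequality applied to f − t f₁(0), whose derivative is O(t); a second derivative
is needed at 0 only. -/
theorem isBigO_sub_sub_of_hasDerivAt {f f₁ : ℝ → ℝ} {f₂ : ℝ}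
    (h : ∀ᶠ δ in 𝓝 0, HasDerivAt f (f₁ δ) δ) (h₁ : HasDerivAt f₁ f₂ 0) :
    (fun δ => f δ - f 0 - δ * f₁ 0) =O[𝓝 0] fun δ => δ ^ 2 := by
  obtain ⟨C, hC⟩ := h₁.isBigO_sub.bound
  obtain ⟨ε, hε, hball⟩ := Metric.eventually_nhds_iff.mp (h.and hC)
  refine IsBigO.of_bound C ?_
  filter_upwards [Metric.ball_mem_nhds (0 : ℝ) hε] with δ hδ
  have hδ' : |δ| < ε := by simpa using hδ
  have hs : ∀ t ∈ Icc (-|δ|) |δ|, |t| ≤ |δ| := fun t ht => abs_le.mpr ht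
  have hb : ∀ t ∈ Icc (-|δ|) |δ|, HasDerivAt f (f₁ t) t ∧ |f₁ t - f₁ 0| ≤ C * |t| := fun t ht => by
    have := hball (y := t) (by rw [Real.dist_eq, sub_zero]; exact (hs t ht).trans_lt hδ')
    simpa using this
  have hC0 : δ ≠ 0 → 0 ≤ C := fun h0 => by
    have h3 := (abs_nonneg _).trans (hb δ (abs_le.mp le_rfl)).2
    exact nonneg_of_mul_nonneg_left h3 (abs_pos.mpr h0)
  by_cases h0 : δ = 0
  · simp [h0]
  have key := (convex_Icc (-|δ|) |δ|).norm_image_sub_le_of_norm_hasDerivWithin_le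
    (f := fun t => f t - t * f₁ 0) (f' := fun t => f₁ t - 1 * f₁ 0) (C := C * |δ|) (x := 0) (y := δ)
    (fun t ht => ((hb t ht).1.fun_sub ((hasDerivAt_id t).mul_const _)).hasDerivWithinAt)
    (fun t ht => by
      rw [one_mul, Real.norm_eq_abs]
      exact (hb t ht).2.trans (mul_le_mul_of_nonneg_left (hs t ht) (hC0 h0)))
    (by simp) (abs_le.mp le_rfl)
  simp only [zero_mul, sub_zero, Real.norm_eq_abs] at key ⊢
  rw [abs_pow, show f δ - f 0 - δ * f₁ 0 = f δ - δ * f₁ 0 - f 0 by ring]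
  linarith

theorem hasDerivAt_sqrt_div {X δ : ℝ} (hX : 0 < X) (hδ : -1 < δ) :
    HasDerivAt (fun δ => √(X / (1 + δ))) (-√(X / (1 + δ)) / (2 * (1 + δ))) δ := by
  have h1 : 0 < 1 + δ := by linarith
  have h2 : 0 < X / (1 + δ) := by positivity
  have h3 : HasDerivAt (fun δ : ℝ => X / (1 + δ)) (-X / (1 + δ) ^ 2) δ := by
    refine ((hasDerivAt_const δ X).fun_div ((hasDerivAt_id δ).const_add 1) h1.ne').congr_deriv ?_
    simp
  refine (h3.sqrt h2.ne').congr_deriv ?_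
  have h4 : √(X / (1 + δ)) ≠ 0 := (Real.sqrt_pos.mpr h2).ne'
  have h5 : √(X / (1 + δ)) ^ 2 = X / (1 + δ) := Real.sq_sqrt h2.le
  have h6 : X = √(X / (1 + δ)) ^ 2 * (1 + δ) := by rw [h5]; field_simp
  generalize √(X / (1 + δ)) = Y at h4 h6 ⊢
  rw [h6]
  field_simp

theorem sqrt_div_lt_one {X δ : ℝ} (hX : 0 < X) (hδ : X < 1 + δ) :
    0 < √(X / (1 + δ)) ∧ √(X / (1 + δ)) < 1 := by
  have h1 : 0 < 1 + δ := by linarith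
  refine ⟨Real.sqrt_pos.mpr (by positivity), ?_⟩
  rw [Real.sqrt_lt' one_pos, div_lt_iff₀ h1]
  linarith

theorem eventually_lt_one_add {X : ℝ} (hX1 : X < 1) : ∀ᶠ δ : ℝ in 𝓝 0, X < 1 + δ :=
  (continuous_const.add continuous_id).continuousAt.eventually (lt_mem_nhds (by simpa using hX1))

theorem sqrt_ratio_isBigO {X : ℝ} (hX : 0 < X) (hX1 : X < 1) :
    (fun δ : ℝ => √((1 + δ) / X - 1) - √(1 / X - 1) - δ * (1 / (2 * X * √(1 / X - 1))))
      =O[𝓝 0] fun δ => δ ^ 2 := by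
  have hpos : ∀ δ : ℝ, X < 1 + δ → 0 < (1 + δ) / X - 1 := fun δ hδ => by
    rw [sub_pos, lt_div_iff₀ hX]; linarith
  have hd : ∀ δ : ℝ, X < 1 + δ → HasDerivAt (fun δ : ℝ => √((1 + δ) / X - 1))
      (1 / (2 * X * √((1 + δ) / X - 1))) δ := fun δ hδ => by
    have h1 : HasDerivAt (fun δ : ℝ => (1 + δ) / X - 1) (1 / X) δ :=
      (((hasDerivAt_id δ).const_add 1).div_const X).sub_const 1
    refine (h1.sqrt (hpos δ hδ).ne').congr_deriv ?_
    have := (Real.sqrt_pos.mpr (hpos δ hδ)).ne'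
    field_simp
  have h0 : X < 1 + 0 := by simpa using hX1
  have h2 := (hasDerivAt_const (0 : ℝ) (1 : ℝ)).fun_div ((hd 0 h0).const_mul (2 * X))
    (mul_ne_zero (by positivity) (Real.sqrt_pos.mpr (hpos 0 h0)).ne')
  have := isBigO_sub_sub_of_hasDerivAt ((eventually_lt_one_add hX1).mono hd) h2
  simpa using this

/-- With Y = √(X/(1+δ)), the derivative of (1+δ) g(Y) is g(Y) − Y√(1−Y²)/2 = arcsin(Y)/2, so the
first-order term of the phase is an arcsine. -/
theorem phase_isBigO {X : ℝ} (hX : 0 < X) (hX1 : X < 1) :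
    (fun δ : ℝ => (1 + δ) * bulkPhase √(X / (1 + δ)) - bulkPhase √X - δ * (Real.arcsin √X / 2))
      =O[𝓝 0] fun δ => δ ^ 2 := by
  have hd : ∀ δ : ℝ, X < 1 + δ → HasDerivAt (fun δ : ℝ => (1 + δ) * bulkPhase √(X / (1 + δ)))
      (Real.arcsin √(X / (1 + δ)) / 2) δ := fun δ hδ => by
    obtain ⟨hY0, hY1⟩ := sqrt_div_lt_one hX hδ
    have hδ1 : 1 + δ ≠ 0 := by linarith
    have h1 := HasDerivAt.comp (h₂ := bulkPhase) δ
      (hasDerivAt_bulkPhase (by rwa [abs_of_pos hY0])) (hasDerivAt_sqrt_div hX (by linarith))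
    refine (((hasDerivAt_id δ).const_add 1).fun_mul h1).congr_deriv ?_
    simp only [id, bulkPhase, Function.comp_apply]
    field_simp
    ring
  have h0 : X < 1 + 0 := by simpa using hX1
  obtain ⟨hY0, hY1⟩ := sqrt_div_lt_one hX h0
  have h2 := (HasDerivAt.comp (h₂ := Real.arcsin) (0 : ℝ)
    (Real.hasDerivAt_arcsin (by linarith) hY1.ne) (hasDerivAt_sqrt_div hX (by linarith))).div_const 2
  have := isBigO_sub_sub_of_hasDerivAt ((eventually_lt_one_add hX1).mono hd) h2
  simpa using this

theorem arcsin_isBigO {X : ℝ} (hX : 0 < X) (hX1 : X < 1) :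
    (fun δ : ℝ => Real.arcsin √(X / (1 + δ)) - Real.arcsin √X) =O[𝓝 0] fun δ => δ := by
  obtain ⟨hY0, hY1⟩ := sqrt_div_lt_one hX (δ := 0) (by simpa using hX1)
  have h2 := (HasDerivAt.comp (h₂ := Real.arcsin) (0 : ℝ)
    (Real.hasDerivAt_arcsin (by linarith) hY1.ne) (hasDerivAt_sqrt_div hX (by linarith)))
  simpa using h2.isBigO_sub

theorem inv_sqrt_mul_isBigO {X : ℝ} (hX : 0 < X) (hX1 : X < 1) :
    (fun δ : ℝ => 1 / (√(X / (1 + δ)) * √(1 - √(X / (1 + δ)) ^ 2)) - 1 / (√X * √(1 - X)))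
      =O[𝓝 0] (fun δ => δ) ∧
    (fun δ : ℝ => 1 / (2 * √(X / (1 + δ)) ^ 2 * √(1 - √(X / (1 + δ)) ^ 2) ^ 2) - 1 / (2 * X * (1 - X)))
      =O[𝓝 0] (fun δ => δ) ∧
    (fun δ : ℝ => 1 / √(1 - √(X / (1 + δ)) ^ 2) - 1 / √(1 - X)) =O[𝓝 0] (fun δ => δ) ∧
    (fun δ : ℝ => 1 / (2 * √(1 - √(X / (1 + δ)) ^ 2) ^ 2) - 1 / (2 * (1 - X))) =O[𝓝 0] (fun δ => δ) := by
  obtain ⟨hY0, hY1⟩ := sqrt_div_lt_one hX (δ := 0) (by simpa using hX1)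
  have hdY := (hasDerivAt_sqrt_div hX (δ := 0) (by linarith)).differentiableAt
  have hc2 : 0 < 1 - √(X / (1 + 0)) ^ 2 := by nlinarith
  have hdC : DifferentiableAt ℝ (fun δ : ℝ => √(1 - √(X / (1 + δ)) ^ 2)) 0 :=
    ((hdY.pow 2).const_sub 1).sqrt hc2.ne'
  have hc := Real.sqrt_pos.mpr hc2
  have hX2 : √X ^ 2 = X := Real.sq_sqrt hX.le
  have hX3 : √(1 - X) ^ 2 = 1 - X := Real.sq_sqrt (by linarith)
  refine ⟨?_, ?_, ?_, ?_⟩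
  · have := ((differentiableAt_const (1 : ℝ)).fun_div (hdY.fun_mul hdC) (by positivity)).isBigO_sub
    simpa [hX2] using this
  · have := ((differentiableAt_const (1 : ℝ)).fun_div (((hdY.fun_pow 2).const_mul 2).fun_mul (hdC.fun_pow 2))
      (by positivity)).isBigO_sub
    simpa [hX2, hX3] using this
  · have := ((differentiableAt_const (1 : ℝ)).fun_div hdC (by positivity)).isBigO_sub
    simpa [hX2] using this
  · have := ((differentiableAt_const (1 : ℝ)).fun_div ((hdC.fun_pow 2).const_mul 2)
      (by positivity)).isBigO_sub
    simpa [hX2, hX3] using this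

theorem isBigO_const_div (d : ℝ) :
    Tendsto (fun N : ℕ => d / (N : ℝ)) atTop (𝓝 0) ∧
    (fun N : ℕ => d / (N : ℝ)) =O[atTop] (fun N : ℕ => 1 / (N : ℝ)) ∧
    (fun N : ℕ => (d / (N : ℝ)) ^ 2) =O[atTop] (fun N : ℕ => 1 / (N : ℝ) ^ 2) := by
  have h : (fun N : ℕ => d / (N : ℝ)) =O[atTop] (fun N : ℕ => 1 / (N : ℝ)) := by
    have := (isBigO_refl (fun N : ℕ => 1 / (N : ℝ)) atTop).const_mul_left d
    simpa [div_eq_mul_inv] using this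
  refine ⟨tendsto_const_div_atTop_nhds_zero_nat d, h, ?_⟩
  simpa [div_pow] using h.pow 2

theorem isBigO_comp_const_div {f : ℝ → ℝ} (d : ℝ) (hf : f =O[𝓝 0] fun δ => δ) :
    (fun N : ℕ => f (d / N)) =O[atTop] (fun N : ℕ => 1 / (N : ℝ)) :=
  (hf.comp_tendsto (isBigO_const_div d).1).trans (isBigO_const_div d).2.1

theorem isBigO_comp_const_div_sq {f : ℝ → ℝ} (d : ℝ) (hf : f =O[𝓝 0] fun δ => δ ^ 2) :
    (fun N : ℕ => f (d / N)) =O[atTop] (fun N : ℕ => 1 / (N : ℝ) ^ 2) :=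
  (hf.comp_tendsto (isBigO_const_div d).1).trans (isBigO_const_div d).2.2

end Expansions

/-! ### Asymptotics of the LUE density -/

section LaguerreAsymptotics
open Set Topology

theorem natCast_mul_isBigO {f : ℕ → ℝ} (hf : f =O[atTop] fun N : ℕ => 1 / (N : ℝ) ^ 2) :
    (fun N : ℕ => (N : ℝ) * f N) =O[atTop] fun N : ℕ => 1 / (N : ℝ) := by
  refine ((isBigO_refl (fun N : ℕ => (N : ℝ)) atTop).mul hf).congr' EventuallyEq.rfl ?_
  filter_upwards [eventually_gt_atTop 0] with N hN
  have : (0 : ℝ) < N := by exact_mod_cast hN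
  field_simp

theorem isBigO_inv_nat_sq_mul {f g : ℕ → ℝ} (hf : f =O[atTop] fun N : ℕ => 1 / (N : ℝ))
    (hg : g =O[atTop] fun N : ℕ => 1 / (N : ℝ)) :
    (fun N => f N * g N) =O[atTop] fun N : ℕ => 1 / (N : ℝ) ^ 2 := by
  simpa [← mul_inv, ← pow_two] using hf.mul hg

theorem inv_nat_isBigO_one : (fun N : ℕ => 1 / (N : ℝ)) =O[atTop] fun _ => (1 : ℝ) :=
  (tendsto_const_div_atTop_nhds_zero_nat 1).isBigO_one ℝ

theorem inv_nat_sq_isBigO_one : (fun N : ℕ => 1 / (N : ℝ) ^ 2) =O[atTop] fun _ => (1 : ℝ) := by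
  simpa using inv_nat_isBigO_one.pow 2

theorem cos_isBigO_one (θ : ℕ → ℝ) : (fun N => Real.cos (θ N)) =O[atTop] fun _ => (1 : ℝ) :=
  IsBigO.of_bound 1 (Eventually.of_forall fun N => by simpa using Real.abs_cos_le_one (θ N))

theorem cos_sub_cos_isBigO {θ φ : ℕ → ℝ}
    (h : (fun N => θ N - φ N) =O[atTop] fun N : ℕ => 1 / (N : ℝ)) :
    (fun N => Real.cos (θ N) - Real.cos (φ N)) =O[atTop] fun N : ℕ => 1 / (N : ℝ) := by
  refine (IsBigO.of_bound 1 (Eventually.of_forall fun N => ?_)).trans h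
  rw [one_mul, Real.norm_eq_abs, Real.norm_eq_abs]
  exact Real.abs_cos_sub_cos_le _ _

theorem abs_mul_div_of_pos {a b : ℝ} (ha : 0 < a) (hb : 0 < b) (x : ℝ) :
    |a * (x / b)| = a * (|x| / b) := by
  rw [abs_mul, abs_div, abs_of_pos ha, abs_of_pos hb]

/-- Multiplication by N turns the first-order term of the phase into a constant shift and the
quadratic remainder into O(1/N), which is admissible inside a cosine that carries a factor 1/N. -/
theorem scaled_phase_isBigO {X : ℝ} (hX : 0 < X) (hX1 : X < 1) (K d : ℝ) :
    (fun N : ℕ => K * N * ((1 + d / N) * bulkPhase √(X / (1 + d / N)) - bulkPhase √X)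
      - K * d / 2 * Real.arcsin √X) =O[atTop] fun N : ℕ => 1 / (N : ℝ) := by
  have h := (natCast_mul_isBigO (isBigO_comp_const_div_sq d (phase_isBigO hX hX1))).const_mul_left K
  refine h.congr' ?_ EventuallyEq.rfl
  filter_upwards [eventually_gt_atTop 0] with N hN
  have : (0 : ℝ) < N := by exact_mod_cast hN
  field_simp

/-- The scaled point stays in a fixed compact part of the bulk, where the uniform bound on the
quadratic form applies. -/
theorem eventually_scaled_mem {X : ℝ} (hX : 0 < X) (hX1 : X < 1) (d : ℝ) :
    ∀ᶠ N : ℕ in atTop, 0 < N ∧ X < 1 + d / N ∧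
      √(X / (1 + d / N)) ∈ Icc (√X / 2) ((1 + √X) / 2) := by
  have hsX : 0 < √X := Real.sqrt_pos.mpr hX
  have hsX1 : √X < 1 := (Real.sqrt_lt' one_pos).mpr (by simpa using hX1)
  have hcont := (hasDerivAt_sqrt_div hX (δ := 0) (by linarith)).continuousAt
  have h1 : Tendsto (fun δ : ℝ => √(X / (1 + δ))) (𝓝 0) (𝓝 √X) := by
    simpa [ContinuousAt] using hcont
  have h2 := h1.eventually (Icc_mem_nhds (by linarith : √X / 2 < √X) (by linarith : √X < (1 + √X) / 2))
  have h3 := (isBigO_const_div d).1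
  filter_upwards [eventually_gt_atTop 0, h3.eventually (eventually_lt_one_add hX1), h3.eventually h2]
    with N a b c using ⟨a, b, c⟩

/-- The density is the gamma quotient 1 + O(N⁻²) times the quadratic form at Y N = √(X/(1+d/N)). The
form is E + O(N⁻²), where E keeps Y and L exact, and Taylor expansion replaces E by the target T. -/
theorem lueDensity_asymptotics {α X : ℝ} (hα : -1 < α) (hX : 0 < X) (hX1 : X < 1) :
    (fun N : ℕ => lueDensity α N X - (2 / Real.pi * √(1 / X - 1)
      - (Real.cos (8 * N * bulkPhase √X + 2 * α * Real.arcsin √X - α * Real.pi)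
          / (4 * Real.pi * X * (1 - X)) - α / (2 * Real.pi * (√X * √(1 - X)))) * (1 / (N : ℝ))))
      =O[atTop] fun N : ℕ => 1 / (N : ℝ) ^ 2 := by
  have hpi := Real.pi_pos
  have hsX : 0 < √X := Real.sqrt_pos.mpr hX
  have hsX1 : √X < 1 := (Real.sqrt_lt' one_pos).mpr (by simpa using hX1)
  have hs1X : 0 < √(1 - X) := Real.sqrt_pos.mpr (by linarith)
  set d := (α + 1) / 2 with hd
  set L : ℕ → ℝ := fun N => 4 * N + 2 * α + 2 with hL
  set Y : ℕ → ℝ := fun N => √(X / (1 + d / N)) with hY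
  set c : ℕ → ℝ := fun N => √(1 - Y N ^ 2) with hc
  set Θ : ℕ → ℝ := fun N => 2 * L N * bulkPhase (Y N) - 2 * Real.arcsin (Y N) - α * Real.pi with hΘ
  set θ : ℕ → ℝ := fun N => 8 * N * bulkPhase √X + 2 * α * Real.arcsin √X - α * Real.pi with hθ
  set q := √X * √(1 - X) with hq
  have hq0 : 0 < q := mul_pos hsX hs1X
  have hκ : 0 < besselAmplitude α := by
    have := Real.Gamma_pos_of_pos (by linarith : 0 < α + 1)
    have := Real.rpow_pos_of_pos two_pos (α + 1 / 2)
    rw [besselAmplitude]; positivity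
  obtain ⟨C, L₀, hC, hL₀, hD⟩ := exists_bound_densityForm (α := α) 1 2 hα
    (by linarith : 0 < √X / 2) (by linarith : (1 + √X) / 2 < 1)
  have hLN : ∀ N : ℕ, 0 < N → 4 * (N : ℝ) ≤ L N := fun N _ => by simp only [hL]; linarith
  have hmem := eventually_scaled_mem hX hX1 d
  have hLd : ∀ N : ℕ, 0 < N → L N = 4 * N * (1 + d / N) := fun N hN => by
    have : (0 : ℝ) < N := by exact_mod_cast hN
    simp only [hL, hd]; field_simp; ring
  have hinvL : (fun N => 1 / L N - 1 / (4 * (N : ℝ))) =O[atTop] fun N : ℕ => 1 / (N : ℝ) ^ 2 := by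
    refine IsBigO.of_bound ((2 * α + 2) / 16) ?_
    filter_upwards [eventually_gt_atTop 0] with N hN
    have hN0 : (0 : ℝ) < N := by exact_mod_cast hN
    have h1 := hLN N hN
    have h2 : 0 < L N := by linarith
    have e : 1 / L N - 1 / (4 * (N : ℝ)) = -((2 * α + 2) / (4 * N * L N)) := by
      field_simp; simp only [hL]; ring
    have h3 : 0 < 2 * α + 2 := by linarith
    rw [e, norm_neg, Real.norm_eq_abs, Real.norm_eq_abs,
      abs_of_pos (div_pos h3 (by positivity)), abs_of_pos (by positivity)]
    calc (2 * α + 2) / (4 * N * L N) ≤ (2 * α + 2) / (4 * N * (4 * N)) := by gcongr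
      _ = _ := by field_simp; norm_num
  have hinvL' : (fun N => 1 / L N) =O[atTop] fun N : ℕ => 1 / (N : ℝ) := by
    refine IsBigO.of_bound 1 ?_
    filter_upwards [eventually_gt_atTop 0] with N hN
    have hN0 : (0 : ℝ) < N := by exact_mod_cast hN
    have h1 := hLN N hN
    rw [one_mul, Real.norm_eq_abs, Real.norm_eq_abs, abs_of_pos (one_div_pos.mpr (by linarith)),
      abs_of_pos (by positivity)]
    exact one_div_le_one_div_of_le hN0 (by linarith)
  -- As 2L = 8N(1+d/N), the phase shift is 4d arcsin √X = 2(α+1) arcsin √X; the term −2 arcsin Y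
  -- from the phase identity reduces it to 2α arcsin √X.
  have hphase : (fun N => Θ N - θ N) =O[atTop] fun N : ℕ => 1 / (N : ℝ) := by
    have h1 := scaled_phase_isBigO hX hX1 8 d
    have h2 := (isBigO_comp_const_div d (arcsin_isBigO hX hX1)).const_mul_left 2
    refine (h1.sub h2).congr' ?_ EventuallyEq.rfl
    filter_upwards [eventually_gt_atTop 0] with N hN
    simp only [hΘ, hθ]
    rw [hLd N hN]
    simp only [hY, hd]
    ring
  obtain ⟨h1, h2, -, -⟩ := inv_sqrt_mul_isBigO hX hX1
  have h1 := isBigO_comp_const_div d h1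
  have h2 := isBigO_comp_const_div d h2
  have h2' : (fun N => 1 / (2 * Y N ^ 2 * c N ^ 2)) =O[atTop] fun _ => (1 : ℝ) := by
    have := (h2.trans inv_nat_isBigO_one).add
      (isBigO_const_const (1 / (2 * X * (1 - X))) one_ne_zero atTop)
    simpa using this
  have ha : (fun N => (1 / (Y N * c N) + Real.cos (Θ N) * (1 / (2 * Y N ^ 2 * c N ^ 2)))
      - (1 / q + Real.cos (θ N) * (1 / (2 * X * (1 - X))))) =O[atTop] fun N : ℕ => 1 / (N : ℝ) := by
    have h3 := (cos_sub_cos_isBigO hphase).mul h2'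
    have h4 := (cos_isBigO_one θ).mul h2
    simp only [mul_one, one_mul] at h3 h4
    refine ((h1.add h3).add h4).congr_left fun N => ?_
    simp only [hY, hc, hq]; ring
  have ha' : (fun N => 1 / q + Real.cos (θ N) * (1 / (2 * X * (1 - X)))) =O[atTop] fun _ => (1 : ℝ) := by
    have := (cos_isBigO_one θ).mul (isBigO_const_const (1 / (2 * X * (1 - X))) one_ne_zero atTop)
    simp only [mul_one] at this
    exact (isBigO_const_const (1 / q) one_ne_zero atTop).add this
  have hF := isBigO_comp_const_div_sq d (sqrt_ratio_isBigO hX hX1)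
  set T : ℕ → ℝ := fun N => 2 / Real.pi * √(1 / X - 1)
      - (Real.cos (θ N) / (4 * Real.pi * X * (1 - X)) - α / (2 * Real.pi * q)) * (1 / (N : ℝ)) with hT
  set E : ℕ → ℝ := fun N => 2 / Real.pi * (√((1 + d / N) / X - 1)
      - (1 / (Y N * c N) + Real.cos (Θ N) * (1 / (2 * Y N ^ 2 * c N ^ 2))) * (1 / L N)) with hE
  have hFq : X * √(1 / X - 1) = q := by
    rw [show 1 / X - 1 = (1 - X) / X by field_simp, Real.sqrt_div (by linarith), hq]
    have : √X ^ 2 = X := Real.sq_sqrt hX.le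
    field_simp; rw [this]
  have hET : (fun N => E N - T N) =O[atTop] fun N : ℕ => 1 / (N : ℝ) ^ 2 := by
    have h3 := isBigO_inv_nat_sq_mul ha hinvL'
    have h4 := ha'.mul hinvL
    simp only [one_mul] at h4
    refine (((hF.sub h3).sub h4).const_mul_left (2 / Real.pi)).congr' ?_ EventuallyEq.rfl
    filter_upwards [eventually_gt_atTop 0] with N hN
    have hN0 : (N : ℝ) ≠ 0 := by exact_mod_cast hN.ne'
    have h1X : 1 - X ≠ 0 := by linarith
    simp only [hE, hT]
    rw [show 2 * X * √(1 / X - 1) = 2 * q by rw [← hFq]; ring]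
    -- The square root contributes (α+1)/(4Nq), and the term −1/c of the phase identity removes
    -- 1/(4Nq); what remains is the non-oscillating correction proportional to α.
    have e1 : d / N * (1 / (2 * q)) = (α + 1) / (4 * N * q) := by rw [hd]; field_simp; norm_num
    rw [e1]
    generalize √(1 / X - 1) = F
    generalize √((1 + d / N) / X - 1) = F'
    generalize Real.cos (θ N) = ct
    generalize Real.cos (Θ N) * (1 / (2 * Y N ^ 2 * c N ^ 2)) = z
    generalize 1 / (Y N * c N) = z'
    generalize 1 / L N = l
    field_simp
    ring
  have hT1 : T =O[atTop] fun _ => (1 : ℝ) := by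
    have h5 : (fun N => Real.cos (θ N) / (4 * Real.pi * X * (1 - X)) - α / (2 * Real.pi * q))
        =O[atTop] fun _ => (1 : ℝ) := by
      have := (cos_isBigO_one θ).mul
        (isBigO_const_const (1 / (4 * Real.pi * X * (1 - X))) one_ne_zero atTop)
      simp only [mul_one] at this
      refine (this.sub (isBigO_const_const (α / (2 * Real.pi * q)) one_ne_zero atTop)).congr_left
        fun N => by ring
    have h6 := h5.mul inv_nat_isBigO_one
    simp only [mul_one] at h6
    exact (isBigO_const_const _ one_ne_zero atTop).sub h6
  have hE1 : E =O[atTop] fun _ => (1 : ℝ) := by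
    simpa using (hET.trans inv_nat_sq_isBigO_one).add hT1
  have hR := gammaRatio_sub_one_isBigO hα
  have hR1 : (gammaRatio α) =O[atTop] fun _ => (1 : ℝ) := by
    simpa using (hR.trans inv_nat_sq_isBigO_one).add (isBigO_const_const (1 : ℝ) one_ne_zero atTop)
  set D : ℕ → ℝ := fun N => densityForm α 1 2 (L N) (laguerreW α N (L N)) (laguerreV α N (L N)) (L N * Y N)
    with hDd
  have hLtop : ∀ᶠ N : ℕ in atTop, L₀ ≤ L N := by
    filter_upwards [eventually_gt_atTop 0, tendsto_natCast_atTop_atTop.eventually (eventually_ge_atTop L₀)]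
      with N hN hN1
    have h3 := hLN N hN
    have h4 : (0 : ℝ) < N := by exact_mod_cast hN
    linarith
  have hDE : (fun N => 2 / (Real.pi * Y N) * (D N / besselAmplitude α ^ 2) - E N)
      =O[atTop] fun N : ℕ => 1 / (N : ℝ) ^ 2 := by
    refine IsBigO.of_bound (2 / (Real.pi * (√X / 2)) * (C / besselAmplitude α ^ 2)) ?_
    filter_upwards [hmem, hLtop] with N ⟨hN, hX', hYm⟩ hLN0
    have hN0 : (0 : ℝ) < N := by exact_mod_cast hN
    obtain ⟨hY0, hY1⟩ := sqrt_div_lt_one hX hX'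
    have h3 := hD (L N) _ _ hLN0 (isRegularSolution_laguerre hα N) (Y N) hYm
    have hYN : 0 < Y N := hY0
    have hYN1 : Y N < 1 := hY1
    have hc2 : 0 < 1 - Y N ^ 2 := by nlinarith
    have hcN : 0 < c N := Real.sqrt_pos.mpr hc2
    have hphase := laguerre_phase_identity (y := Y N) (c := c N)
      (ψ := besselArg α - L N * bulkPhase (Y N)) (Real.sin_arcsin (by linarith) hYN1.le)
      (Real.cos_arcsin _) hYN hcN
    rw [show √(1 - Y N ^ 2) = c N from rfl, hphase,
      show Real.sin (2 * (besselArg α - L N * bulkPhase (Y N)) + 2 * Real.arcsin (Y N)) = Real.cos (Θ N) by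
        rw [← Real.cos_pi_div_two_sub]
        congr 1
        simp only [hΘ, besselArg]; ring] at h3
    have hratio : √((1 + d / N) / X - 1) = c N / Y N := by
      have h5 : 0 < 1 + d / N := hX.trans hX'
      have h4 : Y N ^ 2 = X / (1 + d / N) := Real.sq_sqrt (by positivity)
      have h6 : (1 + d / N) / X = 1 / Y N ^ 2 := by rw [h4]; field_simp
      rw [h6, show 1 / Y N ^ 2 - 1 = (1 - Y N ^ 2) / Y N ^ 2 by field_simp, Real.sqrt_div hc2.le,
        Real.sqrt_sq hYN.le]
    have hLpos : 0 < L N := by linarith [hLN N hN]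
    have e : 2 / (Real.pi * Y N) * (D N / besselAmplitude α ^ 2) - E N
        = 2 / (Real.pi * Y N) * ((D N - besselAmplitude α ^ 2 * (c N + (-(1 / c N)
          - Real.cos (Θ N) / (2 * Y N * c N ^ 2)) / L N)) / besselAmplitude α ^ 2) := by
      simp only [hE]
      rw [hratio]
      field_simp
      ring
    rw [e, Real.norm_eq_abs, Real.norm_eq_abs, abs_mul_div_of_pos (by positivity) (pow_pos hκ 2),
      abs_of_pos (by positivity : 0 < 1 / (N : ℝ) ^ 2)]
    have h7 : C / L N ^ 2 ≤ C * (1 / (N : ℝ) ^ 2) := by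
      rw [mul_one_div]; gcongr; linarith [hLN N hN]
    have h8 : √X / 2 ≤ Y N := hYm.1
    calc _ ≤ 2 / (Real.pi * (√X / 2)) * (C * (1 / (N : ℝ) ^ 2) / besselAmplitude α ^ 2) := by
          gcongr
          exact h3.trans h7
      _ = _ := by ring
  have hρ : ∀ᶠ N : ℕ in atTop, lueDensity α N X
      = gammaRatio α N * (2 / (Real.pi * Y N) * (D N / besselAmplitude α ^ 2)) := by
    filter_upwards [hmem] with N ⟨hN, hX', hYm⟩
    have hN0 : (0 : ℝ) < N := by exact_mod_cast hN
    obtain ⟨hY0, hY1⟩ := sqrt_div_lt_one hX hX'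
    have h5 : 0 < 1 + d / N := hX.trans hX'
    have h4 : Y N ^ 2 = X / (1 + d / N) := Real.sq_sqrt (by positivity)
    have h6 := lueDensity_eq_densityForm hα hN hX (L := L N) (y := Y N) rfl hY0
      (by
        have := h5.ne'
        rw [h4, hLd N hN]
        generalize 1 + d / (N : ℝ) = e at this ⊢
        field_simp)
    have hYN : 0 < Y N := hY0
    have hDN : densityForm α 1 2 (L N) (laguerreW α N (L N)) (laguerreV α N (L N)) (L N * Y N) = D N := rfl
    rw [eq_comm, ← sub_eq_zero]
    have h7 : besselAmplitude α ^ 2 * (gammaRatio α N * (2 / (Real.pi * Y N) * (D N / besselAmplitude α ^ 2))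
      - lueDensity α N X) = 0 := by
      rw [mul_sub, h6, hDN]; field_simp; ring
    exact (mul_eq_zero.mp h7).resolve_left (pow_pos hκ 2).ne'
  have h9 := (((hR1.mul hDE).congr_right (g₂ := fun N : ℕ => 1 / (N : ℝ) ^ 2) (fun N => by ring)).add
      ((hR.mul hE1).congr_right (g₂ := fun N : ℕ => 1 / (N : ℝ) ^ 2) (fun N => by ring))).add hET
  refine h9.congr' ?_ EventuallyEq.rfl
  filter_upwards [hρ] with N hN
  rw [hN]; ring

end LaguerreAsymptotics

/-! ### Asymptotics of the GUE density for positive x -/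

section HermiteAsymptotics
open Set Topology

/-- The Laguerre parameter governing the Hermite polynomial of degree `N`, according to parity. -/
noncomputable def hermiteIndex (N : ℕ) : ℝ := if Even N then -1 / 2 else 1 / 2

theorem hermiteIndex_even (m : ℕ) : hermiteIndex (2 * m) = -1 / 2 := by simp [hermiteIndex]

theorem hermiteIndex_odd (m : ℕ) : hermiteIndex (2 * m + 1) = 1 / 2 := by simp [hermiteIndex]

theorem neg_one_lt_hermiteIndex (N : ℕ) : -1 < hermiteIndex N := by
  rw [hermiteIndex]; split_ifs <;> norm_num

theorem besselAmplitude_hermiteIndex (N : ℕ) : besselAmplitude (hermiteIndex N) = 1 := by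
  rw [hermiteIndex]; split_ifs
  · exact besselAmplitude_neg_half
  · exact besselAmplitude_half

theorem four_mul_div_two_add_hermiteIndex (N : ℕ) :
    4 * ((N / 2 : ℕ) : ℝ) + 2 * hermiteIndex N + 2 = 2 * N + 1 := by
  obtain ⟨m, rfl | rfl⟩ := N.even_or_odd'
  · rw [hermiteIndex_even, show 2 * m / 2 = m by omega]; push_cast; ring
  · rw [hermiteIndex_odd, show (2 * m + 1) / 2 = m by omega]; push_cast; ring

/-- The Bessel phase is 0 for parameter −1/2 and π/2 for 1/2, so parity of N enters as a sign,
written as the phase Nπ to treat both parities uniformly. -/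
theorem cos_two_mul_besselArg_hermiteIndex_sub (N : ℕ) (u : ℝ) :
    Real.cos (2 * besselArg (hermiteIndex N) - u) = Real.cos (N * Real.pi + u) := by
  obtain ⟨m, rfl | rfl⟩ := N.even_or_odd'
  · rw [hermiteIndex_even, besselArg,
      show 2 * (-1 / 2 * Real.pi / 2 + Real.pi / 4) - u = -u by ring, Real.cos_neg,
      show ((2 * m : ℕ) : ℝ) * Real.pi + u = u + m * (2 * Real.pi) by push_cast; ring,
      Real.cos_add_nat_mul_two_pi]
  · rw [hermiteIndex_odd, besselArg,
      show 2 * (1 / 2 * Real.pi / 2 + Real.pi / 4) - u = Real.pi - u by ring, Real.cos_pi_sub,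
      show ((2 * m + 1 : ℕ) : ℝ) * Real.pi + u = (u + Real.pi) + m * (2 * Real.pi) by push_cast; ring,
      Real.cos_add_nat_mul_two_pi, Real.cos_add_pi]

theorem gammaRatio_hermiteIndex_sub_one_isBigO :
    (fun N : ℕ => gammaRatio (hermiteIndex N) (N / 2) - 1) =O[atTop] fun N : ℕ => 1 / (N : ℝ) ^ 2 := by
  have hdiv : Tendsto (fun N : ℕ => N / 2) atTop atTop := Nat.tendsto_div_const_atTop two_ne_zero
  have hhalf : (fun N : ℕ => 1 / ((N / 2 : ℕ) : ℝ) ^ 2) =O[atTop] fun N : ℕ => 1 / (N : ℝ) ^ 2 := by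
    refine IsBigO.of_bound 9 ?_
    filter_upwards [eventually_ge_atTop 2] with N hN
    have h1 : (0 : ℝ) < (N / 2 : ℕ) := by exact_mod_cast (by omega : 0 < N / 2)
    have h2 : (N : ℝ) ≤ 3 * (N / 2 : ℕ) := by exact_mod_cast (by omega : N ≤ 3 * (N / 2))
    have h3 : (0 : ℝ) < N := by exact_mod_cast (by omega : 0 < N)
    rw [Real.norm_eq_abs, Real.norm_eq_abs, abs_of_pos (by positivity), abs_of_pos (by positivity),
      mul_one_div, div_le_div_iff₀ (by positivity) (by positivity)]
    nlinarith
  have h : ∀ α : ℝ, -1 < α → ∃ C, ∀ᶠ N : ℕ in atTop,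
      ‖gammaRatio α (N / 2) - 1‖ ≤ C * ‖1 / (N : ℝ) ^ 2‖ := fun α hα =>
    (((gammaRatio_sub_one_isBigO hα).comp_tendsto hdiv).trans hhalf).bound
  obtain ⟨C₁, h₁⟩ := h (-1 / 2) (by norm_num)
  obtain ⟨C₂, h₂⟩ := h (1 / 2) (by norm_num)
  refine IsBigO.of_bound (max C₁ C₂) ?_
  filter_upwards [h₁, h₂] with N h₁ h₂
  rw [hermiteIndex]
  split_ifs
  · exact h₁.trans (mul_le_mul_of_nonneg_right (le_max_left _ _) (norm_nonneg _))
  · exact h₂.trans (mul_le_mul_of_nonneg_right (le_max_right _ _) (norm_nonneg _))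

theorem gueDensity_eq_densityForm {N : ℕ} (hN : 0 < N) {x t L : ℝ} (hL : L = 2 * N + 1)
    (ht : t = √(2 * N) * x) (ht0 : 0 < t) :
    gueDensity N x = √(2 * N) / N * (√L / Real.pi) * gammaRatio (hermiteIndex N) (N / 2) *
      densityForm (hermiteIndex N) 0 1 L (laguerreW (hermiteIndex N) (N / 2) L)
        (laguerreV (hermiteIndex N) (N / 2) L) (√L * t) := by
  obtain ⟨m, rfl | rfl⟩ := N.even_or_odd'
  · rw [hermiteIndex_even, show 2 * m / 2 = m by omega]
    exact gueDensity_even_eq (by omega) (by rw [hL]; push_cast; ring) ht ht0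
  · rw [hermiteIndex_odd, show (2 * m + 1) / 2 = m by omega]
    exact gueDensity_odd_eq m (by rw [hL]; push_cast; ring) ht ht0

theorem exists_bound_densityForm_hermiteIndex {y₀ y₁ : ℝ} (h₀ : 0 < y₀) (h₁ : y₁ < 1) :
    ∃ C, 0 ≤ C ∧ ∀ᶠ N : ℕ in atTop, ∀ L : ℝ, L = 2 * N + 1 → ∀ y ∈ Icc y₀ y₁,
      |densityForm (hermiteIndex N) 0 1 L (laguerreW (hermiteIndex N) (N / 2) L)
          (laguerreV (hermiteIndex N) (N / 2) L) (L * y)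
        - (√(1 - y ^ 2) + (Real.sin (besselArg (hermiteIndex N) - L * bulkPhase y)
              * Real.cos (besselArg (hermiteIndex N) - L * bulkPhase y) * (y / √(1 - y ^ 2) ^ 2 - 0 / y)
            - 1 * Real.cos (besselArg (hermiteIndex N) - L * bulkPhase y) ^ 2 / √(1 - y ^ 2)) / L)|
        ≤ C / L ^ 2 := by
  obtain ⟨C₁, L₁, hC₁, -, hb₁⟩ := exists_bound_densityForm (α := -1 / 2) 0 1 (by norm_num) h₀ h₁
  obtain ⟨C₂, L₂, hC₂, -, hb₂⟩ := exists_bound_densityForm (α := 1 / 2) 0 1 (by norm_num) h₀ h₁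
  refine ⟨max C₁ C₂, hC₁.trans (le_max_left _ _), ?_⟩
  filter_upwards [tendsto_natCast_atTop_atTop.eventually (eventually_ge_atTop (max L₁ L₂)),
    eventually_gt_atTop 0] with N hN hN0 L hL y hy
  have hN0' : (0 : ℝ) < N := by exact_mod_cast hN0
  have hreg := isRegularSolution_laguerre (neg_one_lt_hermiteIndex N) (N / 2)
  have hamp := besselAmplitude_hermiteIndex N
  rw [four_mul_div_two_add_hermiteIndex, ← hL] at hreg
  have hL1 : L₁ ≤ L := by linarith [(le_max_left L₁ L₂).trans hN]
  have hL2 : L₂ ≤ L := by linarith [(le_max_right L₁ L₂).trans hN]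
  rcases N.even_or_odd with h | h
  · have hi : hermiteIndex N = -1 / 2 := if_pos h
    rw [hi] at hreg hamp ⊢
    have := hb₁ L _ _ hL1 hreg y hy
    rw [hamp, one_pow, one_mul] at this
    exact this.trans (div_le_div_of_nonneg_right (le_max_left _ _) (sq_nonneg L))
  · have hi : hermiteIndex N = 1 / 2 := if_neg (Nat.not_even_iff_odd.mpr h)
    rw [hi] at hreg hamp ⊢
    have := hb₂ L _ _ hL2 hreg y hy
    rw [hamp, one_pow, one_mul] at this
    exact this.trans (div_le_div_of_nonneg_right (le_max_right _ _) (sq_nonneg L))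

/-- The scheme of the LUE with d = 1/2. The arcsine in the phase identity cancels the phase shift
caused by L = 2N(1+d/N), and the non-oscillating part cancels the first-order term of the square
root, so the 1/N correction is purely oscillating. -/
theorem gueDensity_asymptotics_of_pos {x : ℝ} (hx : 0 < x) (hx1 : x < 1) :
    (fun N : ℕ => gueDensity N x - (2 / Real.pi * √(1 - x ^ 2)
      - Real.cos (N * Real.pi + 4 * N * bulkPhase x) / (2 * Real.pi * (1 - x ^ 2)) * (1 / (N : ℝ))))
      =O[atTop] fun N : ℕ => 1 / (N : ℝ) ^ 2 := by
  have hpi := Real.pi_pos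
  set X := x ^ 2 with hXx
  have hX : 0 < X := by positivity
  have hX1 : X < 1 := by rw [hXx]; nlinarith
  have hsX' : √X = x := Real.sqrt_sq hx.le
  have hs1X : 0 < √(1 - X) := Real.sqrt_pos.mpr (by linarith)
  have hs1X2 : √(1 - X) ^ 2 = 1 - X := Real.sq_sqrt (by linarith)
  set d : ℝ := 1 / 2 with hd
  set L : ℕ → ℝ := fun N => 2 * N + 1 with hL
  set Y : ℕ → ℝ := fun N => √(X / (1 + d / N)) with hY
  set c : ℕ → ℝ := fun N => √(1 - Y N ^ 2) with hc
  set Θ : ℕ → ℝ := fun N => 2 * (besselArg (hermiteIndex N) - L N * bulkPhase (Y N))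
    + Real.arcsin (Y N) with hΘ
  set θ : ℕ → ℝ := fun N => 2 * besselArg (hermiteIndex N) - 4 * N * bulkPhase x with hθ
  have hθcos : ∀ N : ℕ, Real.cos (N * Real.pi + 4 * N * bulkPhase x) = Real.cos (θ N) := fun N => by
    simp only [hθ]; rw [cos_two_mul_besselArg_hermiteIndex_sub]
  simp only [hθcos]
  obtain ⟨C, hC, hD⟩ := exists_bound_densityForm_hermiteIndex
    (by rw [hsX']; linarith : 0 < √X / 2) (by rw [hsX']; linarith : (1 + √X) / 2 < 1)
  have hmem := eventually_scaled_mem hX hX1 d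
  have hLd : ∀ N : ℕ, 0 < N → L N = 2 * N * (1 + d / N) := fun N hN => by
    have : (0 : ℝ) < N := by exact_mod_cast hN
    simp only [hL, hd]; field_simp
  have hYx : (fun N => Y N - x) =O[atTop] fun N : ℕ => 1 / (N : ℝ) := by
    have h1 := (hasDerivAt_sqrt_div hX (δ := 0) (by linarith)).isBigO_sub
    simp only [sub_zero, add_zero, div_one, hsX'] at h1
    exact isBigO_comp_const_div d h1
  -- This is √(1+d/N)/L: the outer prefactor √(1+d/N) = x/Y is absorbed into 1/L.
  set l : ℕ → ℝ := fun N => Y N / (2 * N * x) with hl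
  have hinvL : (fun N => l N - 1 / (2 * (N : ℝ))) =O[atTop] fun N : ℕ => 1 / (N : ℝ) ^ 2 := by
    refine ((isBigO_inv_nat_sq_mul hYx (isBigO_refl (fun N : ℕ => 1 / (N : ℝ)) atTop)).const_mul_left
      (1 / (2 * x))).congr' ?_ EventuallyEq.rfl
    filter_upwards [eventually_gt_atTop 0] with N hN
    have hN0 : (0 : ℝ) < N := by exact_mod_cast hN
    simp only [hl]
    generalize Y N = z
    field_simp
  have hinvL' : l =O[atTop] fun N : ℕ => 1 / (N : ℝ) := by
    have h1 : (fun N : ℕ => 1 / (N : ℝ) ^ 2) =O[atTop] fun N : ℕ => 1 / (N : ℝ) := by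
      have := inv_nat_isBigO_one.mul (isBigO_refl (fun N : ℕ => 1 / (N : ℝ)) atTop)
      simp only [one_mul] at this
      exact this.congr_left fun N => by ring
    refine ((hinvL.trans h1).add ((isBigO_refl (fun N : ℕ => 1 / (N : ℝ)) atTop).const_mul_left
      (1 / 2))).congr_left fun N => by ring
  have hphase : (fun N => Θ N - θ N) =O[atTop] fun N : ℕ => 1 / (N : ℝ) := by
    have h1 := scaled_phase_isBigO hX hX1 4 d
    have h2 := isBigO_comp_const_div d (arcsin_isBigO hX hX1)
    refine (h2.sub h1).congr' ?_ EventuallyEq.rfl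
    filter_upwards [eventually_gt_atTop 0] with N hN
    simp only [hΘ, hθ]
    rw [hLd N hN]
    simp only [hY, hd, hsX']
    ring
  obtain ⟨-, -, h1, h2⟩ := inv_sqrt_mul_isBigO hX hX1
  have h1 := (isBigO_comp_const_div d h1).const_mul_left (1 / 2)
  have h2 := isBigO_comp_const_div d h2
  have h2' : (fun N => 1 / (2 * c N ^ 2)) =O[atTop] fun _ => (1 : ℝ) := by
    have := (h2.trans inv_nat_isBigO_one).add
      (isBigO_const_const (1 / (2 * (1 - X))) one_ne_zero atTop)
    simpa using this
  have ha : (fun N => (1 / 2 * (1 / c N) + Real.cos (Θ N) * (1 / (2 * c N ^ 2)))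
      - (1 / 2 * (1 / √(1 - X)) + Real.cos (θ N) * (1 / (2 * (1 - X)))))
      =O[atTop] fun N : ℕ => 1 / (N : ℝ) := by
    have h3 := (cos_sub_cos_isBigO hphase).mul h2'
    have h4 := (cos_isBigO_one θ).mul h2
    simp only [mul_one, one_mul] at h3 h4
    refine ((h1.add h3).add h4).congr_left fun N => ?_
    simp only [hY, hc]; ring
  have ha' : (fun N => 1 / 2 * (1 / √(1 - X)) + Real.cos (θ N) * (1 / (2 * (1 - X))))
      =O[atTop] fun _ => (1 : ℝ) := by
    have := (cos_isBigO_one θ).mul (isBigO_const_const (1 / (2 * (1 - X))) one_ne_zero atTop)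
    simp only [mul_one] at this
    exact (isBigO_const_const (1 / 2 * (1 / √(1 - X))) one_ne_zero atTop).add this
  have hF := (isBigO_comp_const_div_sq d (sqrt_ratio_isBigO hX hX1)).const_mul_left x
  set T : ℕ → ℝ := fun N => 2 / Real.pi * √(1 - X)
      - Real.cos (θ N) / (2 * Real.pi * (1 - X)) * (1 / (N : ℝ)) with hT
  set E : ℕ → ℝ := fun N => 2 / Real.pi * (x * √((1 + d / N) / X - 1)
      - (1 / 2 * (1 / c N) + Real.cos (Θ N) * (1 / (2 * c N ^ 2))) * l N) with hE
  have hFq : √(1 / X - 1) = √(1 - X) / x := by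
    rw [show 1 / X - 1 = (1 - X) / X by field_simp, Real.sqrt_div (by linarith), hsX']
  have hET : (fun N => E N - T N) =O[atTop] fun N : ℕ => 1 / (N : ℝ) ^ 2 := by
    have h3 := isBigO_inv_nat_sq_mul ha hinvL'
    have h4 := ha'.mul hinvL
    simp only [one_mul] at h4
    refine (((hF.sub h3).sub h4).const_mul_left (2 / Real.pi)).congr' ?_ EventuallyEq.rfl
    filter_upwards [eventually_gt_atTop 0] with N hN
    have hN0 : (N : ℝ) ≠ 0 := by exact_mod_cast hN.ne'
    have h1X : 1 - X ≠ 0 := by linarith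
    simp only [hE, hT]
    rw [hFq]
    have e1 : d / N * (1 / (2 * X * (√(1 - X) / x))) = 1 / (4 * N * x * √(1 - X)) := by
      rw [hd, hXx] ; field_simp; norm_num
    rw [e1]
    generalize √(1 - X) = F at *
    generalize √((1 + d / N) / X - 1) = F'
    generalize Real.cos (θ N) = ct
    generalize Real.cos (Θ N) * (1 / (2 * c N ^ 2)) = z
    generalize 1 / c N = z'
    generalize l N = l
    generalize X = X at *
    field_simp
    ring
  have hT1 : T =O[atTop] fun _ => (1 : ℝ) := by
    have h5 : (fun N => Real.cos (θ N) / (2 * Real.pi * (1 - X))) =O[atTop] fun _ => (1 : ℝ) := by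
      have := (cos_isBigO_one θ).mul
        (isBigO_const_const (1 / (2 * Real.pi * (1 - X))) one_ne_zero atTop)
      simp only [mul_one] at this
      exact this.congr_left fun N => by ring
    have h6 := h5.mul inv_nat_isBigO_one
    simp only [mul_one] at h6
    exact (isBigO_const_const _ one_ne_zero atTop).sub h6
  have hE1 : E =O[atTop] fun _ => (1 : ℝ) := by
    simpa using (hET.trans inv_nat_sq_isBigO_one).add hT1
  have hR := gammaRatio_hermiteIndex_sub_one_isBigO
  set R : ℕ → ℝ := fun N => gammaRatio (hermiteIndex N) (N / 2) with hRd
  have hR1 : R =O[atTop] fun _ => (1 : ℝ) := by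
    simpa using (hR.trans inv_nat_sq_isBigO_one).add (isBigO_const_const (1 : ℝ) one_ne_zero atTop)
  set D : ℕ → ℝ := fun N => densityForm (hermiteIndex N) 0 1 (L N)
    (laguerreW (hermiteIndex N) (N / 2) (L N)) (laguerreV (hermiteIndex N) (N / 2) (L N)) (L N * Y N)
    with hDd
  have hfacts : ∀ N : ℕ, 0 < N → X < 1 + d / N → 0 < Y N ∧ Y N < 1 ∧ Y N ^ 2 = X / (1 + d / N) ∧
      √(1 + d / N) = x / Y N ∧ x * √((1 + d / N) / X - 1) = x / Y N * c N ∧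
      x / Y N * (1 / L N) = l N := fun N hN hX' => by
    have hN0 : (0 : ℝ) < N := by exact_mod_cast hN
    obtain ⟨hY0, hY1⟩ := sqrt_div_lt_one hX hX'
    have hYN : 0 < Y N := hY0
    have hYN1 : Y N < 1 := hY1
    have h5 : 0 < 1 + d / N := hX.trans hX'
    have h4 : Y N ^ 2 = X / (1 + d / N) := Real.sq_sqrt (by positivity)
    have h6 : 1 + d / N = x ^ 2 / Y N ^ 2 := by rw [h4, hXx]; field_simp
    refine ⟨hYN, hYN1, h4, ?_, ?_, ?_⟩
    · rw [h6, Real.sqrt_div (by positivity), Real.sqrt_sq hx.le, Real.sqrt_sq hYN.le]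
    · rw [h6, hXx, show x ^ 2 / Y N ^ 2 / x ^ 2 - 1 = (1 - Y N ^ 2) / Y N ^ 2 by field_simp,
        Real.sqrt_div (by nlinarith), Real.sqrt_sq hYN.le]
      simp only [hc]; ring
    · rw [hLd N hN, h6]; simp only [hl]
      generalize Y N = z at hYN
      field_simp
  have hDE : (fun N : ℕ => 2 / Real.pi * √(1 + d / N) * D N - E N)
      =O[atTop] fun N : ℕ => 1 / (N : ℝ) ^ 2 := by
    refine IsBigO.of_bound (2 / Real.pi * (x / (√X / 2)) * C) ?_
    filter_upwards [hmem, hD] with N ⟨hN, hX', hYm⟩ hDN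
    have hN0 : (0 : ℝ) < N := by exact_mod_cast hN
    obtain ⟨hYN, hYN1, h4, hs, hr, hlN⟩ := hfacts N hN hX'
    have h3 := hDN (L N) rfl (Y N) hYm
    have hcN : 0 < c N := Real.sqrt_pos.mpr (by nlinarith)
    have hphase := hermite_phase_identity (y := Y N) (c := c N)
      (ψ := besselArg (hermiteIndex N) - L N * bulkPhase (Y N)) (Real.sin_arcsin (by linarith) hYN1.le)
      (Real.cos_arcsin _) hcN
    rw [show √(1 - Y N ^ 2) = c N from rfl, hphase] at h3
    have hLpos : 0 < L N := by simp only [hL]; positivity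
    have e : 2 / Real.pi * √(1 + d / N) * D N - E N
        = 2 / Real.pi * (x / Y N) * (D N - (c N + (-(1 / (2 * c N))
          - Real.cos (Θ N) / (2 * c N ^ 2)) / L N)) := by
      simp only [hE]
      rw [hr, ← hlN, hs]
      field_simp
      ring
    rw [e, Real.norm_eq_abs, Real.norm_eq_abs, abs_mul, abs_of_pos (by positivity),
      abs_of_pos (by positivity : 0 < 1 / (N : ℝ) ^ 2)]
    have h7 : C / L N ^ 2 ≤ C * (1 / (N : ℝ) ^ 2) := by
      rw [mul_one_div]; gcongr; simp only [hL]; linarith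
    have h8 : √X / 2 ≤ Y N := hYm.1
    have h9 : 0 < √X / 2 := by rw [hsX']; positivity
    calc _ ≤ 2 / Real.pi * (x / (√X / 2)) * (C * (1 / (N : ℝ) ^ 2)) := by
          gcongr
          exact h3.trans h7
      _ = _ := by ring
  have hρ : ∀ᶠ N : ℕ in atTop, gueDensity N x = R N * (2 / Real.pi * √(1 + d / N) * D N) := by
    filter_upwards [hmem] with N ⟨hN, hX', hYm⟩
    have hN0 : (0 : ℝ) < N := by exact_mod_cast hN
    obtain ⟨hYN, hYN1, h4, hs, hr, hlN⟩ := hfacts N hN hX'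
    have h2N : √(2 * (N : ℝ)) ^ 2 = 2 * N := Real.sq_sqrt (by positivity)
    have hsL : √(L N) = √(2 * N) * (x / Y N) := by
      rw [hLd N hN, Real.sqrt_mul (by positivity), hs]
    have h6 := gueDensity_eq_densityForm hN (x := x) (L := L N) rfl rfl (by positivity)
    have harg : √(L N) * (√(2 * N) * x) = L N * Y N := by
      have h7 : 1 + d / N = (x / Y N) ^ 2 := by rw [← hs, Real.sq_sqrt (hX.trans hX').le]
      rw [hsL, hLd N hN, h7]
      calc _ = √(2 * (N : ℝ)) ^ 2 * (x / Y N) * x := by ring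
        _ = _ := by rw [h2N]; field_simp
    rw [harg] at h6
    rw [h6, show densityForm (hermiteIndex N) 0 1 (L N) (laguerreW (hermiteIndex N) (N / 2) (L N))
      (laguerreV (hermiteIndex N) (N / 2) (L N)) (L N * Y N) = D N from rfl,
      show gammaRatio (hermiteIndex N) (N / 2) = R N from rfl, hsL, hs]
    have h7 : √(2 * (N : ℝ)) / N * (√(2 * N) * (x / Y N) / Real.pi) = 2 / Real.pi * (x / Y N) := by
      calc _ = √(2 * (N : ℝ)) ^ 2 / N * (x / Y N / Real.pi) := by ring
        _ = _ := by rw [h2N]; field_simp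
    rw [h7]; ring
  have h9 := (((hR1.mul hDE).congr_right (g₂ := fun N : ℕ => 1 / (N : ℝ) ^ 2) (fun N => by ring)).add
    ((hR.mul hE1).congr_right (g₂ := fun N : ℕ => 1 / (N : ℝ) ^ 2) (fun N => by ring))).add hET
  refine h9.congr' ?_ EventuallyEq.rfl
  filter_upwards [hρ] with N hN
  rw [hN]; ring

end HermiteAsymptotics

/-! ### The GUE at the origin and for negative x -/

section HermiteAsymptotics
open Set Topology

theorem hermiteMonic_eval_neg_sq (k : ℕ) (t : ℝ) :
    (hermiteMonic k).eval (-t) ^ 2 = (hermiteMonic k).eval t ^ 2 := by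
  obtain ⟨m, rfl | rfl⟩ := k.even_or_odd'
  · simp [(hermiteMonic_eq_laguerreMonic_comp m).1]
  · simp [(hermiteMonic_eq_laguerreMonic_comp m).2]

theorem gueDensity_neg {N : ℕ} (hN : 0 < N) (x : ℝ) : gueDensity N (-x) = gueDensity N x := by
  simp only [gueDensity_eq_sum hN, mul_neg, neg_sq, hermiteMonic_eval_neg_sq]

theorem bulkPhase_neg (y : ℝ) : bulkPhase (-y) = -bulkPhase y := by
  simp only [bulkPhase, Real.arcsin_neg, neg_sq]; ring

theorem cos_natCast_mul_pi_sub (N : ℕ) (u : ℝ) :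
    Real.cos (N * Real.pi - u) = Real.cos (N * Real.pi + u) := by
  rw [Real.cos_sub, Real.cos_add, Real.sin_nat_mul_pi]; ring

theorem abs_sqrt_one_add_sub_le {δ : ℝ} (hδ : 0 ≤ δ) :
    |√(1 + δ) - (1 + δ / 2)| ≤ 2 * δ ^ 2 ∧ |1 / √(1 + δ) - (1 - δ / 2)| ≤ 2 * δ ^ 2 := by
  have h1 : 1 ≤ √(1 + δ) := Real.one_le_sqrt.mpr (by linarith)
  have h2 : √(1 + δ) ^ 2 = 1 + δ := Real.sq_sqrt (by linarith)
  generalize √(1 + δ) = r at *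
  obtain rfl : δ = r ^ 2 - 1 := by linarith
  have h3 : (r ^ 2 - 1) ^ 2 = (r - 1) ^ 2 * (r + 1) ^ 2 := by ring
  have h4 : 4 * (r - 1) ^ 2 ≤ (r ^ 2 - 1) ^ 2 := by
    rw [h3]; nlinarith [mul_nonneg (sq_nonneg (r - 1)) (by nlinarith : (0 : ℝ) ≤ (r + 1) ^ 2 - 4)]
  constructor
  · rw [show r - (1 + (r ^ 2 - 1) / 2) = -((r - 1) ^ 2 / 2) by ring, abs_neg,
      abs_of_nonneg (by positivity)]
    nlinarith [sq_nonneg (r - 1)]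
  · have hr : 0 < r := by linarith
    rw [show 1 / r - (1 - (r ^ 2 - 1) / 2) = (r - 1) ^ 2 * ((r + 2) / (2 * r)) by field_simp; ring,
      abs_of_nonneg (by positivity)]
    have h5 : (r + 2) / (2 * r) ≤ 3 / 2 := by rw [div_le_iff₀ (by positivity)]; linarith
    nlinarith [mul_le_mul_of_nonneg_left h5 (sq_nonneg (r - 1)), sq_nonneg (r - 1)]

/-- The factor S is (1+1/(2N))^(−1/2) for even N and (1+1/(2N))^(1/2) for odd N; the sign of its
1/(4N) term is −cos(Nπ). -/
theorem gueDensity_zero_eq {N : ℕ} (hN : 0 < N) :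
    ∃ S : ℝ, |S - (1 - Real.cos (N * Real.pi) * (1 / (4 * N)))| ≤ 1 / (N : ℝ) ^ 2 ∧
      gueDensity N 0 = 2 / Real.pi * (S * gammaRatio (hermiteIndex N) (N / 2)) := by
  have hpi := Real.pi_pos
  have hN0 : (0 : ℝ) < N := by exact_mod_cast hN
  obtain ⟨h1, h2⟩ := abs_sqrt_one_add_sub_le (δ := 1 / (2 * N)) (by positivity)
  have h3 : 2 * (1 / (2 * (N : ℝ))) ^ 2 ≤ 1 / (N : ℝ) ^ 2 := by
    rw [div_pow, one_pow, mul_one_div, div_le_div_iff₀ (by positivity) (by positivity)]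
    nlinarith [sq_nonneg (N : ℝ)]
  have h4 : 1 / (2 * (N : ℝ)) / 2 = 1 / (4 * N) := by field_simp; norm_num
  have h5 : √(2 * (N : ℝ) + 1) = √(2 * N) * √(1 + 1 / (2 * N)) := by
    rw [← Real.sqrt_mul (by positivity)]; congr 1; field_simp
  have h6 : 0 < √(2 * (N : ℝ)) := Real.sqrt_pos.mpr (by positivity)
  have h7 : 0 < √(1 + 1 / (2 * (N : ℝ))) := Real.sqrt_pos.mpr (by positivity)
  have h8 : √(2 * (N : ℝ)) ^ 2 = 2 * N := Real.sq_sqrt (by positivity)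
  obtain ⟨m, hm⟩ := N.even_or_odd'
  rcases hm with hm | hm
  · refine ⟨1 / √(1 + 1 / (2 * N)), ?_, ?_⟩
    · have : Real.cos (N * Real.pi) = 1 := by
        rw [Real.cos_nat_mul_pi, hm]; simp
      rw [this, one_mul, ← h4]
      exact h2.trans h3
    · have h9 : (4 * (m : ℝ) + 1) = 2 * N + 1 := by rw [hm]; push_cast; ring
      have h10 := (gueDensity_zero m).1 (by omega)
      rw [h9, ← hm, h5] at h10
      rw [h10, show N / 2 = m by omega, show hermiteIndex N = -1 / 2 by rw [hm, hermiteIndex_even]]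
      field_simp
  · refine ⟨√(1 + 1 / (2 * N)), ?_, ?_⟩
    · have : Real.cos (N * Real.pi) = -1 := by
        rw [Real.cos_nat_mul_pi, hm, pow_succ, pow_mul]; simp
      rw [this, neg_one_mul, sub_neg_eq_add, ← h4]
      exact h1.trans h3
    · have h9 : (4 * (m : ℝ) + 3) = 2 * N + 1 := by rw [hm]; push_cast; ring
      have h10 := (gueDensity_zero m).2
      rw [h9, ← hm, h5] at h10
      rw [h10, show N / 2 = m by omega, show hermiteIndex N = 1 / 2 by rw [hm, hermiteIndex_odd]]
      calc _ = √(2 * (N : ℝ)) ^ 2 / N * (√(1 + 1 / (2 * N)) / Real.pi * gammaRatio (1 / 2) m) := by ring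
        _ = _ := by rw [h8]; field_simp

theorem gueDensity_zero_asymptotics :
    (fun N : ℕ => gueDensity N 0 - (2 / Real.pi - Real.cos (N * Real.pi) / (2 * Real.pi) * (1 / (N : ℝ))))
      =O[atTop] fun N : ℕ => 1 / (N : ℝ) ^ 2 := by
  have hpi := Real.pi_pos
  choose! S hS hρ using fun (N : ℕ) (hN : 0 < N) => gueDensity_zero_eq hN
  have hR := gammaRatio_hermiteIndex_sub_one_isBigO
  have h1 : (fun N : ℕ => S N - (1 - Real.cos (N * Real.pi) * (1 / (4 * N))))
      =O[atTop] fun N : ℕ => 1 / (N : ℝ) ^ 2 := by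
    refine IsBigO.of_bound 1 ?_
    filter_upwards [eventually_gt_atTop 0] with N hN
    rw [one_mul, Real.norm_eq_abs, Real.norm_eq_abs, abs_of_nonneg (by positivity : 0 ≤ 1 / (N : ℝ) ^ 2)]
    exact hS N hN
  have h2 : (fun N : ℕ => 1 - Real.cos (N * Real.pi) * (1 / (4 * N))) =O[atTop] fun _ => (1 : ℝ) := by
    have h3 := ((cos_isBigO_one fun N : ℕ => N * Real.pi).mul inv_nat_isBigO_one).const_mul_left (1 / 4)
    simp only [mul_one] at h3
    refine ((isBigO_const_const (1 : ℝ) one_ne_zero atTop).sub h3).congr_left fun N => ?_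
    simp only [one_div, mul_inv]; ring
  have hS1 : S =O[atTop] fun _ => (1 : ℝ) := by
    simpa using (h1.trans inv_nat_sq_isBigO_one).add h2
  have h3 := (hS1.mul hR).congr_right (g₂ := fun N : ℕ => 1 / (N : ℝ) ^ 2) (fun N => by ring)
  refine ((h3.add h1).const_mul_left (2 / Real.pi)).congr' ?_ EventuallyEq.rfl
  filter_upwards [eventually_gt_atTop 0] with N hN
  have hN0 : (0 : ℝ) < N := by exact_mod_cast hN
  rw [hρ N hN]
  field_simp
  ring

theorem gueDensity_asymptotics {x : ℝ} (hx : |x| < 1) :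
    (fun N : ℕ => gueDensity N x - (2 / Real.pi * √(1 - x ^ 2)
      - Real.cos (N * Real.pi + 4 * N * bulkPhase x) / (2 * Real.pi * (1 - x ^ 2)) * (1 / (N : ℝ))))
      =O[atTop] fun N : ℕ => 1 / (N : ℝ) ^ 2 := by
  obtain ⟨hl, hr⟩ := abs_lt.mp hx
  rcases lt_trichotomy x 0 with h | rfl | h
  · refine (gueDensity_asymptotics_of_pos (x := -x) (by linarith) (by linarith)).congr' ?_ EventuallyEq.rfl
    filter_upwards [eventually_gt_atTop 0] with N hN
    rw [gueDensity_neg hN, bulkPhase_neg, neg_sq, mul_neg, ← sub_eq_add_neg, cos_natCast_mul_pi_sub]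
  · simpa [bulkPhase_zero] using gueDensity_zero_asymptotics
  · exact gueDensity_asymptotics_of_pos h hr

end HermiteAsymptotics

/-! ### The limiting distribution functions in terms of g -/

section DistributionFunctions
open Set Topology

theorem continuous_bulkPhase : Continuous bulkPhase := by
  unfold bulkPhase
  exact (Real.continuous_arcsin.add
    (continuous_id.mul ((continuous_const.sub (continuous_pow 2)).sqrt))).div_const 2

theorem semicircle_eq {x : ℝ} (hx : |x| < 1) : semicircle x = 2 / Real.pi * √(1 - x ^ 2) :=
  if_pos ⟨(abs_lt.mp hx).1.le, (abs_lt.mp hx).2.le⟩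

theorem marcenkoPastur_eq {x : ℝ} (hx : 0 < x) (hx1 : x < 1) :
    marcenkoPastur x = 2 / Real.pi * √(1 / x - 1) := if_pos ⟨hx, hx1.le⟩

/-- Nonnegativity of the derivative supplies integrability, which is needed because the
Marčenko–Pastur density is unbounded at 0. -/
theorem integral_eq_sub_of_hasDerivAt_of_nonneg {f f' : ℝ → ℝ} {a b : ℝ} (hab : a ≤ b)
    (hf : ContinuousOn f (Icc a b)) (hd : ∀ t ∈ Ioo a b, HasDerivAt f (f' t) t)
    (h0 : ∀ t ∈ Ioo a b, 0 ≤ f' t) : ∫ t in a..b, f' t = f b - f a := by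
  refine intervalIntegral.integral_eq_sub_of_hasDerivAt_of_le hab hf hd ?_
  refine intervalIntegral.intervalIntegrable_deriv_of_nonneg (g := f) ?_ ?_ ?_
  · rwa [uIcc_of_le hab]
  · rwa [min_eq_left hab, max_eq_right hab]
  · rwa [min_eq_left hab, max_eq_right hab]

theorem semicircleCdf_eq_bulkPhase {x : ℝ} (hx : |x| < 1) :
    semicircleCdf x = 1 / 2 + 2 / Real.pi * bulkPhase x := by
  obtain ⟨hl, hr⟩ := abs_lt.mp hx
  have hpi := Real.pi_pos
  have hlt : ∀ t ∈ Ioo (-1) x, |t| < 1 := fun t ht => abs_lt.mpr ⟨ht.1, ht.2.trans hr⟩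
  rw [semicircleCdf, integral_eq_sub_of_hasDerivAt_of_nonneg (f := fun t => 2 / Real.pi * bulkPhase t) hl.le
    (continuous_const.mul continuous_bulkPhase).continuousOn]
  · have : bulkPhase (-1) = -(Real.pi / 4) := by
      rw [bulkPhase, Real.arcsin_neg_one]; norm_num; ring
    rw [this]; field_simp; ring
  · intro t ht
    rw [semicircle_eq (hlt t ht)]
    exact (hasDerivAt_bulkPhase (hlt t ht)).const_mul _
  · intro t ht
    rw [semicircle_eq (hlt t ht)]
    positivity

theorem marcenkoPasturCdf_eq_bulkPhase {x : ℝ} (hx : 0 < x) (hx1 : x < 1) :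
    marcenkoPasturCdf x = 4 / Real.pi * bulkPhase √x := by
  rw [marcenkoPasturCdf, integral_eq_sub_of_hasDerivAt_of_nonneg
    (f := fun t => 4 / Real.pi * bulkPhase √t) hx.le
    (continuous_const.mul (continuous_bulkPhase.comp Real.continuous_sqrt)).continuousOn]
  · simp [bulkPhase_zero]
  · intro t ht
    have ht1 : t < 1 := ht.2.trans hx1
    have hst : 0 < √t := Real.sqrt_pos.mpr ht.1
    have hst1 : |√t| < 1 := by
      rw [abs_of_pos hst, Real.sqrt_lt' one_pos]; simpa using ht1
    rw [marcenkoPastur_eq ht.1 ht1]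
    refine ((HasDerivAt.comp (h₂ := bulkPhase) t (hasDerivAt_bulkPhase hst1)
      (Real.hasDerivAt_sqrt ht.1.ne')).const_mul (4 / Real.pi)).congr_deriv ?_
    rw [Real.sq_sqrt ht.1.le, show 1 / t - 1 = (1 - t) / t by have := ht.1; field_simp,
      Real.sqrt_div (by linarith)]
    field_simp
    ring
  · intro t ht
    rw [marcenkoPastur_eq ht.1 (ht.2.trans hx1)]
    positivity

theorem semicircleCdf_eq_arccos {x : ℝ} (hx : |x| < 1) :
    semicircleCdf x = 1 + x / 2 * semicircle x - 1 / Real.pi * Real.arccos x := by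
  have hpi := Real.pi_pos
  rw [semicircleCdf_eq_bulkPhase hx, semicircle_eq hx, Real.arccos, bulkPhase]
  field_simp
  ring

theorem mul_sqrt_one_div_sub_one {x : ℝ} (hx : 0 < x) (hx1 : x < 1) :
    x * √(1 / x - 1) = √x * √(1 - x) := by
  have h1 : √x ^ 2 = x := Real.sq_sqrt hx.le
  have h2 : 0 < √x := Real.sqrt_pos.mpr hx
  rw [show 1 / x - 1 = (1 - x) / x by field_simp, Real.sqrt_div (by linarith)]
  calc x * (√(1 - x) / √x) = √x ^ 2 * (√(1 - x) / √x) := by rw [h1]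
    _ = _ := by field_simp

theorem marcenkoPasturCdf_eq_arccos {x : ℝ} (hx : 0 < x) (hx1 : x < 1) :
    marcenkoPasturCdf x = 1 + x * marcenkoPastur x - 2 / Real.pi * Real.arccos √x := by
  have hpi := Real.pi_pos
  rw [marcenkoPasturCdf_eq_bulkPhase hx hx1, marcenkoPastur_eq hx hx1, Real.arccos, bulkPhase,
    Real.sq_sqrt hx.le, mul_left_comm, mul_sqrt_one_div_sub_one hx hx1]
  field_simp
  ring

end DistributionFunctions

/-! ### The theorem -/

theorem mainTheorem1 :
    (∀ x : ℝ, |x| < 1 →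
      semicircleCdf x = 1 + x / 2 * semicircle x - 1 / Real.pi * Real.arccos x ∧
      (fun N : ℕ => gueDensity N x -
          (semicircle x -
            2 * Real.cos (2 * (N : ℝ) * Real.pi * semicircleCdf x) /
              (Real.pi ^ 3 * semicircle x ^ 2) * (1 / (N : ℝ))))
        =O[atTop] (fun N : ℕ => 1 / (N : ℝ) ^ 2)) ∧
    (∀ α : ℝ, -1 < α → ∀ x : ℝ, 0 < x → x < 1 →
      marcenkoPasturCdf x =
        1 + x * marcenkoPastur x - 2 / Real.pi * Real.arccos (Real.sqrt x) ∧
      (fun N : ℕ => lueDensity α N x -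
          (marcenkoPastur x -
            (Real.cos (2 * (N : ℝ) * Real.pi * marcenkoPasturCdf x -
                  α * Real.pi * (1 + x * marcenkoPastur x - marcenkoPasturCdf x)) /
                (Real.pi ^ 3 * x ^ 2 * marcenkoPastur x ^ 2) -
              α / (Real.pi ^ 2 * x * marcenkoPastur x)) * (1 / (N : ℝ))))
        =O[atTop] (fun N : ℕ => 1 / (N : ℝ) ^ 2) ∧
      (fun N : ℕ => lueDensity α N x -
          (marcenkoPastur x -
            (Real.cos (2 * (N : ℝ) * Real.pi * marcenkoPasturCdf x -
                  2 * α * Real.arccos (Real.sqrt x)) /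
                (Real.pi ^ 3 * x ^ 2 * marcenkoPastur x ^ 2) -
              α / (2 * Real.pi * Real.sqrt (x * (1 - x)))) * (1 / (N : ℝ))))
        =O[atTop] (fun N : ℕ => 1 / (N : ℝ) ^ 2)) := by
  have hpi := Real.pi_pos
  refine ⟨fun x hx => ⟨semicircleCdf_eq_arccos hx, ?_⟩,
    fun α hα x hx hx1 => ⟨marcenkoPasturCdf_eq_arccos hx hx1, ?_⟩⟩
  · have h1 : 0 < 1 - x ^ 2 := by have := (sq_lt_one_iff_abs_lt_one x).mpr hx; linarith
    refine (gueDensity_asymptotics hx).congr_left fun N => ?_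
    -- The summand Nπ, which carried the parity of N, is the value 1/2 of the distribution function
    -- at the origin.
    have h2 : 2 * (N : ℝ) * Real.pi * semicircleCdf x = N * Real.pi + 4 * N * bulkPhase x := by
      rw [semicircleCdf_eq_bulkPhase hx]; field_simp; ring
    have h3 : Real.pi ^ 3 * semicircle x ^ 2 = 2 * (2 * Real.pi * (1 - x ^ 2)) := by
      rw [semicircle_eq hx, mul_pow, Real.sq_sqrt h1.le]; field_simp
    rw [h2, h3, mul_div_mul_left _ _ two_ne_zero, semicircle_eq hx]
  · have h1 : 0 < 1 - x := by linarith
    have hxρ : x * marcenkoPastur x = 2 / Real.pi * (√x * √(1 - x)) := by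
      rw [marcenkoPastur_eq hx hx1, mul_left_comm, mul_sqrt_one_div_sub_one hx hx1]
    have hq : 0 < √x * √(1 - x) := mul_pos (Real.sqrt_pos.mpr hx) (Real.sqrt_pos.mpr h1)
    have hq2 : (√x * √(1 - x)) ^ 2 = x * (1 - x) := by
      rw [mul_pow, Real.sq_sqrt hx.le, Real.sq_sqrt h1.le]
    have hden : Real.pi ^ 3 * x ^ 2 * marcenkoPastur x ^ 2 = 4 * Real.pi * x * (1 - x) := by
      rw [mul_assoc, ← mul_pow, hxρ, mul_pow, hq2]; field_simp; norm_num
    have hphase (N : ℕ) : 2 * (N : ℝ) * Real.pi * marcenkoPasturCdf x = 8 * N * bulkPhase √x := by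
      rw [marcenkoPasturCdf_eq_bulkPhase hx hx1]; field_simp; ring
    -- The closed form of the distribution function makes the two stated phases equal.
    have hshift : α * Real.pi * (1 + x * marcenkoPastur x - marcenkoPasturCdf x)
        = 2 * α * Real.arccos √x := by
      rw [marcenkoPasturCdf_eq_arccos hx hx1]; field_simp; ring
    have harg (N : ℕ) : 8 * N * bulkPhase √x - 2 * α * Real.arccos √x
        = 8 * N * bulkPhase √x + 2 * α * Real.arcsin √x - α * Real.pi := by
      rw [Real.arccos]; ring
    have hα1 : α / (Real.pi ^ 2 * x * marcenkoPastur x) = α / (2 * Real.pi * (√x * √(1 - x))) := by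
      rw [mul_assoc, hxρ]; congr 1; field_simp
    have hα2 : √(x * (1 - x)) = √x * √(1 - x) := Real.sqrt_mul hx.le _
    have h := lueDensity_asymptotics hα hx hx1
    refine ⟨h.congr_left fun N => ?_, h.congr_left fun N => ?_⟩
    · rw [hphase, hshift, harg, hden, hα1, marcenkoPastur_eq hx hx1]
    · rw [hphase, harg, hden, hα2, marcenkoPastur_eq hx hx1]
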